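/- All logarithms are to base two. For a set $V$, a $k$-tuple in $V$ means a sequence $(v_1,\dots,v_k)$ of distinct elements of $V$; two $k$-tuples are disjoint if they have no entry in common. The $(k,\ell)$-path is the graph on $\{u_1,\dots,u_\ell\}$ whose edges are all $\{u_i,u_j\}$ with $0<j-i\le k$, and the $(k,\ell)$-tight-path is the $(k+1)$-uniform hypergraph on $\{u_1,\dots,u_\ell\}$ whose edges are all $\{u_i,u_{i+1},\dots,u_{i+k}\}$ with $1\le i\le \ell-k$. A $k$-path (respectively $k$-tight-path) from a $k$-tuple $\mathbf a$ to a disjoint $k$-tuple $\mathbf b$ is a graph (hypergraph) $P$ that is isomorphic to the $(k,\ell)$-path ($(k,\ell)$-tight-path) for some $\ell\ge 2k$, by an isomorphism that takes $(u_1,\dots,u_k)$ to $\mathbf a$ and $(u_{\ell-k+1},\dots,u_\ell)$ to $\mathbf b$. Let $A$ be a graph (a $(k+1)$-uniform hypergraph), let $\mathbf a,\mathbf b$ be disjoint $k$-tuples in $V(A)$ and let $X\subseteq V(A)$. Then $A$ is an $(\mathbf a,\mathbf b,X)$-absorber if for every $X'\subseteq X$ there is a $k$-path ($k$-tight-path)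 $P\subseteq A$ from $\mathbf a$ to $\mathbf b$ with $V(P)=V(A)\setminus X'$. Write $\mathcal G(n,p)$ for the random graph on $n$ vertices, and $\mathcal G^{(k+1)}(n,p)$ for the random $(k+1)$-uniform hypergraph on $n$ vertices, in which each possible edge is present with probability $p$, independently of all others. An event holds asymptotically almost surely (a.a.s.) if its probability tends to $1$ as $n\to\infty$. **Lemma 4.1.** For every integer $k\ge 2$ there is a constant $C>0$ such that the following holds for every $p=p(n)\in[0,1]$. If (i) $G\sim\mathcal G(n,p)$, where $p^k\ge C\log^8 n/n$ for all sufficiently large $n$, or (ii) $G\sim\mathcal G^{(k+1)}(n,p)$, where $p\ge C\log^8 n/n$ for all sufficiently large $n$, then a.a.s. there are a subset $X\subset V(G)$ of size $|X|=\left\lfloor \frac{n}{16\log^2 n}\right\rfloor$, disjoint $k$-tuples $\mathbf a,\mathbf b$ in $V(G)\setminus X$, and a subgraph (subhypergraph) $A\subseteq G$ with at most $n/2$ vertices that is an $(\mathbf a,\mathbf b,X)$-absorber. -/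

import Mathlib

namespace Absorbing

/-- The `(k, ℓ)`-path: the `k`-th power of a path on `ℓ` vertices `0, …, ℓ - 1`. Two vertices
`i`, `j` are joined when they are distinct and their positions differ by at most `k`. -/
def kPathGraph (k ℓ : ℕ) : SimpleGraph (Fin ℓ) where
  Adj i j := (i < j ∧ (j : ℕ) ≤ i + k) ∨ (j < i ∧ (i : ℕ) ≤ j + k)
  symm := ⟨fun _ _ h => h.symm⟩
  loopless := ⟨fun _ h => h.elim (fun h => lt_irrefl _ h.1) (fun h => lt_irrefl _ h.1)⟩

/-- The subgraph `P` of `G` is a `k`-path from the `k`-tuple `a` to the `k`-tuple `b` (tuples of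
distinct vertices): `P` is isomorphic to a `(k, ℓ)`-path with `ℓ ≥ 2k`, where the first `k`
vertices form `a` and the last `k` vertices form `b`, in this order. -/
def IsKPathFromTo {V : Type*} {G : SimpleGraph V} {k : ℕ} (P : G.Subgraph) (a b : Fin k ↪ V) :
    Prop :=
  ∃ (ℓ : ℕ) (hℓ : 2 * k ≤ ℓ) (f : kPathGraph k ℓ ≃g P.coe),
    (∀ i : Fin k, (f ⟨i, by omega⟩ : V) = a i) ∧
    (∀ i : Fin k, (f ⟨ℓ - k + i, by omega⟩ : V) = b i)

/-- The subgraph `A` of `G` is an `(a, b, X)`-absorber. -/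
structure IsAbsorber {V : Type*} {G : SimpleGraph V} {k : ℕ} (A : G.Subgraph) (a b : Fin k ↪ V)
    (X : Set V) : Prop where
  left_mem : ∀ i, a i ∈ A.verts
  right_mem : ∀ i, b i ∈ A.verts
  disjoint : Disjoint (Set.range a) (Set.range b)
  subset : X ⊆ A.verts
  absorbs : ∀ X' ⊆ X, ∃ P : G.Subgraph, P ≤ A ∧ IsKPathFromTo P a b ∧ P.verts = A.verts \ X'

/-- The `(k, ℓ)`-tight-path: the `(k + 1)`-uniform hypergraph on the `ℓ` vertices `0, …, ℓ - 1`
whose edges are the sets `{i, i + 1, …, i + k}` of `k + 1` consecutive vertices. -/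
def tightPath (k ℓ : ℕ) : Hypergraph (Fin ℓ) where
  vertexSet := Set.univ
  edgeSet := {e | ∃ i : ℕ, i + k < ℓ ∧ e = {j : Fin ℓ | i ≤ (j : ℕ) ∧ (j : ℕ) ≤ i + k}}
  subset_vertexSet_of_mem_edgeSet' := fun _ _ => Set.subset_univ _

/-- `H` is a subhypergraph of `G`: its vertices are vertices of `G`, its edges edges of `G`. -/
def IsSubhypergraph {V : Type*} (H G : Hypergraph V) : Prop :=
  H.vertexSet ⊆ G.vertexSet ∧ H.edgeSet ⊆ G.edgeSet

/-- The hypergraph `P` is a `k`-tight-path from the `k`-tuple `a` to the `k`-tuple `b` (tuples of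
distinct vertices): `P` is the image of a `(k, ℓ)`-tight-path with `ℓ ≥ 2k` under an injective map
(hence isomorphic to it), where the first `k` vertices form `a` and the last `k` vertices form `b`,
in this order. -/
def IsTightPathFromTo {V : Type*} {k : ℕ} (P : Hypergraph V) (a b : Fin k ↪ V) : Prop :=
  ∃ (ℓ : ℕ) (hℓ : 2 * k ≤ ℓ) (f : Fin ℓ ↪ V), P = (tightPath k ℓ).image f ∧
    (∀ i : Fin k, f ⟨i, by omega⟩ = a i) ∧
    (∀ i : Fin k, f ⟨ℓ - k + i, by omega⟩ = b i)

/-- The hypergraph `A` is an `(a, b, X)`-absorber. -/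
structure IsHyperAbsorber {V : Type*} {k : ℕ} (A : Hypergraph V) (a b : Fin k ↪ V)
    (X : Set V) : Prop where
  left_mem : ∀ i, a i ∈ A.vertexSet
  right_mem : ∀ i, b i ∈ A.vertexSet
  disjoint : Disjoint (Set.range a) (Set.range b)
  subset : X ⊆ A.vertexSet
  absorbs : ∀ X' ⊆ X, ∃ P : Hypergraph V, IsSubhypergraph P A ∧ IsTightPathFromTo P a b ∧
    P.vertexSet = A.vertexSet \ X'

/-- The hypergraph on the full vertex set `V` with edge set `E`. -/
def hypergraphOfEdges {V : Type*} (E : Set (Set V)) : Hypergraph V where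
  vertexSet := Set.univ
  edgeSet := E
  subset_vertexSet_of_mem_edgeSet' := fun _ _ => Set.subset_univ _

/-- The binomial random `r`-uniform hypergraph on `V`, given as the law of its edge set: every
`r`-element subset of `V` is an edge with probability `p`, independently of the others, and no
other set is an edge. -/
noncomputable def binomialRandomEdges (V : Type*) (r : ℕ) (p : unitInterval) :
    MeasureTheory.Measure (Set (Set V)) :=
  ProbabilityTheory.setBernoulli {e : Set V | e.ncard = r} p

/-- The number `⌊n / (16 log² n)⌋`, with the logarithm to base two. -/
noncomputable def absorbSize (n : ℕ) : ℕ := ⌊(n : ℝ) / (16 * Real.logb 2 n ^ 2)⌋₊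

/-- The graph `G` on `n` vertices contains an `(a, b, X)`-absorber with at most `n / 2` vertices,
for some set `X` of `⌊n / (16 log² n)⌋` vertices and disjoint `k`-tuples `a`, `b` of vertices
outside `X`. -/
def ContainsAbsorber (k n : ℕ) (G : SimpleGraph (Fin n)) : Prop :=
  ∃ (X : Set (Fin n)) (a b : Fin k ↪ Fin n) (A : G.Subgraph),
    X.ncard = absorbSize n ∧ (∀ i, a i ∉ X) ∧ (∀ i, b i ∉ X) ∧
    IsAbsorber A a b X ∧ (A.verts.ncard : ℝ) ≤ (n : ℝ) / 2

/-- The hypergraph `G` on `n` vertices contains an `(a, b, X)`-absorber with at most `n / 2`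
vertices, for some set `X` of `⌊n / (16 log² n)⌋` vertices and disjoint `k`-tuples `a`, `b` of
vertices outside `X`. -/
def ContainsHyperAbsorber (k n : ℕ) (G : Hypergraph (Fin n)) : Prop :=
  ∃ (X : Set (Fin n)) (a b : Fin k ↪ Fin n) (A : Hypergraph (Fin n)),
    X.ncard = absorbSize n ∧ (∀ i, a i ∉ X) ∧ (∀ i, b i ∉ X) ∧
    IsSubhypergraph A G ∧ IsHyperAbsorber A a b X ∧ (A.vertexSet.ncard : ℝ) ≤ (n : ℝ) / 2

end Absorbing

/-! ### Random subsets and minimum fragments. -/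

namespace RandomSubset

open Finset

variable {α ι : Type*} [DecidableEq α]

/-! The absorber is not built piece by piece. It is a copy of one explicit template of bounded
degree with at most n/2 vertices, and such a copy exists because the family of all copies is
sufficiently spread.

The template is a chain of `absorbSize n` gadgets. Each gadget has one core, which becomes an
element of X, and 2h+1 rows of M vertices, with h = M = ⌊log n⌋. It can be traversed as core, row 1,
…, row 2h+1, or without the core as row 2h, …, row 1, row 2h+1. Both traversals follow the last row
of the preceding gadget and end in the same row, so the choices in different gadgets are independent
and any set of cores can be avoided (`exists_sequence_avoiding`). The edges of the template are cut
out of walks in the digraph `Arc` by d shapes: the k pairs {0, j} for graphs, the single window {0,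
…, k} for hypergraphs.

Deterministically, a set T of template edges with c components must span at least |T|/d + 3c/2
vertices, up to an error of order |T|/log n (`isSparse_template`). By averaging there are a column
and a junction position whose removal destroys only a proportion O(1/log n) of T. The arcs that
remain form a zigzag (`AbsorberTemplate.isZigzag`): the vertices can be ranked so that every walk
has its highest vertex at one of its ends, and this vertex and the length determine the walk's
vertices. Hence each vertex is the highest one of at most d edges (`IsZigzag.hasHeads`), and
counting highest vertices gives the bound (`HasHeads.card_le`). The error costs a factor n^(O(1/log
n)) = O(1) per edge, which is why rows and gadgets have logarithmic length.

Probabilistically, sparsity implies that the proportion of copies containing T, times q^(-|T|), is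
at most n^(-c/2) β^|T| (`IsSparse.weight_le`). The sets T of size t generated by given root edges
number at most exponentially many in t (`card_generated_le`), so summing over T inside a family F
costs (1 + n^(-1/2))^|F| and leaves a geometric series in some θ (`IsSparse.sum_weight_le`). For a
whole copy this prefactor can be exp(O(√n)), which only terms with |T| ≥ √n can pay for. Hence there
are two rounds of exposure (`binomialExp_not_contains_le`): after the first, few minimum fragments
have √n or more edges; in the second, fragments with fewer than √n edges make the prefactor bounded.
The failure probability is O(θ), and θ is at most a constant times (log n)^(-8/d). -/

/-- The expectation of `g W`, where `W` is a random subset of `E` that contains every element of `E`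
independently with probability `p`. -/
noncomputable def binomialExp (E : Finset α) (p : ℝ) (g : Finset α → ℝ) : ℝ :=
  ∑ W ∈ E.powerset, p ^ #W * (1 - p) ^ #(E \ W) * g W

lemma binomialExp_empty (p : ℝ) (g : Finset α → ℝ) : binomialExp ∅ p g = g ∅ := by
  simp [binomialExp]

lemma binomialExp_insert {E : Finset α} {e : α} (he : e ∉ E) (p : ℝ) (g : Finset α → ℝ) :
    binomialExp (insert e E) p g =
      (1 - p) * binomialExp E p g + p * binomialExp E p (fun W ↦ g (insert e W)) := by
  unfold binomialExp
  rw [sum_powerset_insert he, mul_sum, mul_sum]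
  congr 1 <;> refine sum_congr rfl fun W hW ↦ ?_
  · have hW' : e ∉ W := fun h ↦ he (mem_powerset.1 hW h)
    rw [insert_sdiff_of_notMem _ hW', card_insert_of_notMem (by simp [he]), pow_succ]
    ring
  · have hW' : e ∉ W := fun h ↦ he (mem_powerset.1 hW h)
    rw [card_insert_of_notMem hW', insert_sdiff_insert, sdiff_insert_of_notMem he, pow_succ]
    ring

lemma binomialExp_mono {E : Finset α} {p : ℝ} (h0 : 0 ≤ p) (h1 : p ≤ 1) {g h : Finset α → ℝ}
    (hgh : ∀ W ⊆ E, g W ≤ h W) : binomialExp E p g ≤ binomialExp E p h := by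
  refine sum_le_sum fun W hW ↦ mul_le_mul_of_nonneg_left (hgh W (mem_powerset.1 hW)) ?_
  have : 0 ≤ 1 - p := by linarith
  positivity

lemma binomialExp_add (E : Finset α) (p : ℝ) (g h : Finset α → ℝ) :
    binomialExp E p (fun W ↦ g W + h W) = binomialExp E p g + binomialExp E p h := by
  simp only [binomialExp, mul_add, sum_add_distrib]

lemma binomialExp_const_mul (E : Finset α) (p c : ℝ) (g : Finset α → ℝ) :
    binomialExp E p (fun W ↦ c * g W) = c * binomialExp E p g := by
  simp only [binomialExp, mul_sum]
  exact sum_congr rfl fun W _ ↦ by ring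

lemma binomialExp_const (E : Finset α) (p c : ℝ) : binomialExp E p (fun _ ↦ c) = c := by
  induction E using Finset.induction_on with
  | empty => simp [binomialExp_empty]
  | insert e E he ih => rw [binomialExp_insert he, ih]; ring

/-- Exposing one element at a time, a larger density only shifts weight from `g W` to the smaller
value `g (insert e W)`. -/
lemma binomialExp_antitone_density {p q : ℝ} (hp : 0 ≤ p) (hpq : p ≤ q) (hq : q ≤ 1)
    (E : Finset α) (g : Finset α → ℝ) (hg : Antitone g) :
    binomialExp E q g ≤ binomialExp E p g := by
  induction E using Finset.induction_on generalizing g with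
  | empty => simp [binomialExp_empty]
  | insert e E he ih =>
    have h2 : Antitone fun W ↦ g (insert e W) := fun U W h ↦ hg (insert_subset_insert e h)
    rw [binomialExp_insert he, binomialExp_insert he]
    have h3 : binomialExp E p (fun W ↦ g (insert e W)) ≤ binomialExp E p g :=
      binomialExp_mono hp (hpq.trans hq) fun W _ ↦ hg (subset_insert e W)
    have h4 := mul_le_mul_of_nonneg_left (ih g hg) (sub_nonneg.2 hq)
    have h5 := mul_le_mul_of_nonneg_left (ih _ h2) (hp.trans hpq)
    nlinarith [mul_nonneg (sub_nonneg.2 hpq) (sub_nonneg.2 h3)]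

/-- The union of two independent random subsets of densities `a` and `b` is a random subset of
density `a + b - a * b`; for decreasing functions this bounds the expectation at density `p`. -/
lemma binomialExp_le_union {a b p : ℝ} (ha : 0 ≤ a) (ha1 : a ≤ 1) (hb : 0 ≤ b)
    (hp : a + b - a * b ≤ p) (hp1 : p ≤ 1) (E : Finset α) (g : Finset α → ℝ) (hg : Antitone g) :
    binomialExp E p g ≤ binomialExp E a fun W₁ ↦ binomialExp E b fun W₂ ↦ g (W₁ ∪ W₂) := by
  refine (binomialExp_antitone_density (by nlinarith) hp hp1 E g hg).trans (le_of_eq ?_)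
  clear hp hp1
  induction E using Finset.induction_on generalizing g with
  | empty => simp [binomialExp_empty]
  | insert e E he ih =>
    have h2 : Antitone fun W ↦ g (insert e W) := fun U W h ↦ hg (insert_subset_insert e h)
    simp only [binomialExp_insert he, insert_union, union_insert, insert_idem, ih g hg, ih _ h2,
      binomialExp_add, binomialExp_const_mul]
    ring

/-- Among the sets `F j`, `j ∈ Φ`, contained in `W ∪ F i` there is one that minimizes the number of
elements outside `W`. -/
lemma exists_minimal_fragment (Φ : Finset ι) (F : ι → Finset α) (W : Finset α) {i : ι}
    (hi : i ∈ Φ) :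
    ∃ j ∈ Φ, F j ⊆ W ∪ F i ∧ ∀ j' ∈ Φ, F j' ⊆ W ∪ F i → #(F j \ W) ≤ #(F j' \ W) := by
  classical
  obtain ⟨j, hj, hmin⟩ := exists_min_image (Φ.filter fun j ↦ F j ⊆ W ∪ F i)
    (fun j ↦ #(F j \ W)) ⟨i, by simp [hi]⟩
  simp only [mem_filter] at hj hmin
  exact ⟨j, hj.1, hj.2, fun j' h1 h2 ↦ hmin j' ⟨h1, h2⟩⟩

open Classical in
/-- The fragment of `F i` with respect to `W`: the part outside `W` of a set `F j ⊆ W ∪ F i` for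
which this part is smallest. -/
noncomputable def fragment (Φ : Finset ι) (F : ι → Finset α) (W : Finset α) (i : ι) : Finset α :=
  if hi : i ∈ Φ then F (exists_minimal_fragment Φ F W hi).choose \ W else ∅

lemma fragment_spec (Φ : Finset ι) (F : ι → Finset α) (W : Finset α) {i : ι} (hi : i ∈ Φ) :
    ∃ j ∈ Φ, fragment Φ F W i = F j \ W ∧ F j ⊆ W ∪ F i ∧
      ∀ j' ∈ Φ, F j' ⊆ W ∪ F i → #(fragment Φ F W i) ≤ #(F j' \ W) := by
  have h := (exists_minimal_fragment Φ F W hi).choose_spec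
  have he : fragment Φ F W i = F (exists_minimal_fragment Φ F W hi).choose \ W := by
    rw [fragment, dif_pos hi]
  exact ⟨_, h.1, he, h.2.1, by rw [he]; exact h.2.2⟩

lemma fragment_subset (Φ : Finset ι) (F : ι → Finset α) (W : Finset α) {i : ι} (hi : i ∈ Φ) :
    fragment Φ F W i ⊆ F i := by
  obtain ⟨j, _, he, hj, _⟩ := fragment_spec Φ F W hi
  rw [he]
  intro x hx
  rw [mem_sdiff] at hx
  exact (mem_union.1 (hj hx.1)).resolve_left hx.2

lemma disjoint_fragment (Φ : Finset ι) (F : ι → Finset α) (W : Finset α) {i : ι} (hi : i ∈ Φ) :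
    Disjoint W (fragment Φ F W i) := by
  obtain ⟨j, _, he, -⟩ := fragment_spec Φ F W hi
  rw [he]
  exact disjoint_sdiff

/-- A set `F j` inside `W ∪ fragment` contains the fragment. -/
lemma fragment_subset_of_subset_union {Φ : Finset ι} {F : ι → Finset α} {W : Finset α} {i j : ι}
    (hi : i ∈ Φ) (hj : j ∈ Φ) (h : F j ⊆ W ∪ fragment Φ F W i) : fragment Φ F W i ⊆ F j := by
  obtain ⟨_, _, _, _, hmin⟩ := fragment_spec Φ F W hi
  have h1 := hmin j hj (h.trans (union_subset_union_right (fragment_subset Φ F W hi)))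
  have h2 : F j \ W ⊆ fragment Φ F W i := by
    intro x hx
    rw [mem_sdiff] at hx
    exact (mem_union.1 (h hx.1)).resolve_left hx.2
  rw [← eq_of_subset_of_card_le h2 h1]
  exact sdiff_subset

/-- The expected number of indices whose fragment is bad is at most the supremum over the sets
`F j` of the weighted number of pairs `(T, i)` with `T ⊆ F j ∩ F i` bad. -/
lemma binomialExp_card_bad_fragment_le {E : Finset α} {Φ : Finset ι} {F : ι → Finset α}
    (hF : ∀ i ∈ Φ, F i ⊆ E) (bad : Finset α → Prop) [DecidablePred bad] {q M : ℝ} (hq : 0 < q) (hq1 : q ≤ 1)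
    (hM : 0 ≤ M)
    (h : ∀ j ∈ Φ, ∑ T ∈ (F j).powerset with bad T,
      (q⁻¹) ^ #T * (#{i ∈ Φ | T ⊆ F i} : ℝ) ≤ M) :
    binomialExp E q (fun W ↦ (#{i ∈ Φ | bad (fragment Φ F W i)} : ℝ)) ≤ M := by
  classical
  set w : Finset α → ℝ := fun W ↦ q ^ #W * (1 - q) ^ #(E \ W) with hw
  have h1q : 0 ≤ 1 - q := by linarith
  have hw0 : ∀ W, 0 ≤ w W := fun W ↦ by positivity
  -- Moving `T` into the random set multiplies the weight by (q / (1 - q)) ^ #T; the factor (1 - q)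
  -- ^ #T ≤ 1 is given away.
  have hwle : ∀ W T, W ∪ T ⊆ E → Disjoint W T → w W ≤ w (W ∪ T) * (q⁻¹) ^ #T := by
    intro W T hWT hd
    have hc : #(E \ W) = #(E \ (W ∪ T)) + #T := by
      rw [card_sdiff_of_subset (subset_union_left.trans hWT), card_sdiff_of_subset hWT,
        card_union_of_disjoint hd]
      have := card_le_card hWT
      rw [card_union_of_disjoint hd] at this
      omega
    have hone : (1 - q) ^ #T ≤ 1 := pow_le_one₀ h1q (by linarith)
    have : w (W ∪ T) * (q⁻¹) ^ #T = q ^ #W * (1 - q) ^ #(E \ (W ∪ T)) := by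
      simp only [hw]
      rw [card_union_of_disjoint hd, pow_add, inv_pow]
      field_simp
    rw [this]
    simp only [hw]
    rw [hc, pow_add, ← mul_assoc]
    exact mul_le_of_le_one_right (by positivity) hone
  -- all triples `(Z, T, i)`
  set U : Finset (Finset α × Finset α × ι) :=
    (E.powerset ×ˢ E.powerset ×ˢ Φ).filter fun x ↦ 
      (∃ j ∈ Φ, F j ⊆ x.1) ∧ (∀ j ∈ Φ, F j ⊆ x.1 → x.2.1 ⊆ F j) ∧ bad x.2.1 ∧ x.2.1 ⊆ F x.2.2
    with hU
  set D : Finset (Finset α × ι) :=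
    (E.powerset ×ˢ Φ).filter fun x ↦ bad (fragment Φ F x.1 x.2) with hD
  have hexpand : binomialExp E q (fun W ↦ (#{i ∈ Φ | bad (fragment Φ F W i)} : ℝ)) =
      ∑ x ∈ D, w x.1 := by
    rw [hD, sum_filter, sum_product]
    refine sum_congr rfl fun W _ ↦ ?_
    rw [← sum_filter]
    simp only [sum_const, nsmul_eq_mul, hw]
    ring
  have hmap : ∑ x ∈ D, w x.1 ≤ ∑ y ∈ U, w y.1 * (q⁻¹) ^ #y.2.1 := by
    set f : Finset α × ι → Finset α × Finset α × ι := fun x ↦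
      (x.1 ∪ fragment Φ F x.1 x.2, fragment Φ F x.1 x.2, x.2) with hf
    -- A fragment is disjoint from its `W`, so `W` is recovered by removing the second component
    -- from the first.
    have hinj : Set.InjOn f D := by
      rintro ⟨W, i⟩ hx ⟨W', i'⟩ hx' hxx
      simp only [hD, coe_filter, mem_product, Set.mem_ofPred_eq] at hx hx'
      simp only [hf, Prod.mk.injEq] at hxx
      obtain ⟨h1, h2, rfl⟩ := hxx
      have hd := disjoint_fragment Φ F W hx.1.2
      have hd' := disjoint_fragment Φ F W' hx.1.2
      rw [h2] at h1 hd
      rw [← union_sdiff_cancel_right hd, h1, union_sdiff_cancel_right hd']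
    have hsub : D.image f ⊆ U := by
      rintro _ hy
      obtain ⟨⟨W, i⟩, hx, rfl⟩ := mem_image.1 hy
      simp only [hD, mem_filter, mem_product, mem_powerset] at hx
      have hs := fragment_subset Φ F W hx.1.2
      simp only [hU, hf, mem_filter, mem_product, mem_powerset]
      refine ⟨⟨union_subset hx.1.1 (hs.trans (hF _ hx.1.2)), hs.trans (hF _ hx.1.2), hx.1.2⟩,
        ?_, fun j hj hjs ↦ fragment_subset_of_subset_union hx.1.2 hj hjs, hx.2, hs⟩
      obtain ⟨j, hj, he, -, -⟩ := fragment_spec Φ F W hx.1.2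
      exact ⟨j, hj, by rw [he]; exact fun x hx ↦ by by_cases x ∈ W <;> simp_all⟩
    calc ∑ x ∈ D, w x.1 ≤ ∑ x ∈ D, w (f x).1 * (q⁻¹) ^ #(f x).2.1 := by
          refine sum_le_sum fun x hx ↦ ?_
          simp only [hD, mem_filter, mem_product, mem_powerset] at hx
          exact hwle _ _ (union_subset hx.1.1 ((fragment_subset Φ F _ hx.1.2).trans
            (hF _ hx.1.2))) (disjoint_fragment Φ F _ hx.1.2)
      _ = ∑ y ∈ D.image f, w y.1 * (q⁻¹) ^ #y.2.1 :=
          (sum_image (f := fun y : Finset α × Finset α × ι ↦ w y.1 * (q⁻¹) ^ #y.2.1) hinj).symm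
      _ ≤ _ := sum_le_sum_of_subset_of_nonneg hsub fun y _ _ ↦
          mul_nonneg (hw0 _) (by positivity)
  -- The heart of the fragment method: by minimality, every fragment that leads to `Z` lies in every
  -- `F j ⊆ Z`. So for fixed `Z` one such `j` suffices, and the sum runs over subsets of a single `F
  -- j`.
  have hfiber : ∑ y ∈ U, w y.1 * (q⁻¹) ^ #y.2.1 ≤ ∑ Z ∈ E.powerset, w Z * M := by
    rw [hU, sum_filter, sum_product]
    refine sum_le_sum fun Z _ ↦ ?_
    by_cases hZ : ∃ j ∈ Φ, F j ⊆ Z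
    · obtain ⟨j, hj, hjZ⟩ := hZ
      refine le_trans ?_ (mul_le_mul_of_nonneg_left (h j hj) (hw0 Z))
      rw [sum_product, mul_sum, sum_filter, ← sum_subset (powerset_mono.2 (hF j hj))]
      · refine sum_le_sum fun T _ ↦ ?_
        by_cases hT : bad T
        · rw [if_pos hT, ← sum_filter]
          simp only [sum_const, nsmul_eq_mul]
          have hsub : {i ∈ Φ | (∃ j ∈ Φ, F j ⊆ Z) ∧ (∀ j ∈ Φ, F j ⊆ Z → T ⊆ F j) ∧ bad T ∧
              T ⊆ F i} ⊆ {i ∈ Φ | T ⊆ F i} := fun i hi ↦ by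
            simp only [mem_filter] at hi ⊢
            exact ⟨hi.1, hi.2.2.2.2⟩
          have hc := Nat.cast_le (α := ℝ).2 (card_le_card hsub)
          have h0 : 0 ≤ w Z * (q⁻¹) ^ #T := mul_nonneg (hw0 Z) (by positivity)
          rw [mul_comm, ← mul_assoc]
          exact mul_le_mul_of_nonneg_left hc h0
        · rw [if_neg hT]
          exact (sum_eq_zero fun i _ ↦ if_neg fun hc ↦ hT hc.2.2.1).le
      · intro T _ hT
        exact sum_eq_zero fun i _ ↦ if_neg fun hc ↦ hT (mem_powerset.2 (hc.2.1 j hj hjZ))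
    · refine (sum_eq_zero fun y _ ↦ if_neg fun hc ↦ hZ hc.1).le.trans
        (mul_nonneg (hw0 _) hM)
  rw [hexpand]
  refine hmap.trans (hfiber.trans (le_of_eq ?_))
  have := binomialExp_const E q M
  rwa [binomialExp] at this

/-- If the family `S i`, `i ∈ Φ`, is spread enough, then a random set of density `2 * q` contains
one of its members with high probability: in a first round only few fragments have `s` or more
elements, and a second round covers the smaller ones. -/
lemma binomialExp_not_contains_le {E : Finset α} {Φ : Finset ι} (hΦ : Φ.Nonempty)
    {S : ι → Finset α} (hS : ∀ i ∈ Φ, S i ⊆ E) (s : ℕ) {q δ₁ δ₂ : ℝ} (hq : 0 < q)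
    (hq1 : 2 * q ≤ 1) (hδ₁ : 0 ≤ δ₁) (hδ₂ : 0 ≤ δ₂)
    (h₁ : ∀ j ∈ Φ, ∑ T ∈ (S j).powerset with s ≤ #T,
      (q⁻¹) ^ #T * (#{i ∈ Φ | T ⊆ S i} : ℝ) ≤ δ₁ * #Φ)
    (h₂ : ∀ j ∈ Φ, ∀ F ⊆ S j, #F < s → ∑ T ∈ F.powerset with 1 ≤ #T,
      (q⁻¹) ^ #T * (#{i ∈ Φ | T ⊆ S i} : ℝ) ≤ δ₂ * #Φ) :
    binomialExp E (2 * q) (fun W ↦ if ∃ i ∈ Φ, S i ⊆ W then 0 else 1) ≤ δ₁ + δ₂ := by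
  have hΦ0 : (0 : ℝ) < #Φ := by exact_mod_cast hΦ.card_pos
  have hanti : Antitone fun W : Finset α ↦ if ∃ i ∈ Φ, S i ⊆ W then (0 : ℝ) else 1 := by
    intro U W hUW
    dsimp only
    split_ifs with h1 h2 h2
    · exact le_rfl
    · norm_num
    · obtain ⟨i, hi, hiU⟩ := h2
      exact absurd ⟨i, hi, hiU.trans hUW⟩ h1
    · exact le_rfl
  refine (binomialExp_le_union hq.le (by linarith) hq.le (by nlinarith) hq1 E _ hanti).trans ?_
  set Φ' : Finset α → Finset ι := fun W₁ ↦ {i ∈ Φ | #(fragment Φ S W₁ i) < s} with hΦ'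
  set F : Finset α → ι → Finset α := fun W₁ i ↦ fragment Φ S W₁ i with hF
  -- On failure every index is counted on the right: its first fragment is large, or its second
  -- fragment is nonempty, since an empty one would exhibit a set covered by the two rounds.
  have point : ∀ W₁ W₂, (if ∃ i ∈ Φ, S i ⊆ W₁ ∪ W₂ then (0 : ℝ) else 1) ≤
      (#Φ : ℝ)⁻¹ * (#{i ∈ Φ | s ≤ #(fragment Φ S W₁ i)} : ℝ) +
      (#Φ : ℝ)⁻¹ * (#{i ∈ Φ' W₁ | 1 ≤ #(fragment (Φ' W₁) (F W₁) W₂ i)} : ℝ) := by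
    intro W₁ W₂
    split_ifs with hc
    · positivity
    · have hall : Φ' W₁ ⊆ {i ∈ Φ' W₁ | 1 ≤ #(fragment (Φ' W₁) (F W₁) W₂ i)} := by
        intro i hi
        refine mem_filter.2 ⟨hi, ?_⟩
        by_contra h0
        have h0 : fragment (Φ' W₁) (F W₁) W₂ i = ∅ := by
          rw [← card_eq_zero]; omega
        obtain ⟨j, hj, he, -, -⟩ := fragment_spec (Φ' W₁) (F W₁) W₂ hi
        rw [h0] at he
        have hjΦ : j ∈ Φ := (mem_filter.1 hj).1
        obtain ⟨j', hj', he', -, -⟩ := fragment_spec Φ S W₁ hjΦ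
        refine hc ⟨j', hj', fun x hx ↦ ?_⟩
        rw [mem_union]
        by_contra hn
        push Not at hn
        have hx1 : x ∈ F W₁ j := by
          simp only [hF]; rw [he']; exact mem_sdiff.2 ⟨hx, hn.1⟩
        have : x ∈ F W₁ j \ W₂ := mem_sdiff.2 ⟨hx1, hn.2⟩
        rw [← he] at this
        exact notMem_empty _ this
      have hcard : #Φ ≤ #{i ∈ Φ | s ≤ #(fragment Φ S W₁ i)} +
          #{i ∈ Φ' W₁ | 1 ≤ #(fragment (Φ' W₁) (F W₁) W₂ i)} := by
        refine le_trans ?_ (Nat.add_le_add_left (card_le_card hall) _)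
        rw [← card_filter_add_card_filter_not (s := Φ) (p := fun i ↦ s ≤ #(fragment Φ S W₁ i))]
        simp [hΦ', not_le]
      rw [← mul_add, inv_mul_eq_div, le_div_iff₀ hΦ0, one_mul]
      exact_mod_cast hcard
  have inner : ∀ W₁ ⊆ E, binomialExp E q (fun W₂ ↦ if ∃ i ∈ Φ, S i ⊆ W₁ ∪ W₂ then (0 : ℝ) else 1) ≤
      (#Φ : ℝ)⁻¹ * (#{i ∈ Φ | s ≤ #(fragment Φ S W₁ i)} : ℝ) + δ₂ := by
    intro W₁ _
    refine (binomialExp_mono hq.le (by linarith) fun W₂ _ ↦ point W₁ W₂).trans ?_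
    rw [binomialExp_add, binomialExp_const, binomialExp_const_mul]
    refine add_le_add_right ?_ _
    -- The second round is applied to the family of small first-round fragments. Since these lie
    -- inside the sets `S i`, the degrees in the original family still bound theirs.
    have := binomialExp_card_bad_fragment_le (E := E) (Φ := Φ' W₁) (F := F W₁)
      (fun i hi ↦ (fragment_subset Φ S W₁ (mem_filter.1 hi).1).trans (hS i (mem_filter.1 hi).1))
      (fun T ↦ 1 ≤ #T) hq (by linarith) (M := δ₂ * #Φ) (by positivity) (fun j hj ↦ by
        refine le_trans ?_ (h₂ j (mem_filter.1 hj).1 (F W₁ j)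
          (fragment_subset Φ S W₁ (mem_filter.1 hj).1) (mem_filter.1 hj).2)
        refine sum_le_sum fun T _ ↦ ?_
        have hsub : {i ∈ Φ' W₁ | T ⊆ F W₁ i} ⊆ {i ∈ Φ | T ⊆ S i} := fun i hi ↦ by
          simp only [mem_filter] at hi ⊢
          exact ⟨(mem_filter.1 hi.1).1, hi.2.trans (fragment_subset Φ S W₁ (mem_filter.1 hi.1).1)⟩
        have hc : (#{i ∈ Φ' W₁ | T ⊆ F W₁ i} : ℝ) ≤ #{i ∈ Φ | T ⊆ S i} := by
          exact_mod_cast card_le_card hsub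
        have hq0 : 0 ≤ (q⁻¹) ^ #T := by positivity
        exact mul_le_mul_of_nonneg_left hc hq0)
    rw [inv_mul_eq_div, div_le_iff₀ hΦ0]
    exact this
  refine (binomialExp_mono hq.le (by linarith) inner).trans ?_
  rw [binomialExp_add, binomialExp_const, binomialExp_const_mul]
  refine add_le_add_left ?_ _
  rw [inv_mul_eq_div, div_le_iff₀ hΦ0]
  exact binomialExp_card_bad_fragment_le hS (fun T ↦ s ≤ #T) hq (by linarith)
    (mul_nonneg hδ₁ hΦ0.le) h₁

end RandomSubset

/-! ### Counting connected edge sets and embeddings. -/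

namespace EdgeFamily

open Finset

section Generates

variable {V : Type*} [DecidableEq V]

/-- Every edge of `T` is connected, through intersecting edges of `T`, to an edge of `R ⊆ T`. -/
def Generates (R T : Finset (Finset V)) : Prop :=
  R ⊆ T ∧ ∀ P : Finset (Finset V), R ⊆ P →
    (∀ a ∈ P, ∀ b ∈ T, (a ∩ b).Nonempty → b ∈ P) → T ⊆ P

/-- If `T` is isolated in `W`, it is the union of the components of `W` that meet `R`. Applied in
both directions this shows that `R` and `W` determine `T`. -/
lemma Generates.eq_of_isolated {R T T' W : Finset (Finset V)} (hT : Generates R T)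
    (hT' : Generates R T') (hTW' : T' ⊆ W)
    (h : ∀ a ∈ T, ∀ b ∈ W, (a ∩ b).Nonempty → b ∈ T) : T' ⊆ T :=
  hT'.2 T hT.1 fun a ha b hb hab ↦ h a ha b (hTW' hb) hab

open Classical in
/-- The number of edge sets of a given size generated by `R` is bounded by an exponential. -/
lemma card_generated_le (F R : Finset (Finset V)) (t D : ℕ) (hne : ∀ e ∈ F, e.Nonempty)
    (hD : ∀ e ∈ F, #{f ∈ F | (e ∩ f).Nonempty} ≤ D) :
    #{T ∈ F.powerset | #T = t ∧ Generates R T} ≤ 2 ^ (D * t) := by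
  set N : Finset (Finset V) → Finset (Finset V) :=
    fun T ↦ T.biUnion fun e ↦ {f ∈ F | (e ∩ f).Nonempty} with hN
  set 𝒯 := {T ∈ F.powerset | #T = t ∧ Generates R T} with h𝒯
  have hmem : ∀ T ∈ 𝒯, T ⊆ F ∧ #T = t ∧ Generates R T := by
    intro T hT
    simpa [h𝒯] using hT
  have hNF : ∀ T, N T ⊆ F := fun T ↦ biUnion_subset.2 fun e _ ↦ filter_subset _ _
  have hTN : ∀ T ∈ 𝒯, T ⊆ N T := fun T hT e he ↦
    mem_biUnion.2 ⟨e, he, mem_filter.2 ⟨(hmem T hT).1 he, by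
      simpa using hne e ((hmem T hT).1 he)⟩⟩
  have hNcard : ∀ T ∈ 𝒯, #(N T) ≤ D * t := by
    intro T hT
    obtain ⟨h1, h2, -⟩ := hmem T hT
    rw [← h2, mul_comm]
    exact card_biUnion_le_card_mul _ _ _ fun e he ↦ hD e (h1 he)
  -- These are the subfamilies of `F` that contain `T` as an isolated part. The classes of different
  -- `T` are disjoint, and each contains at least a proportion 2 ^ (-D t) of all subfamilies, so
  -- there are at most 2 ^ (D t) of them.
  set 𝒲 : Finset (Finset V) → Finset (Finset (Finset V)) :=
    fun T ↦ (F \ N T).powerset.image (T ∪ ·) with h𝒲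
  have hW : ∀ T ∈ 𝒯, ∀ W ∈ 𝒲 T, T ⊆ W ∧ W ⊆ F ∧
      ∀ a ∈ T, ∀ b ∈ W, (a ∩ b).Nonempty → b ∈ T := by
    intro T hT W hW
    obtain ⟨Y, hY, rfl⟩ := mem_image.1 hW
    rw [mem_powerset] at hY
    refine ⟨subset_union_left, union_subset (hmem T hT).1 (hY.trans sdiff_subset), ?_⟩
    intro a ha b hb hab
    refine (mem_union.1 hb).resolve_right fun hbY ↦ ?_
    have := mem_sdiff.1 (hY hbY)
    exact this.2 (mem_biUnion.2 ⟨a, ha, mem_filter.2 ⟨this.1, hab⟩⟩)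
  have hdisj : (𝒯 : Set (Finset (Finset V))).PairwiseDisjoint 𝒲 := by
    intro T hT T' hT' hne'
    rw [Function.onFun, disjoint_left]
    intro W h1 h2
    obtain ⟨a1, a2, a3⟩ := hW T hT W h1
    obtain ⟨b1, b2, b3⟩ := hW T' hT' W h2
    exact hne' (Subset.antisymm
      ((hmem T' hT').2.2.eq_of_isolated (hmem T hT).2.2 a1 b3)
      ((hmem T hT).2.2.eq_of_isolated (hmem T' hT').2.2 b1 a3))
  have hWcard : ∀ T ∈ 𝒯, 2 ^ #F ≤ #(𝒲 T) * 2 ^ (D * t) := by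
    intro T hT
    have hinj : Set.InjOn (T ∪ ·) ((F \ N T).powerset : Set (Finset (Finset V))) := by
      intro Y hY Y' hY' h
      have hd : ∀ Y ∈ (F \ N T).powerset, (T ∪ Y) \ T = Y := by
        intro Y hY
        refine union_sdiff_cancel_left (disjoint_left.2 fun e he heY ↦ ?_)
        exact (mem_sdiff.1 (mem_powerset.1 hY heY)).2 (hTN T hT he)
      rw [← hd Y hY, ← hd Y' hY']
      exact congrArg (· \ T) h
    rw [h𝒲, card_image_of_injOn hinj, card_powerset, card_sdiff_of_subset (hNF T), ← pow_add]
    have := hNcard T hT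
    exact Nat.pow_le_pow_right (by norm_num) (by omega)
  have hsum : ∑ T ∈ 𝒯, #(𝒲 T) ≤ 2 ^ #F := by
    rw [← card_biUnion hdisj, ← card_powerset]
    exact card_le_card (biUnion_subset.2 fun T hT W hWT ↦ mem_powerset.2 (hW T hT W hWT).2.1)
  have h1 : #𝒯 * 2 ^ #F ≤ 2 ^ #F * 2 ^ (D * t) :=
    calc #𝒯 * 2 ^ #F = ∑ T ∈ 𝒯, 2 ^ #F := by simp
      _ ≤ ∑ T ∈ 𝒯, #(𝒲 T) * 2 ^ (D * t) := sum_le_sum hWcard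
      _ = (∑ T ∈ 𝒯, #(𝒲 T)) * 2 ^ (D * t) := (sum_mul _ _ _).symm
      _ ≤ _ := Nat.mul_le_mul_right _ hsum
  rw [mul_comm] at h1
  exact Nat.le_of_mul_le_mul_left h1 (by positivity)

end Generates

section Copies

lemma partialInv_eq_some {X W : Type*} {φ : X ↪ W} {x : X} {w : W} :
    Function.partialInv φ w = some x ↔ φ x = w :=
  φ.injective.isPartialInv x w

variable {X W : Type*} [DecidableEq W]

/-- The copy of the edge family `A` under the embedding `φ`. -/
def copy (A : Finset (Finset X)) (φ : X ↪ W) : Finset (Finset W) := A.image fun e ↦ e.map φ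

lemma mem_copy {A : Finset (Finset X)} {φ : X ↪ W} {f : Finset W} :
    f ∈ copy A φ ↔ ∃ e ∈ A, e.map φ = f := mem_image

/-- The inverse of `φ`, restricted to `U`. -/
noncomputable def restrictInv (U : Finset W) (φ : X ↪ W) (w : W) : Option X :=
  if w ∈ U then Function.partialInv φ w else none

variable [Fintype X] [Fintype W]

-- Once the preimages of `U` are prescribed, an embedding is fixed on a set `Y` of `#U` points, and
-- what is left is an injection from the complement of `Y` into the complement of `U`.
open Classical in
lemma card_restrictInv_fiber_le (U : Finset W) (b : W → Option X) :
    #{φ : X ↪ W | (∀ w ∈ U, ∃ x, φ x = w) ∧ restrictInv U φ = b} ≤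
      (Fintype.card W - #U).descFactorial (Fintype.card X - #U) := by
  set Y : Finset X := {x | ∃ w ∈ U, b w = some x} with hY
  rcases eq_empty_or_nonempty
    ({φ : X ↪ W | (∀ w ∈ U, ∃ x, φ x = w) ∧ restrictInv U φ = b} : Finset (X ↪ W)) with h | h
  · rw [h]; simp
  obtain ⟨φ₀, hφ₀⟩ := h
  have hval : ∀ φ : X ↪ W, restrictInv U φ = b → ∀ w ∈ U, ∀ x, b w = some x ↔ φ x = w := by
    rintro φ rfl w hw x
    rw [restrictInv, if_pos hw, partialInv_eq_some]
  have hYcard : #Y = #U := by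
    simp only [mem_filter, mem_univ, true_and] at hφ₀
    have : U = Y.map φ₀ := by
      ext w
      simp only [mem_map, hY, mem_filter, mem_univ, true_and]
      constructor
      · intro hw
        obtain ⟨x, hx⟩ := hφ₀.1 w hw
        exact ⟨x, ⟨w, hw, (hval φ₀ hφ₀.2 w hw x).2 hx⟩, hx⟩
      · rintro ⟨x, ⟨w', hw', hb⟩, hx⟩
        rw [(hval φ₀ hφ₀.2 w' hw' x).1 hb] at hx
        exact hx ▸ hw'
    rw [this, card_map]
  have hout : ∀ φ : X ↪ W, restrictInv U φ = b → ∀ x, x ∉ Y → φ x ∉ U := by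
    intro φ hφ x hx hU
    exact hx (by simpa [hY] using ⟨φ x, hU, (hval φ hφ _ hU x).2 rfl⟩)
  set r : (X ↪ W) → ({x // x ∉ Y} ↪ {w // w ∉ U}) := fun φ ↦
    if hφ : restrictInv U φ = b then
      ⟨fun x ↦ ⟨φ x, hout φ hφ x x.2⟩, fun x y hxy ↦ Subtype.ext (φ.injective (by simpa using hxy))⟩
    else
      ⟨fun x ↦ ⟨φ₀ x, hout φ₀ (by simpa using (mem_filter.1 hφ₀).2.2) x x.2⟩,
        fun x y hxy ↦ Subtype.ext (φ₀.injective (by simpa using hxy))⟩ with hr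
  have hcard : Fintype.card ({x // x ∉ Y} ↪ {w // w ∉ U}) =
      (Fintype.card W - #U).descFactorial (Fintype.card X - #U) := by
    rw [Fintype.card_embedding_eq, Fintype.card_subtype_compl, Fintype.card_subtype_compl]
    simp [hYcard]
  rw [← hcard, ← Finset.card_univ]
  refine card_le_card_of_injOn r (fun _ _ ↦ mem_univ _) ?_
  intro φ hφ ψ hψ h
  have hφ := (mem_filter.1 hφ).2
  have hψ := (mem_filter.1 hψ).2
  ext x
  by_cases hx : x ∈ Y
  · obtain ⟨w, hw, hb⟩ := (mem_filter.1 hx).2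
    rw [(hval φ hφ.2 w hw x).1 hb, (hval ψ hψ.2 w hw x).1 hb]
  · simp only [hr, dif_pos hφ.2, dif_pos hψ.2] at h
    exact congrArg Subtype.val (DFunLike.congr_fun h ⟨x, hx⟩)

open Classical in
/-- The number of embeddings whose copy of `A` contains `T`. -/
lemma card_copy_superset_le (A : Finset (Finset X)) (R T : Finset (Finset W)) {Δ : ℕ}
    (hΔ : 1 ≤ Δ) (hA : ∀ x, #{y | ∃ e ∈ A, x ∈ e ∧ y ∈ e} ≤ Δ) (hT : Generates R T)
    (hne : ∀ e ∈ T, e.Nonempty) :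
    #{φ : X ↪ W | T ⊆ copy A φ} ≤ Fintype.card X ^ #R * Δ ^ #(T.biUnion id) *
      (Fintype.card W - #(T.biUnion id)).descFactorial (Fintype.card X - #(T.biUnion id)) := by
  set good : Finset (X ↪ W) := {φ : X ↪ W | T ⊆ copy A φ} with hgood
  set VT := T.biUnion id with hVT
  -- `Q U` collects the possible assignments of preimages to `U`. A new vertex multiplies their
  -- number by at most `Fintype.card X`, and by at most `Δ` if it shares an edge of `T` with a
  -- vertex already treated.
  set Q : Finset W → Finset (W → Option X) := fun U ↦ good.image (restrictInv U) with hQ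
  have hcov : ∀ φ ∈ good, ∀ w ∈ VT, ∃ x, φ x = w := by
    intro φ hφ w hw
    obtain ⟨f, hf, hwf⟩ := mem_biUnion.1 hw
    obtain ⟨e, he, rfl⟩ := mem_copy.1 ((mem_filter.1 hφ).2 hf)
    obtain ⟨x, -, hx⟩ := mem_map.1 hwf
    exact ⟨x, hx⟩
  -- extending the domain by one vertex
  have hrest : ∀ (U : Finset W) (u : W) (φ : X ↪ W), (fun w ↦ if w ∈ U then restrictInv (insert u U) φ w else none) =
      restrictInv U φ := by
    intro U u φ
    funext w
    simp only [restrictInv, mem_insert]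
    split_ifs <;> simp_all
  have hext : ∀ (U : Finset W) (u : W) (K : ℕ), 
      (∀ φ₀ ∈ good, ∃ Y : Finset X, #Y ≤ K ∧ ∀ φ ∈ good, restrictInv U φ = restrictInv U φ₀ →
        ∃ x ∈ Y, φ x = u) → #(Q (insert u U)) ≤ K * #(Q U) := by
    intro U u K h
    refine card_le_mul_card_image_of_maps_to (f := fun b w ↦ if w ∈ U then b w else none) ?_ K ?_
    · intro b hb
      obtain ⟨φ, hφ, rfl⟩ := mem_image.1 hb
      exact mem_image.2 ⟨φ, hφ, (hrest U u φ).symm⟩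
    · intro b hb
      obtain ⟨φ₀, hφ₀, rfl⟩ := mem_image.1 hb
      obtain ⟨Y, hYK, hY⟩ := h φ₀ hφ₀
      refine le_trans ?_ ((card_image_le (s := Y) (f := some)).trans hYK)
      refine card_le_card_of_injOn (fun b ↦ b u) ?_ ?_
      · intro b hb
        obtain ⟨hb1, hb2⟩ := mem_filter.1 hb
        obtain ⟨φ, hφ, rfl⟩ := mem_image.1 hb1
        rw [hrest] at hb2
        obtain ⟨x, hx, hxu⟩ := hY φ hφ hb2
        have : restrictInv (insert u U) φ u = some x := by
          rw [restrictInv, if_pos (mem_insert_self _ _), partialInv_eq_some, hxu]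
        simpa [this] using hx
      · intro b hb b' hb' hbb
        obtain ⟨hb1, hb2⟩ := mem_filter.1 hb
        obtain ⟨φ, hφ, rfl⟩ := mem_image.1 hb1
        obtain ⟨hb1', hb2'⟩ := mem_filter.1 hb'
        obtain ⟨φ', hφ', rfl⟩ := mem_image.1 hb1'
        rw [hrest] at hb2 hb2'
        funext w
        by_cases hw : w = u
        · subst hw; exact hbb
        · have h1 := congrFun (hb2.trans hb2'.symm) w
          simp only [restrictInv, mem_insert, hw, false_or] at h1 ⊢
          exact h1
  -- root vertices
  have hroot : ∀ U : Finset W, U ⊆ VT → #(Q U) ≤ Fintype.card X ^ #U := by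
    intro U
    induction U using Finset.induction_on with
    | empty =>
      intro _
      simp only [card_empty, pow_zero]
      refine card_le_one.2 ?_
      intro b hb b' hb'
      obtain ⟨φ, -, rfl⟩ := mem_image.1 hb
      obtain ⟨φ', -, rfl⟩ := mem_image.1 hb'
      funext w
      simp [restrictInv]
    | insert u U hu ih =>
      intro hU
      rw [card_insert_of_notMem hu, pow_succ, mul_comm]
      refine (hext U u (Fintype.card X) fun φ₀ _ ↦ ⟨univ, le_rfl, fun φ hφ _ ↦ ?_⟩).trans
        (Nat.mul_le_mul_left _ (ih ((subset_insert u U).trans hU)))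
      obtain ⟨x, hx⟩ := hcov φ hφ u (hU (mem_insert_self u U))
      exact ⟨x, mem_univ _, hx⟩
  choose f hf using hne
  -- One vertex of each root edge: only these pay the factor `Fintype.card X`.
  set U₀ := R.attach.image fun e ↦ f e.1 (hT.1 e.2) with hU₀
  have hU₀T : U₀ ⊆ VT := by
    intro w hw
    obtain ⟨e, -, rfl⟩ := mem_image.1 hw
    exact mem_biUnion.2 ⟨e, hT.1 e.2, hf e _⟩
  -- a maximal set of vertices whose possible preimages are under control
  obtain ⟨U, hU, hmax⟩ := exists_max_image
    {U ∈ VT.powerset | U₀ ⊆ U ∧ #(Q U) ≤ Fintype.card X ^ #R * Δ ^ #U} card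
    ⟨U₀, by
      simp only [mem_filter, mem_powerset, subset_refl, true_and]
      refine ⟨hU₀T, (hroot U₀ hU₀T).trans ?_⟩
      rcases Nat.eq_zero_or_pos (Fintype.card X) with h0 | h0
      · rcases R.eq_empty_or_nonempty with hR | hR
        · have : #U₀ = 0 := Nat.le_zero.1 (card_image_le.trans (by simp [hR]))
          simp [this, hR]
        · have : U₀.Nonempty := hR.attach.image _
          simp [h0, this.card_pos.ne']
      · exact (Nat.pow_le_pow_right h0 (card_image_le.trans card_attach.le)).trans
          (Nat.le_mul_of_pos_right _ (by positivity))⟩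
  simp only [mem_filter, mem_powerset] at hU hmax
  have hclosed : ∀ a ∈ T, (∃ w ∈ a, w ∈ U) → a ⊆ U := by
    intro a ha ⟨w, hwa, hwU⟩ u hua
    by_contra huU
    have hle : #(Q (insert u U)) ≤ Δ * #(Q U) := by
      refine hext U u Δ fun φ₀ hφ₀ ↦ ?_
      obtain ⟨x₀, hx₀⟩ := hcov φ₀ hφ₀ w (hU.1 hwU)
      refine ⟨_, hA x₀, fun φ hφ hφφ ↦ ?_⟩
      obtain ⟨e, he, hea⟩ := mem_copy.1 ((mem_filter.1 hφ).2 ha)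
      have hx : φ x₀ = w := by
        have h1 := congrFun hφφ w
        rw [restrictInv, restrictInv, if_pos hwU, if_pos hwU, partialInv_eq_some.2 hx₀,
          partialInv_eq_some] at h1
        exact h1
      rw [← hea, mem_map] at hua hwa
      obtain ⟨y, hye, hyu⟩ := hua
      obtain ⟨x, hxe, hxw⟩ := hwa
      have : x = x₀ := φ.injective (hxw.trans hx.symm)
      subst this
      exact ⟨y, by simpa using ⟨e, he, hxe, hye⟩, hyu⟩
    have hmem : u ∈ VT := mem_biUnion.2 ⟨a, ha, hua⟩
    have := hmax (insert u U) ⟨insert_subset hmem hU.1, hU.2.1.trans (subset_insert _ _), by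
      rw [card_insert_of_notMem huU, pow_succ]
      calc _ ≤ Δ * #(Q U) := hle
        _ ≤ Δ * (Fintype.card X ^ #R * Δ ^ #U) := Nat.mul_le_mul_left _ hU.2.2
        _ = _ := by ring⟩
    rw [card_insert_of_notMem huU] at this
    omega
  -- By maximality an edge of `T` that meets `U` lies in `U`; as `U` meets every root edge,
  -- generation spreads this to all of `T`.
  have hall : T ⊆ {a ∈ T | a ⊆ U} := by
    refine hT.2 _ ?_ ?_
    · intro e he
      exact mem_filter.2 ⟨hT.1 he, hclosed e (hT.1 he)
        ⟨_, hf e (hT.1 he), hU.2.1 (mem_image.2 ⟨⟨e, he⟩, mem_attach _ _, rfl⟩)⟩⟩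
    · intro a ha b hb ⟨w, hw⟩
      rw [mem_inter] at hw
      exact mem_filter.2 ⟨hb, hclosed b hb ⟨w, hw.2, (mem_filter.1 ha).2 hw.1⟩⟩
  have hUV : U = VT := hU.1.antisymm (biUnion_subset.2 fun e he ↦ (mem_filter.1 (hall he)).2)
  rw [hUV] at hU
  refine le_trans (card_le_mul_card_image_of_maps_to (f := restrictInv VT) (t := Q VT)
    (fun φ hφ ↦ mem_image_of_mem _ hφ) _ fun b _ ↦ ?_)
    ((mul_comm _ _).le.trans (Nat.mul_le_mul_right _ hU.2.2))
  refine le_trans (card_le_card ?_) (card_restrictInv_fiber_le VT b)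
  intro φ hφ
  obtain ⟨h1, h2⟩ := mem_filter.1 hφ
  exact mem_filter.2 ⟨mem_univ _, hcov φ h1, h2⟩

end Copies

end EdgeFamily

/-! ### Sparse families: random families contain a copy. -/

namespace EdgeFamily

open Finset RandomSubset

section Transport

variable {X W : Type*} [DecidableEq W]

lemma card_copy (A : Finset (Finset X)) (φ : X ↪ W) : #(copy A φ) = #A :=
  card_image_of_injective _ (map_injective φ)

lemma biUnion_copy [DecidableEq X] (A : Finset (Finset X)) (φ : X ↪ W) :
    (copy A φ).biUnion id = (A.biUnion id).map φ := by
  ext w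
  simp only [mem_biUnion, mem_copy, mem_map, id]
  constructor
  · rintro ⟨_, ⟨e, he, rfl⟩, hw⟩
    obtain ⟨x, hx, rfl⟩ := mem_map.1 hw
    exact ⟨x, ⟨e, he, hx⟩, rfl⟩
  · rintro ⟨x, ⟨e, he, hx⟩, rfl⟩
    exact ⟨_, ⟨e, he, rfl⟩, mem_map_of_mem φ hx⟩

lemma exists_copy_eq {A : Finset (Finset X)} {φ : X ↪ W} {T : Finset (Finset W)}
    (hT : T ⊆ copy A φ) : ∃ T₀ ⊆ A, copy T₀ φ = T := by
  refine ⟨{e ∈ A | e.map φ ∈ T}, filter_subset _ _, ?_⟩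
  ext f
  simp only [mem_copy, mem_filter]
  constructor
  · rintro ⟨e, he, rfl⟩
    exact he.2
  · intro hf
    obtain ⟨e, he, rfl⟩ := mem_copy.1 (hT hf)
    exact ⟨e, ⟨he, hf⟩, rfl⟩

lemma copy_subset_copy {A B : Finset (Finset X)} (h : A ⊆ B) (φ : X ↪ W) :
    copy A φ ⊆ copy B φ := image_subset_image h

lemma Generates.copy [DecidableEq X] {R T : Finset (Finset X)} (h : Generates R T) (φ : X ↪ W) :
    Generates (copy R φ) (copy T φ) := by
  refine ⟨copy_subset_copy h.1 φ, fun P hRP hP ↦ ?_⟩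
  have : T ⊆ {e ∈ T | e.map φ ∈ P} := by
    refine h.2 _ (fun e he ↦ mem_filter.2 ⟨h.1 he, hRP (mem_copy.2 ⟨e, he, rfl⟩)⟩) ?_
    intro a ha b hb hab
    refine mem_filter.2 ⟨hb, hP _ (mem_filter.1 ha).2 _ (mem_copy.2 ⟨b, hb, rfl⟩) ?_⟩
    rw [← map_inter]
    exact hab.map
  intro f hf
  obtain ⟨e, he, rfl⟩ := mem_copy.1 hf
  exact (mem_filter.1 (this he)).2

end Transport

/-- The edge family `A` is `r`-uniform, has maximum degree at most `D`, and every subfamily `T`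
with `c` components spans at least `#T / d + 3 c / 2` vertices, up to an error that is a small
multiple of `#T`. -/
structure IsSparse {X : Type*} [DecidableEq X] (A : Finset (Finset X)) (r d D : ℕ) (κ : ℝ) :
    Prop where
  card_eq : ∀ e ∈ A, #e = r
  degree : ∀ x, #{e ∈ A | x ∈ e} ≤ D
  sparse : ∀ T ⊆ A, ∃ R, Generates R T ∧
    2 * (#T : ℝ) + 3 * d * #R ≤ 2 * d * #(T.biUnion id) + κ * #T

namespace IsSparse

variable {X W : Type*} [DecidableEq X] [DecidableEq W] {A : Finset (Finset X)} {r d D : ℕ} {κ : ℝ}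

lemma copy (h : IsSparse A r d D κ) (φ : X ↪ W) : IsSparse (copy A φ) r d D κ where
  card_eq f hf := by
    obtain ⟨e, he, rfl⟩ := mem_copy.1 hf
    rw [card_map, h.card_eq e he]
  degree w := by
    by_cases hw : ∃ x, φ x = w
    · obtain ⟨x, rfl⟩ := hw
      refine le_trans (le_trans (card_le_card ?_) (card_image_le (f := fun e ↦ e.map φ)))
        (h.degree x)
      intro f hf
      obtain ⟨hf, hx⟩ := mem_filter.1 hf
      obtain ⟨e, he, rfl⟩ := mem_copy.1 hf
      exact mem_image.2 ⟨e, mem_filter.2 ⟨he, by simpa using hx⟩, rfl⟩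
    · rw [card_eq_zero.2]
      · exact Nat.zero_le _
      · refine filter_eq_empty_iff.2 fun f hf hwf ↦ hw ?_
        obtain ⟨e, he, rfl⟩ := mem_copy.1 hf
        obtain ⟨x, -, hx⟩ := mem_map.1 hwf
        exact ⟨x, hx⟩
  sparse T hT := by
    obtain ⟨T₀, hT₀, rfl⟩ := exists_copy_eq hT
    obtain ⟨R, hR, hRT⟩ := h.sparse T₀ hT₀
    refine ⟨_, hR.copy φ, ?_⟩
    rwa [card_copy, card_copy, biUnion_copy, card_map]

lemma card_adjacent_le (h : IsSparse A r d D κ) {F : Finset (Finset X)} (hF : F ⊆ A)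
    {e : Finset X} (he : e ∈ F) : #{f ∈ F | (e ∩ f).Nonempty} ≤ D * r := by
  calc #{f ∈ F | (e ∩ f).Nonempty} ≤ #(e.biUnion fun x ↦ {f ∈ A | x ∈ f}) := by
        refine card_le_card fun f hf ↦ ?_
        obtain ⟨hf, x, hx⟩ := mem_filter.1 hf
        rw [mem_inter] at hx
        exact mem_biUnion.2 ⟨x, hx.1, mem_filter.2 ⟨hF hf, hx.2⟩⟩
    _ ≤ #e * D := card_biUnion_le_card_mul _ _ _ fun x _ ↦ h.degree x
    _ = D * r := by rw [h.card_eq e (hF he), mul_comm]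

lemma card_neighbors_le [Fintype X] (h : IsSparse A r d D κ) (x : X) :
    #{y | ∃ e ∈ A, x ∈ e ∧ y ∈ e} ≤ D * r := by
  calc #{y | ∃ e ∈ A, x ∈ e ∧ y ∈ e} ≤ #(({e ∈ A | x ∈ e}).biUnion id) := by
        refine card_le_card fun y hy ↦ ?_
        obtain ⟨e, he, hx, hy⟩ := (mem_filter.1 hy).2
        exact mem_biUnion.2 ⟨e, mem_filter.2 ⟨he, hx⟩, hy⟩
    _ ≤ #{e ∈ A | x ∈ e} * r := card_biUnion_le_card_mul _ _ _ fun e he ↦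
        (h.card_eq e (mem_filter.1 he).1).le
    _ ≤ D * r := Nat.mul_le_mul_right _ (h.degree x)

lemma card_le [Fintype X] (h : IsSparse A r d D κ) (hr : 1 ≤ r) : #A ≤ D * Fintype.card X := by
  calc #A ≤ #((univ : Finset X).biUnion fun x ↦ {e ∈ A | x ∈ e}) := by
        refine card_le_card fun e he ↦ ?_
        obtain ⟨x, hx⟩ : e.Nonempty := card_pos.1 (by rw [h.card_eq e he]; exact hr)
        exact mem_biUnion.2 ⟨x, mem_univ _, mem_filter.2 ⟨he, hx⟩⟩
    _ ≤ _ := (card_biUnion_le_card_mul _ _ _ fun x _ ↦ h.degree x).trans (by simp [mul_comm])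

/-- The weighted proportion of copies of `A` that contain a given edge family `T` decays like
`n ^ (- c / 2) * β ^ #T`, where `c` is the number of components of `T`. -/
lemma weight_le [Fintype X] [Fintype W] (h : IsSparse A r d D κ) (hr : 1 ≤ r) (hd : 1 ≤ d)
    (hD : 1 ≤ D) (hX : 2 * Fintype.card X ≤ Fintype.card W) (hW : 1 ≤ Fintype.card W)
    {q : ℝ} (hq : 0 < q) {φ₀ : X ↪ W} {R T : Finset (Finset W)} (hT : T ⊆ EdgeFamily.copy A φ₀)
    (hR : Generates R T)
    (hRT : 2 * (#T : ℝ) + 3 * d * #R ≤ 2 * d * #(T.biUnion id) + κ * #T) :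
    (q⁻¹) ^ #T * (#{φ : X ↪ W | T ⊆ EdgeFamily.copy A φ} : ℝ) ≤
      ((Fintype.card W : ℝ) ^ (-(1 / 2) : ℝ)) ^ #R *
      (q⁻¹ * (Fintype.card W : ℝ) ^ (-(1 / d : ℝ) + κ / (2 * d)) * (2 * (D * r)) ^ r) ^ #T *
      (Fintype.card W).descFactorial (Fintype.card X) := by
  set n := Fintype.card W with hn
  set N := Fintype.card X with hN
  set v := #(T.biUnion id) with hv
  have hTc : ∀ e ∈ T, #e = r := fun e he ↦ (h.copy φ₀).card_eq e (hT he)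
  have hvr : v ≤ #T * r := card_biUnion_le_card_mul _ _ _ fun e he ↦ (hTc e he).le
  have hvN : v ≤ N := by
    have : T.biUnion id ⊆ (univ : Finset X).map φ₀ := by
      refine (biUnion_subset_biUnion_of_subset_left id hT).trans ?_
      rw [biUnion_copy]
      exact map_subset_map.2 (subset_univ _)
    simpa using card_le_card this
  have h1 := card_copy_superset_le (W := W) A R T (Δ := D * r) (Nat.mul_pos hD hr)
    (fun x ↦ by convert h.card_neighbors_le x) hR fun e he ↦ card_pos.1 (by rw [hTc e he]; exact hr)
  have hn0 : (0 : ℝ) < n := by exact_mod_cast hW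
  -- Since v ≤ N ≤ n/2, each of the first v factors of the falling factorial is at least n/2.
  have hdesc : ((n : ℝ) / 2) ^ v * ((n - v).descFactorial (N - v) : ℝ) ≤ n.descFactorial N := by
    rw [← Nat.descFactorial_mul_descFactorial hvN, mul_comm]
    push_cast
    refine mul_le_mul_of_nonneg_left ?_ (by positivity)
    refine le_trans ?_ (Nat.cast_le.2 (Nat.pow_sub_le_descFactorial n v))
    push_cast
    refine pow_le_pow_left₀ (by positivity) ?_ _
    rw [Nat.cast_sub (by omega)]
    push_cast
    have : (2 * v : ℝ) ≤ n := by exact_mod_cast (Nat.mul_le_mul_left 2 hvN).trans hX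
    linarith
  have hd0 : (0 : ℝ) < d := by exact_mod_cast hd
  -- The sparsity inequality divided by 2d, in the exponent of n. The coefficient 3/2 of `#R` pays
  -- for the choice of root preimages and still leaves n ^ (-1/2) per root.
  have hexp : (n : ℝ) ^ #R * ((n : ℝ)⁻¹) ^ v ≤
      ((n : ℝ) ^ (-(1 / 2) : ℝ)) ^ #R * ((n : ℝ) ^ (-(1 / d : ℝ) + κ / (2 * d))) ^ #T := by
    rw [← Real.rpow_natCast, ← Real.rpow_natCast, ← Real.rpow_natCast, ← Real.rpow_natCast,
      ← Real.rpow_neg_one, ← Real.rpow_mul hn0.le, ← Real.rpow_mul hn0.le,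
      ← Real.rpow_mul hn0.le, ← Real.rpow_add hn0, ← Real.rpow_add hn0]
    refine Real.rpow_le_rpow_of_exponent_le (by exact_mod_cast hW) ?_
    have e1 : (2 * d : ℝ) * ((#R : ℝ) + -1 * v) ≤
        (2 * d) * (-(1 / 2) * #R + (-(1 / d) + κ / (2 * d)) * #T) := by
      have : (2 * d : ℝ) * (-(1 / 2) * #R + (-(1 / d) + κ / (2 * d)) * #T) =
          - (d * #R) - 2 * #T + κ * #T := by field_simp; ring
      rw [this]
      linarith
    exact le_of_mul_le_mul_left e1 (by positivity)
  have hΔ : (2 * (D * r) : ℝ) ^ v ≤ ((2 * (D * r)) ^ r) ^ #T := by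
    rw [← pow_mul]
    refine pow_le_pow_right₀ ?_ (by rwa [mul_comm])
    have : (1 : ℝ) ≤ D * r := by exact_mod_cast Nat.mul_pos hD hr
    linarith
  have hNn : (N : ℝ) ≤ n := by exact_mod_cast (by omega : N ≤ n)
  calc (q⁻¹) ^ #T * (#{φ : X ↪ W | T ⊆ EdgeFamily.copy A φ} : ℝ)
      ≤ (q⁻¹) ^ #T * ((N : ℝ) ^ #R * (D * r : ℝ) ^ v * ((n - v).descFactorial (N - v) : ℝ)) := by
        refine mul_le_mul_of_nonneg_left ?_ (by positivity)
        have := Nat.cast_le (α := ℝ).2 h1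
        push_cast at this
        exact this
    _ ≤ (q⁻¹) ^ #T * ((n : ℝ) ^ #R * (D * r : ℝ) ^ v * 
          ((2 * (n : ℝ)⁻¹) ^ v * n.descFactorial N)) := by
        have : ((n - v).descFactorial (N - v) : ℝ) ≤ (2 * (n : ℝ)⁻¹) ^ v * n.descFactorial N := by
          have e : (2 * (n : ℝ)⁻¹) ^ v * ((n : ℝ) / 2) ^ v = 1 := by
            rw [← mul_pow, show 2 * (n : ℝ)⁻¹ * (n / 2) = 1 by field_simp, one_pow]
          calc ((n - v).descFactorial (N - v) : ℝ)
              = (2 * (n : ℝ)⁻¹) ^ v * (((n : ℝ) / 2) ^ v * (n - v).descFactorial (N - v)) := by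
                rw [← mul_assoc, e, one_mul]
            _ ≤ _ := mul_le_mul_of_nonneg_left hdesc (by positivity)
        gcongr
    _ = (q⁻¹) ^ #T * ((n : ℝ) ^ #R * ((n : ℝ)⁻¹) ^ v) * (2 * (D * r) : ℝ) ^ v *
          n.descFactorial N := by
        rw [mul_pow 2 (n : ℝ)⁻¹, mul_pow 2 (D * r : ℝ)]
        ring
    _ ≤ (q⁻¹) ^ #T * (((n : ℝ) ^ (-(1 / 2) : ℝ)) ^ #R *
          ((n : ℝ) ^ (-(1 / d : ℝ) + κ / (2 * d))) ^ #T) * ((2 * (D * r)) ^ r) ^ #T *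
          n.descFactorial N := by
        gcongr
    _ = _ := by
        rw [mul_pow, mul_pow]
        ring

/-- The weighted number of pairs `(T, φ)` with `T ⊆ F` of size at least `s` contained in the copy of
`A` under `φ` decays exponentially in `s`. -/
lemma sum_weight_le [Fintype X] [Fintype W] (h : IsSparse A r d D κ) (hr : 1 ≤ r) (hd : 1 ≤ d)
    (hD : 1 ≤ D) (hX : 2 * Fintype.card X ≤ Fintype.card W) (hW : 1 ≤ Fintype.card W)
    {q θ : ℝ} (hq : 0 < q)
    (hθ : θ = 2 ^ (D * r) *
      (q⁻¹ * (Fintype.card W : ℝ) ^ (-(1 / d : ℝ) + κ / (2 * d)) * (2 * (D * r)) ^ r))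
    (hθ2 : θ ≤ 1 / 2) {φ₀ : X ↪ W} {F : Finset (Finset W)} (hF : F ⊆ EdgeFamily.copy A φ₀) (s : ℕ) :
    ∑ T ∈ F.powerset with s ≤ #T, (q⁻¹) ^ #T * (#{φ : X ↪ W | T ⊆ EdgeFamily.copy A φ} : ℝ) ≤
      Real.exp ((Fintype.card W : ℝ) ^ (-(1 / 2) : ℝ) * #F) * (2 * θ ^ s) *
      (Fintype.card W).descFactorial (Fintype.card X) := by
  classical
  set n := Fintype.card W with hn
  set y := (n : ℝ) ^ (-(1 / 2) : ℝ) with hy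
  set β := q⁻¹ * (n : ℝ) ^ (-(1 / d : ℝ) + κ / (2 * d)) * (2 * (D * r)) ^ r with hβ
  set Q : ℝ := (n.descFactorial (Fintype.card X) : ℝ) with hQ
  have hy0 : 0 ≤ y := by positivity
  have hβ0 : 0 ≤ β := by positivity
  have hθ0 : 0 ≤ θ := by rw [hθ]; positivity
  have hQ0 : 0 ≤ Q := by positivity
  have hFA : ∀ e ∈ F, #e = r := fun e he ↦ (h.copy φ₀).card_eq e (hF he)
  have hT : ∀ T ∈ F.powerset, ∃ R ∈ F.powerset, Generates R T ∧
      (q⁻¹) ^ #T * (#{φ : X ↪ W | T ⊆ EdgeFamily.copy A φ} : ℝ) ≤ y ^ #R * β ^ #T * Q := by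
    intro T hT
    rw [mem_powerset] at hT
    obtain ⟨R, hR, hRT⟩ := (h.copy φ₀).sparse T (hT.trans hF)
    exact ⟨R, mem_powerset.2 (hR.1.trans hT), hR,
      h.weight_le hr hd hD hX hW hq (hT.trans hF) hR hRT⟩
  have hgeom : ∑ t ∈ Ico s (#F + 1), θ ^ t ≤ 2 * θ ^ s := by
    refine (geom_sum_Ico_le_of_lt_one hθ0 (by linarith)).trans ?_
    rw [div_le_iff₀ (by linarith)]
    nlinarith [pow_nonneg hθ0 s]
  calc ∑ T ∈ F.powerset with s ≤ #T, (q⁻¹) ^ #T * (#{φ : X ↪ W | T ⊆ EdgeFamily.copy A φ} : ℝ)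
      ≤ ∑ T ∈ F.powerset with s ≤ #T, ∑ R ∈ F.powerset,
          if Generates R T then y ^ #R * β ^ #T * Q else 0 := by
        refine sum_le_sum fun T hTF ↦ ?_
        obtain ⟨R, hRF, hR, hle⟩ := hT T (mem_filter.1 hTF).1
        refine hle.trans ?_
        have := single_le_sum (f := fun R ↦ if Generates R T then y ^ #R * β ^ #T * Q else 0)
          (fun R _ ↦ by split_ifs <;> positivity) hRF
        simpa [hR] using this
    _ = ∑ R ∈ F.powerset, ∑ T ∈ F.powerset with s ≤ #T,
          if Generates R T then y ^ #R * β ^ #T * Q else 0 := sum_comm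
    _ ≤ ∑ R ∈ F.powerset, y ^ #R * Q * ∑ t ∈ Ico s (#F + 1), θ ^ t := by
        refine sum_le_sum fun R _ ↦ ?_
        have hmaps : ∀ T ∈ F.powerset.filter (s ≤ #·), #T ∈ Ico s (#F + 1) := by
          intro T hT
          obtain ⟨h1, h2⟩ := mem_filter.1 hT
          have := card_le_card (mem_powerset.1 h1)
          exact mem_Ico.2 ⟨h2, by omega⟩
        rw [← sum_fiberwise_of_maps_to hmaps, mul_sum]
        refine sum_le_sum fun t _ ↦ ?_
        have hc := card_generated_le F R t (D * r)
          (fun e he ↦ card_pos.1 (by rw [hFA e he]; exact hr))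
          fun e he ↦ (h.copy φ₀).card_adjacent_le hF he
        calc ∑ T ∈ F.powerset.filter (s ≤ #·) with #T = t,
              (if Generates R T then y ^ #R * β ^ #T * Q else 0)
            = ∑ T ∈ F.powerset.filter (s ≤ #·) with #T = t,
              (if Generates R T then y ^ #R * β ^ t * Q else 0) :=
              sum_congr rfl fun T hT ↦ by rw [(mem_filter.1 hT).2]
          _ = #{T ∈ {T ∈ F.powerset.filter (s ≤ #·) | #T = t} | Generates R T} *
              (y ^ #R * β ^ t * Q) := by
              rw [← sum_filter, sum_const, nsmul_eq_mul]
          _ ≤ (2 ^ (D * r * t) : ℕ) * (y ^ #R * β ^ t * Q) := by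
              refine mul_le_mul_of_nonneg_right (Nat.cast_le.2 ((card_le_card ?_).trans hc))
                (by positivity)
              intro T hT
              simp only [mem_filter] at hT ⊢
              exact ⟨hT.1.1.1, hT.1.2, hT.2⟩
          _ = y ^ #R * Q * θ ^ t := by
              rw [hθ, mul_pow, ← pow_mul]
              push_cast
              ring
    _ ≤ ∑ R ∈ F.powerset, y ^ #R * Q * (2 * θ ^ s) :=
        sum_le_sum fun R _ ↦ mul_le_mul_of_nonneg_left hgeom (by positivity)
    -- Binomial form of the sum over all possible root sets, equal to (y + 1) ^ #F.
    _ = (∑ R ∈ F.powerset, y ^ #R * 1 ^ (#F - #R)) * (2 * θ ^ s) * Q := by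
        rw [sum_mul, sum_mul]
        exact sum_congr rfl fun R _ ↦ by rw [one_pow]; ring
    _ ≤ _ := by
        rw [sum_pow_mul_eq_add_pow, mul_comm y, Real.exp_nat_mul]
        have : y + 1 ≤ Real.exp y := Real.add_one_le_exp y
        gcongr

/-- A random family of `r`-element sets of density `2 * q` contains a copy of a sparse family `A`
with high probability. -/
theorem binomialExp_not_contains_copy_le [Fintype X] [Fintype W] (h : IsSparse A r d D κ)
    (hr : 1 ≤ r) (hd : 1 ≤ d) (hD : 1 ≤ D) (hX : 2 * Fintype.card X ≤ Fintype.card W)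
    (hW : 1 ≤ Fintype.card W) {q θ : ℝ} (hq : 0 < q) (hq1 : 2 * q ≤ 1)
    (hθ : θ = 2 ^ (D * r) *
      (q⁻¹ * (Fintype.card W : ℝ) ^ (-(1 / d : ℝ) + κ / (2 * d)) * (2 * (D * r)) ^ r))
    (hθ2 : θ ≤ 1 / 2) (hθD : Real.exp D * θ ≤ 1) :
    binomialExp (univ.powersetCard r : Finset (Finset W)) (2 * q)
      (fun U ↦ if ∃ φ ∈ (univ : Finset (X ↪ W)), EdgeFamily.copy A φ ⊆ U then 0 else 1) ≤
      2 * (Real.exp D * θ) + 2 * (Real.exp 1 * θ) := by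
  set n := Fintype.card W with hn
  set y := (n : ℝ) ^ (-(1 / 2) : ℝ) with hy
  have hn0 : (0 : ℝ) < n := by exact_mod_cast hW
  have hy0 : 0 ≤ y := by positivity
  have hθ0 : 0 ≤ θ := by rw [hθ]; positivity
  have hyn : y * n = √n := by
    rw [hy, Real.sqrt_eq_rpow]
    nth_rewrite 2 [← Real.rpow_one (n : ℝ)]
    rw [← Real.rpow_add hn0]
    norm_num
  have hys : y * √n = 1 := by
    rw [hy, Real.sqrt_eq_rpow, ← Real.rpow_add hn0]
    norm_num
  have hcardΦ : (#(univ : Finset (X ↪ W)) : ℝ) = n.descFactorial (Fintype.card X) := by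
    rw [card_univ, Fintype.card_embedding_eq]
  have hΦ : (univ : Finset (X ↪ W)).Nonempty := by
    rw [← card_pos, card_univ, Fintype.card_embedding_eq, Nat.pos_iff_ne_zero, Ne,
      Nat.descFactorial_eq_zero_iff_lt]
    omega
  -- The threshold balances the rounds. A copy has at most D n edges, so its prefactor is at most
  -- exp(D √n) ≤ exp(D) ^ s, which θ ^ s absorbs; fewer than s edges means fewer than √n, and then
  -- the prefactor is at most exp 1.
  set s := ⌈√(n : ℝ)⌉₊ with hs
  have hs1 : 1 ≤ s := Nat.one_le_ceil_iff.2 (by positivity)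
  refine binomialExp_not_contains_le hΦ (S := fun φ ↦ EdgeFamily.copy A φ) (fun φ _ e he ↦
    mem_powersetCard.2 ⟨subset_univ _, (h.copy φ).card_eq e he⟩) s hq hq1 (by positivity)
    (by positivity) ?_ ?_
  · intro φ₀ _
    rw [hcardΦ]
    refine (h.sum_weight_le hr hd hD hX hW hq hθ hθ2 (φ₀ := φ₀) subset_rfl s).trans ?_
    refine mul_le_mul_of_nonneg_right ?_ (by positivity)
    have h1 : y * #(EdgeFamily.copy A φ₀) ≤ s * D := by
      rw [card_copy]
      have hA : (#A : ℝ) ≤ D * n := by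
        exact_mod_cast (h.card_le hr).trans (Nat.mul_le_mul_left D (by omega))
      calc y * #A ≤ y * (D * n) := mul_le_mul_of_nonneg_left hA hy0
        _ = √n * D := by rw [← hyn]; ring
        _ ≤ s * D := mul_le_mul_of_nonneg_right (Nat.le_ceil _) (by positivity)
    calc Real.exp (y * #(EdgeFamily.copy A φ₀)) * (2 * θ ^ s)
        ≤ Real.exp (s * D) * (2 * θ ^ s) :=
          mul_le_mul_of_nonneg_right (Real.exp_le_exp.2 h1) (by positivity)
      _ = 2 * (Real.exp D * θ) ^ s := by rw [Real.exp_nat_mul, mul_pow]; ring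
      _ ≤ 2 * (Real.exp D * θ) :=
          mul_le_mul_of_nonneg_left (pow_le_of_le_one (by positivity) hθD (by omega)) (by norm_num)
  · intro φ₀ _ F hF hFs
    rw [hcardΦ]
    refine (h.sum_weight_le hr hd hD hX hW hq hθ hθ2 hF 1).trans ?_
    refine mul_le_mul_of_nonneg_right ?_ (by positivity)
    have h1 : y * #F ≤ 1 := by
      rw [← hys]
      exact mul_le_mul_of_nonneg_left (Nat.lt_ceil.1 hFs).le hy0
    rw [pow_one, mul_left_comm]
    refine mul_le_mul_of_nonneg_left ?_ (by norm_num)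
    exact mul_le_mul_of_nonneg_right (Real.exp_le_exp.2 h1) hθ0

end IsSparse

end EdgeFamily

/-! ### Edges with heads: from rankings to sparsity. -/

namespace EdgeFamily

open Finset RandomSubset

variable {X : Type*} [DecidableEq X]

/-- Every edge has a head, the vertex of strictly largest rank in it, and every vertex is the head
of at most `d` edges. -/
def HasHeads (T : Finset (Finset X)) (d : ℕ) : Prop :=
  ∃ (rank : X → ℕ) (head : Finset X → X),
    (∀ e ∈ T, head e ∈ e ∧ ∀ u ∈ e, u ≠ head e → rank u < rank (head e)) ∧
    ∀ v, #{e ∈ T | head e = v} ≤ d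

lemma HasHeads.mono {S T : Finset (Finset X)} {d : ℕ} (h : HasHeads T d) (hST : S ⊆ T) :
    HasHeads S d := by
  obtain ⟨rank, head, h1, h2⟩ := h
  exact ⟨rank, head, fun e he ↦ h1 e (hST he), fun v ↦
    (card_le_card (filter_subset_filter _ hST)).trans (h2 v)⟩

/-- A nonempty edge family with heads spans many vertices. -/
lemma HasHeads.card_le {C : Finset (Finset X)} {r d : ℕ} (h : HasHeads C d) (hC : C.Nonempty)
    (hr : 2 ≤ r) (hrd : 3 ≤ r ∨ 2 ≤ d) (hcard : ∀ e ∈ C, #e = r) :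
    2 * #C + 3 * d ≤ 2 * d * #(C.biUnion id) := by
  obtain ⟨rank, head, h1, h2⟩ := h
  obtain ⟨e₀, he₀, hmin⟩ := exists_min_image C (fun e ↦ rank (head e)) hC
  set H := C.image head with hH
  set V := C.biUnion id with hV
  have hHV : H ⊆ V := by
    intro v hv
    obtain ⟨e, he, rfl⟩ := mem_image.1 hv
    exact mem_biUnion.2 ⟨e, he, (h1 e he).1⟩
  -- In an edge with the lowest head, all other vertices rank below every head and so are not heads.
  have hnon : ∀ e ∈ C, head e = head e₀ → e.erase (head e) ⊆ V \ H := by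
    intro e he hee u hu
    obtain ⟨hu1, hu2⟩ := mem_erase.1 hu
    refine mem_sdiff.2 ⟨mem_biUnion.2 ⟨e, he, hu2⟩, fun huH ↦ ?_⟩
    obtain ⟨e', he', rfl⟩ := mem_image.1 huH
    have h3 := (h1 e he).2 _ hu2 hu1
    have h4 := hmin e' he'
    rw [hee] at h3
    omega
  have hsd : #(V \ H) + #H = #V := card_sdiff_add_card_eq_card hHV
  have hfib : #C = ∑ v ∈ H, #{e ∈ C | head e = v} :=
    card_eq_sum_card_fiberwise fun e he ↦ mem_image_of_mem head he
  have hCle : #C ≤ d * #H := by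
    rw [hfib, mul_comm]
    exact (sum_le_card_nsmul _ _ d fun v _ ↦ h2 v).trans (by simp)
  have hfin : ∀ m, 2 ≤ #(V \ H) → m = d * #V → 2 * #C + 3 * d ≤ 2 * m := by
    rintro m h5 rfl
    have : d * 2 ≤ d * #(V \ H) := Nat.mul_le_mul_left d h5
    rw [← hsd, mul_add]
    omega
  rw [mul_assoc]
  -- Two vertices that are not heads suffice, as then #C ≤ d (#V - 2). An edge of size at least 3
  -- with the lowest head provides them, and so do two different edges with that head.
  by_cases h3 : 3 ≤ r
  · refine hfin _ (le_trans ?_ (card_le_card (hnon e₀ he₀ rfl))) rfl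
    rw [card_erase_of_mem (h1 e₀ he₀).1, hcard e₀ he₀]
    omega
  have hd2 : 2 ≤ d := hrd.resolve_left h3
  by_cases hone : ∃ e₁ ∈ C, e₁ ≠ e₀ ∧ head e₁ = head e₀
  · obtain ⟨e₁, he₁, hne, hhd⟩ := hone
    refine hfin _ ?_ rfl
    have hsub : (e₀ ∪ e₁).erase (head e₀) ⊆ V \ H := by
      rw [erase_union_distrib]
      exact union_subset (hnon e₀ he₀ rfl) (hhd ▸ hnon e₁ he₁ hhd)
    refine le_trans ?_ (card_le_card hsub)
    rw [card_erase_of_mem (mem_union_left _ (h1 e₀ he₀).1)]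
    have : #e₀ < #(e₀ ∪ e₁) := by
      refine card_lt_card (Finset.ssubset_iff_subset_ne.2 ⟨subset_union_left, fun heq ↦ hne ?_⟩)
      refine eq_of_subset_of_card_le ?_ (by rw [hcard e₀ he₀, hcard e₁ he₁])
      rw [heq]
      exact subset_union_right
    rw [hcard e₀ he₀] at this
    omega
  -- Here perhaps only one vertex is not a head, but the lowest head accounts for one edge instead
  -- of d. This gives #C ≤ 1 + d (#V - 2), which is enough because d ≥ 2.
  · push Not at hone
    have hw : head e₀ ∈ H := mem_image_of_mem head he₀
    have h5 : #{e ∈ C | head e = head e₀} ≤ 1 := by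
      refine card_le_one.2 fun a ha b hb ↦ ?_
      have ha := mem_filter.1 ha
      have hb := mem_filter.1 hb
      by_contra hab
      by_cases hae : a = e₀
      · exact hone b hb.1 (fun hbe ↦ hab (hae.trans hbe.symm)) hb.2
      · exact hone a ha.1 hae ha.2
    have h6 : #C ≤ 1 + d * (#H - 1) := by
      rw [hfib, ← add_sum_erase _ _ hw]
      refine add_le_add h5 ?_
      refine (sum_le_card_nsmul _ _ d fun v _ ↦ h2 v).trans ?_
      rw [card_erase_of_mem hw, smul_eq_mul, mul_comm]
    have h7 : 1 ≤ #(V \ H) := by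
      refine le_trans ?_ (card_le_card (hnon e₀ he₀ rfl))
      rw [card_erase_of_mem (h1 e₀ he₀).1, hcard e₀ he₀]
      omega
    have h8 : 1 ≤ #H := card_pos.2 ⟨_, hw⟩
    obtain ⟨a, ha⟩ : ∃ a, #H = a + 1 := ⟨#H - 1, by omega⟩
    rw [ha, Nat.add_sub_cancel] at h6
    have h9 : d * (a + 2) ≤ d * #V := Nat.mul_le_mul_left d (by omega)
    rw [mul_add] at h9
    omega

/-- The edges of `T` connected to `e` through intersecting edges of `T`. -/
lemma exists_component {T : Finset (Finset X)} {e : Finset X} (he : e ∈ T) :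
    ∃ C ⊆ T, e ∈ C ∧ Generates {e} C ∧ ∀ a ∈ C, ∀ b ∈ T, (a ∩ b).Nonempty → b ∈ C := by
  classical
  set C := {b ∈ T | ∀ P : Finset (Finset X), e ∈ P →
    (∀ a ∈ P, ∀ b ∈ T, (a ∩ b).Nonempty → b ∈ P) → b ∈ P} with hC
  have heC : e ∈ C := mem_filter.2 ⟨he, fun P h _ ↦ h⟩
  have hclosed : ∀ a ∈ C, ∀ b ∈ T, (a ∩ b).Nonempty → b ∈ C := by
    intro a ha b hb hab
    exact mem_filter.2 ⟨hb, fun P hP hcl ↦ hcl a ((mem_filter.1 ha).2 P hP hcl) b hb hab⟩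
  refine ⟨C, filter_subset _ _, heC, ⟨singleton_subset_iff.2 heC, fun P hP hcl b hb ↦ ?_⟩, hclosed⟩
  have := (mem_filter.1 hb).2 (P ∩ C) (mem_inter.2 ⟨hP (mem_singleton_self e), heC⟩)
    fun a ha b hb hab ↦ by
      obtain ⟨haP, haC⟩ := mem_inter.1 ha
      have hbC := hclosed a haC b hb hab
      exact mem_inter.2 ⟨hcl a haP b hbC hab, hbC⟩
  exact (mem_inter.1 this).1

/-- An edge family with heads is generated by one edge per component, and spans correspondingly
many vertices. -/
lemma HasHeads.exists_generates {T : Finset (Finset X)} {r d : ℕ} (h : HasHeads T d)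
    (hr : 2 ≤ r) (hrd : 3 ≤ r ∨ 2 ≤ d) (hcard : ∀ e ∈ T, #e = r) :
    ∃ R, Generates R T ∧ 2 * #T + 3 * d * #R ≤ 2 * d * #(T.biUnion id) := by
  induction hn : #T using Nat.strong_induction_on generalizing T with
  | _ n ih =>
  subst hn
  rcases T.eq_empty_or_nonempty with rfl | ⟨e, he⟩
  · exact ⟨∅, ⟨subset_rfl, fun _ _ _ ↦ empty_subset _⟩, by simp⟩
  obtain ⟨C, hCT, heC, hgen, hclosed⟩ := exists_component he
  have hlt : #(T \ C) < #T :=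
    card_lt_card (sdiff_ssubset hCT ⟨e, heC⟩)
  obtain ⟨R, hR, hle⟩ := ih _ hlt (h.mono sdiff_subset) (fun e he ↦ hcard e (sdiff_subset he)) rfl
  have hCle := (h.mono hCT).card_le ⟨e, heC⟩ hr hrd fun e he ↦ hcard e (hCT he)
  refine ⟨insert e R, ⟨insert_subset he (hR.1.trans sdiff_subset), fun P hP hcl ↦ ?_⟩, ?_⟩
  · have h1 : C ⊆ P := hgen.2 P (singleton_subset_iff.2 (hP (mem_insert_self _ _)))
      fun a ha b hb ↦ hcl a ha b (hCT hb)
    have h2 : T \ C ⊆ P := hR.2 P ((subset_insert _ _).trans hP)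
      fun a ha b hb ↦ hcl a ha b (sdiff_subset hb)
    rw [← union_sdiff_of_subset hCT]
    exact union_subset h1 h2
  · have hdisj : Disjoint (C.biUnion id) ((T \ C).biUnion id) := by
      rw [disjoint_left]
      intro x hx hx'
      obtain ⟨a, ha, hxa⟩ := mem_biUnion.1 hx
      obtain ⟨b, hb, hxb⟩ := mem_biUnion.1 hx'
      obtain ⟨hbT, hbC⟩ := mem_sdiff.1 hb
      exact hbC (hclosed a ha b hbT ⟨x, mem_inter.2 ⟨hxa, hxb⟩⟩)
    have hT : T.biUnion id = C.biUnion id ∪ (T \ C).biUnion id := by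
      rw [← union_biUnion, union_sdiff_of_subset hCT]
    rw [hT, card_union_of_disjoint hdisj]
    have h3 : #(insert e R) ≤ #R + 1 := card_insert_le _ _
    have h4 : #(T \ C) + #C = #T := card_sdiff_add_card_eq_card hCT
    have h5 : 3 * d * #(insert e R) ≤ 3 * d * (#R + 1) := Nat.mul_le_mul_left _ h3
    rw [mul_add] at h5 ⊢
    omega

/-- An edge family is sparse if all its subfamilies have heads after the removal of a small
proportion of their edges. -/
lemma isSparse_of_hasHeads {A : Finset (Finset X)} {r d D : ℕ} {ε : ℝ} (hr : 2 ≤ r)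
    (hrd : 3 ≤ r ∨ 2 ≤ d) (hcard : ∀ e ∈ A, #e = r) (hdeg : ∀ x, #{e ∈ A | x ∈ e} ≤ D)
    (h : ∀ T ⊆ A, ∃ T' ⊆ T, HasHeads T' d ∧ (#(T \ T') : ℝ) ≤ ε * #T) :
    IsSparse A r d D ((3 * d + 2) * ε) where
  card_eq := hcard
  degree := hdeg
  sparse T hT := by
    obtain ⟨T', hT', hh, hε⟩ := h T hT
    obtain ⟨R, hR, hle⟩ := hh.exists_generates hr hrd fun e he ↦ hcard e (hT (hT' he))
    -- Every removed edge becomes a root of its own. It costs 3d as a root and 2 as an edge, whence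
    -- the factor 3d + 2.
    refine ⟨R ∪ (T \ T'), ⟨union_subset (hR.1.trans hT') sdiff_subset, fun P hP hcl ↦ ?_⟩, ?_⟩
    · have h1 : T' ⊆ P := hR.2 P (subset_union_left.trans hP) fun a ha b hb ↦ hcl a ha b (hT' hb)
      rw [← union_sdiff_of_subset hT']
      exact union_subset h1 (subset_union_right.trans hP)
    · have h1 : (#(R ∪ (T \ T')) : ℝ) ≤ #R + #(T \ T') := by exact_mod_cast card_union_le _ _
      have h2 : (#T : ℝ) = #(T \ T') + #T' := by
        exact_mod_cast (card_sdiff_add_card_eq_card hT').symm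
      have h3 : (#(T'.biUnion id) : ℝ) ≤ #(T.biUnion id) := by
        exact_mod_cast card_le_card (biUnion_subset_biUnion_of_subset_left id hT')
      have h4 : 2 * (#T' : ℝ) + 3 * d * #R ≤ 2 * d * #(T'.biUnion id) := by exact_mod_cast hle
      have h5 : 3 * (d : ℝ) * #(R ∪ (T \ T')) ≤ 3 * d * (#R + #(T \ T')) :=
        mul_le_mul_of_nonneg_left h1 (by positivity)
      have h6 : 2 * (d : ℝ) * #(T'.biUnion id) ≤ 2 * d * #(T.biUnion id) :=
        mul_le_mul_of_nonneg_left h3 (by positivity)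
      have h7 : (3 * (d : ℝ) + 2) * #(T \ T') ≤ (3 * d + 2) * (ε * #T) :=
        mul_le_mul_of_nonneg_left hε (by positivity)
      nlinarith

/-- Averaging: if every element carries at most `k` labels, then some label of `I` is carried by at
most a proportion `k / #I` of the elements. -/
lemma exists_rare_label {α β : Type*} [DecidableEq β] (T : Finset α) (I : Finset β)
    (hI : I.Nonempty) (L : α → Finset β) (k : ℕ) (hL : ∀ e ∈ T, #(L e) ≤ k) :
    ∃ ρ ∈ I, #{e ∈ T | ρ ∈ L e} * #I ≤ k * #T := by
  by_contra! hcon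
  have h1 : ∑ ρ ∈ I, #{e ∈ T | ρ ∈ L e} ≤ k * #T := by
    simp only [card_filter]
    rw [sum_comm, mul_comm]
    refine sum_le_card_nsmul _ _ k fun e he ↦ ?_
    rw [← card_filter]
    refine (card_le_card ?_).trans (hL e he)
    intro ρ hρ
    exact (mem_filter.1 hρ).2
  have h2 : #I * (k * #T) < ∑ ρ ∈ I, #{e ∈ T | ρ ∈ L e} * #I := by
    rw [← smul_eq_mul, ← sum_const]
    exact sum_lt_sum_of_nonempty hI hcon
  rw [← sum_mul, mul_comm] at h2
  exact absurd (Nat.lt_of_mul_lt_mul_right h2) (not_lt.2 h1)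

end EdgeFamily

/-! ### Zigzag digraphs and the edges cut out of their walks. -/

namespace EdgeFamily

open Finset RandomSubset

variable {X : Type*}

/-- `w 0, …, w j` is a walk in the digraph `S`. -/
def IsWalk (S : X → X → Prop) (w : ℕ → X) (j : ℕ) : Prop := ∀ i < j, S (w i) (w (i + 1))

/-- The digraph `S` consists of arms; the arms are totally preordered by `τ`. Arcs run through an
arm of outgoing type (`out`) towards its end, from there to the beginning of another arm, and then
away from that beginning. The vertices are ranked by their arm and then by the distance to the end
or beginning, and every arm is adjacent to at most one arm that is smaller. -/
structure IsZigzag (S : X → X → Prop) (out inner : X → Prop) (τ rank : X → ℕ) : Prop where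
  rank_lt : ∀ a b, τ a < τ b → rank a < rank b
  out_out : ∀ a b, S a b → out a → out b → τ a = τ b ∧ rank b < rank a
  out_in : ∀ a b, S a b → out a → ¬ out b → τ a < τ b ∨ (τ b < τ a ∧ inner b)
  not_out : ∀ a b, S a b → ¬ out a → ¬ out b ∧ τ a ≤ τ b ∧ rank a < rank b
  inner_eq : ∀ a b, S a b → inner a → τ a = τ b ∧ inner b
  inner_not_out : ∀ a, inner a → ¬ out a
  pred_unique : ∀ a a' b, S a b → S a' b → τ a ≤ τ b → τ a' ≤ τ b → a = a'
  succ_unique : ∀ a b b', S a b → S a b' → τ b ≤ τ a → τ b' ≤ τ a → b = b'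

namespace IsZigzag

variable {S : X → X → Prop} {out inner : X → Prop} {τ rank : X → ℕ}

/-- A walk has its vertex of largest rank at one of its ends. -/
lemma walk_cases (h : IsZigzag S out inner τ rank) {w : ℕ → X} {j : ℕ} (hw : IsWalk S w j) :
    (¬ out (w j) ∧ ∀ i < j, τ (w i) ≤ τ (w (i + 1)) ∧ rank (w i) < rank (w j)) ∨
    (out (w 0) ∧ ∀ i < j, τ (w (i + 1)) ≤ τ (w i) ∧ rank (w (i + 1)) < rank (w 0)) := by
  -- The three states of a walk: still descending in its first outgoing arm; past any outgoing arm
  -- and ascending, so that the current vertex is the highest; or fallen into a smaller inner arm,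
  -- which it cannot leave, so that the first vertex remains the highest.
  suffices H : (∀ i ≤ j, out (w i) ∧ τ (w i) = τ (w 0) ∧ (i ≠ 0 → rank (w i) < rank (w 0))) ∨
      (¬ out (w j) ∧ ∀ i < j, τ (w i) ≤ τ (w (i + 1)) ∧ rank (w i) < rank (w j)) ∨
      (inner (w j) ∧ τ (w j) < τ (w 0) ∧ out (w 0) ∧
        ∀ i < j, τ (w (i + 1)) ≤ τ (w i) ∧ rank (w (i + 1)) < rank (w 0)) by
    rcases H with H | H | H
    · refine Or.inr ⟨(H 0 (Nat.zero_le _)).1, fun i hi ↦ ⟨?_, (H (i + 1) hi).2.2 (by omega)⟩⟩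
      rw [(H (i + 1) hi).2.1, (H i hi.le).2.1]
    · exact Or.inl H
    · exact Or.inr H.2.2
  induction j with
  | zero =>
    by_cases h0 : out (w 0)
    · left
      intro i hi
      obtain rfl : i = 0 := by omega
      exact ⟨h0, rfl, fun h ↦ absurd rfl h⟩
    · exact Or.inr (Or.inl ⟨h0, fun i hi ↦ absurd hi (Nat.not_lt_zero i)⟩)
  | succ j ih =>
    have harc := hw j (Nat.lt_succ_self j)
    rcases ih fun i hi ↦ hw i (hi.trans (Nat.lt_succ_self j)) with H | H | H
    · obtain ⟨hj1, hj2, hj3⟩ := H j le_rfl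
      have hjr : rank (w j) ≤ rank (w 0) := by
        rcases eq_or_ne j 0 with rfl | hj
        · exact le_rfl
        · exact (hj3 hj).le
      by_cases hout : out (w (j + 1))
      · left
        intro i hi
        rcases Nat.lt_or_ge i (j + 1) with hi' | hi'
        · exact H i (by omega)
        · obtain rfl : i = j + 1 := by omega
          obtain ⟨e1, e2⟩ := h.out_out _ _ harc hj1 hout
          exact ⟨hout, by omega, fun _ ↦ by omega⟩
      · right
        rcases h.out_in _ _ harc hj1 hout with hτ | ⟨hτ, hin⟩
        · left
          refine ⟨hout, fun i hi ↦ ?_⟩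
          have hi2 := (H i (by omega)).2.1
          refine ⟨?_, h.rank_lt _ _ (by omega)⟩
          rcases Nat.lt_or_ge i j with hi' | hi'
          · have := (H (i + 1) (by omega)).2.1
            omega
          · obtain rfl : i = j := by omega
            exact hτ.le
        · right
          refine ⟨hin, by omega, (H 0 (Nat.zero_le _)).1, fun i hi ↦ ?_⟩
          have hi2 := (H i (by omega)).2.1
          rcases Nat.lt_or_ge i j with hi' | hi'
          · have h1 := H (i + 1) (by omega)
            exact ⟨by omega, h1.2.2 (by omega)⟩
          · obtain rfl : i = j := by omega
            exact ⟨hτ.le, h.rank_lt _ _ (by omega)⟩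
    · right; left
      obtain ⟨h1, h2, h3⟩ := h.not_out _ _ harc H.1
      refine ⟨h1, fun i hi ↦ ?_⟩
      rcases Nat.lt_or_ge i j with hi' | hi'
      · exact ⟨(H.2 i hi').1, (H.2 i hi').2.trans h3⟩
      · obtain rfl : i = j := by omega
        exact ⟨h2, h3⟩
    · right; right
      obtain ⟨h1, h2⟩ := h.inner_eq _ _ harc H.1
      refine ⟨h2, by omega, H.2.2.1, fun i hi ↦ ?_⟩
      rcases Nat.lt_or_ge i j with hi' | hi'
      · exact H.2.2.2 i hi'
      · obtain rfl : i = j := by omega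
        exact ⟨h1.symm.le, h.rank_lt _ _ (by omega)⟩

/-- The vertices of a walk are determined by its vertex of largest rank. -/
lemma exists_line (h : IsZigzag S out inner τ rank) :
    ∃ line : X → ℕ → X, ∀ w j, IsWalk S w j → ∃ v,
      (∀ i, 1 ≤ i → i ≤ j → rank (line v i) < rank v) ∧ line v 0 = v ∧
      ((∀ i ≤ j, w i = line v i) ∨ ∀ i ≤ j, w (j - i) = line v i) := by
  classical
  -- The neighbours towards arms that are not larger, unique by the zigzag axioms. The default value
  -- is irrelevant: iterates are only evaluated along existing walks.
  set pred : X → X := fun b ↦ if hb : ∃ a, S a b ∧ τ a ≤ τ b then hb.choose else b with hpred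
  set succ : X → X := fun a ↦ if ha : ∃ b, S a b ∧ τ b ≤ τ a then ha.choose else a with hsucc
  have hp : ∀ a b, S a b → τ a ≤ τ b → pred b = a := by
    intro a b hab hτ
    have hb : ∃ a, S a b ∧ τ a ≤ τ b := ⟨a, hab, hτ⟩
    rw [hpred]
    simp only [dif_pos hb]
    exact h.pred_unique _ _ _ hb.choose_spec.1 hab hb.choose_spec.2 hτ
  have hs : ∀ a b, S a b → τ b ≤ τ a → succ a = b := by
    intro a b hab hτ
    have ha : ∃ b, S a b ∧ τ b ≤ τ a := ⟨b, hab, hτ⟩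
    rw [hsucc]
    simp only [dif_pos ha]
    exact h.succ_unique _ _ _ ha.choose_spec.1 hab ha.choose_spec.2 hτ
  refine ⟨fun v i ↦ if out v then succ^[i] v else pred^[i] v, fun w j hw ↦ ?_⟩
  rcases h.walk_cases hw with ⟨hout, H⟩ | ⟨hout, H⟩
  · have hline : ∀ i ≤ j, w (j - i) = pred^[i] (w j) := by
      intro i
      induction i with
      | zero => intro _; rfl
      | succ i ih =>
        intro hi
        rw [Function.iterate_succ_apply', ← ih (by omega)]
        have h1 := hw (j - (i + 1)) (by omega)
        have h2 := (H (j - (i + 1)) (by omega)).1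
        rw [show j - (i + 1) + 1 = j - i by omega] at h1 h2
        exact (hp _ _ h1 h2).symm
    refine ⟨w j, fun i hi hij ↦ ?_, by simp, Or.inr fun i hi ↦ ?_⟩
    · simp only [if_neg hout]
      rw [← hline i hij]
      exact (H (j - i) (by omega)).2
    · simp only [if_neg hout]
      exact hline i hi
  · have hline : ∀ i ≤ j, w i = succ^[i] (w 0) := by
      intro i
      induction i with
      | zero => intro _; rfl
      | succ i ih =>
        intro hi
        rw [Function.iterate_succ_apply', ← ih (by omega)]
        exact (hs _ _ (hw i (by omega)) (H i (by omega)).1).symm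
    refine ⟨w 0, fun i hi hij ↦ ?_, by simp, Or.inl fun i hi ↦ ?_⟩
    · simp only [if_pos hout]
      rw [← hline i hij]
      have := (H (i - 1) (by omega)).2
      rwa [show i - 1 + 1 = i by omega] at this
    · simp only [if_pos hout]
      exact hline i hi

end IsZigzag

section WalkEdges

variable [Fintype X] [DecidableEq X]

open Classical in
/-- The `r`-element sets that arise by restricting walks in `S` to one of the index sets in `𝒮`. -/
noncomputable def walkEdges (S : X → X → Prop) (𝒮 : Finset (Finset ℕ)) (r : ℕ) :
    Finset (Finset X) :=
  {e | #e = r ∧ ∃ I ∈ 𝒮, ∃ w, IsWalk S w (I.sup id) ∧ e = I.image w}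

lemma mem_walkEdges {S : X → X → Prop} {𝒮 : Finset (Finset ℕ)} {r : ℕ} {e : Finset X} :
    e ∈ walkEdges S 𝒮 r ↔ #e = r ∧ ∃ I ∈ 𝒮, ∃ w, IsWalk S w (I.sup id) ∧ e = I.image w := by
  simp [walkEdges]

/-- An index set that contains `0` and is symmetric under reversal. -/
def IsSymmetricShape (I : Finset ℕ) : Prop := 0 ∈ I ∧ ∀ i ∈ I, I.sup id - i ∈ I

/-- The head of an edge is the highest vertex of its walk. It sits at an end of the walk, and
symmetry of the shape makes it irrelevant at which one. Given the head, the edge depends only on its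
shape, so a vertex is the head of at most one edge per shape. -/
lemma IsZigzag.hasHeads [Nonempty X] {S : X → X → Prop} {out inner : X → Prop} {τ rank : X → ℕ}
    (h : IsZigzag S out inner τ rank) {𝒮 : Finset (Finset ℕ)} {r : ℕ}
    (h𝒮 : ∀ I ∈ 𝒮, IsSymmetricShape I) : HasHeads (walkEdges S 𝒮 r) #𝒮 := by
  obtain ⟨line, hline⟩ := h.exists_line
  have key : ∀ e ∈ walkEdges S 𝒮 r, ∃ v, (v ∈ e ∧ ∀ u ∈ e, u ≠ v → rank u < rank v) ∧
      ∃ I ∈ 𝒮, e = I.image (line v) := by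
    intro e he
    obtain ⟨-, I, hI, w, hw, rfl⟩ := mem_walkEdges.1 he
    obtain ⟨v, h1, h0, h2⟩ := hline w _ hw
    have hle : ∀ i ∈ I, i ≤ I.sup id := fun i hi ↦ le_sup (f := id) hi
    have heq : I.image w = I.image (line v) := by
      rcases h2 with h2 | h2
      · exact image_congr fun i hi ↦ h2 i (hle i hi)
      · ext x
        simp only [mem_image]
        constructor
        · rintro ⟨i, hi, rfl⟩
          refine ⟨I.sup id - i, (h𝒮 I hI).2 i hi, ?_⟩
          rw [← h2 _ (Nat.sub_le _ _)]
          congr 1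
          have := hle i hi
          omega
        · rintro ⟨i, hi, rfl⟩
          exact ⟨_, (h𝒮 I hI).2 i hi, h2 i (hle i hi)⟩
    refine ⟨v, ⟨?_, ?_⟩, I, hI, heq⟩
    · rw [heq]
      exact mem_image.2 ⟨0, (h𝒮 I hI).1, h0⟩
    · rw [heq]
      intro u hu huv
      obtain ⟨i, hi, rfl⟩ := mem_image.1 hu
      refine h1 i ?_ (hle i hi)
      rcases Nat.eq_zero_or_pos i with rfl | hi0
      · exact absurd h0 huv
      · exact hi0
  choose! head hhead hI using key
  refine ⟨rank, head, hhead, fun v ↦ (card_le_card ?_).trans (card_image_le (f := fun I ↦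
    I.image (line v)))⟩
  intro e he
  obtain ⟨heT, hev⟩ := mem_filter.1 he
  obtain ⟨I, hI, heI⟩ := hI e heT
  rw [hev] at heI
  exact mem_image.2 ⟨I, hI, heI.symm⟩

/-- In a digraph of bounded degree, every vertex lies in boundedly many walk edges. -/
lemma card_walkEdges_mem_le {S : X → X → Prop} {𝒮 : Finset (Finset ℕ)} {r k Δ : ℕ}
    (h𝒮 : ∀ I ∈ 𝒮, I.sup id ≤ k) (N : X → Finset X) (hN : ∀ x, #(N x) ≤ Δ)
    (hself : ∀ x, x ∈ N x) (hS : ∀ x y, S x y → y ∈ N x ∧ x ∈ N y) (x : X) :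
    #{e ∈ walkEdges S 𝒮 r | x ∈ e} ≤ 2 ^ Δ ^ k := by
  set ball : ℕ → Finset X := fun t ↦ Nat.rec {x} (fun _ B ↦ B.biUnion N) t with hball
  have hsucc : ∀ t, ball (t + 1) = (ball t).biUnion N := fun t ↦ rfl
  have hcard : ∀ t, #(ball t) ≤ Δ ^ t := by
    intro t
    induction t with
    | zero => exact (card_singleton x).le
    | succ t ih =>
      rw [hsucc, pow_succ]
      exact (card_biUnion_le_card_mul _ _ _ fun y _ ↦ hN y).trans (Nat.mul_le_mul_right _ ih)
  have hmono : Monotone ball := monotone_nat_of_le_succ fun t y hy ↦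
    mem_biUnion.2 ⟨y, hy, hself y⟩
  have hwalk : ∀ w j, IsWalk S w j → ∀ a ≤ j, ∀ t, (a + t ≤ j → w (a + t) ∈ ball t ∨ w a ≠ x) ∧
      (t ≤ a → w (a - t) ∈ ball t ∨ w a ≠ x) := by
    intro w j hw a ha t
    by_cases hax : w a = x
    swap
    · exact ⟨fun _ ↦ Or.inr hax, fun _ ↦ Or.inr hax⟩
    induction t with
    | zero => exact ⟨fun _ ↦ Or.inl (mem_singleton.2 hax), fun _ ↦ Or.inl (mem_singleton.2 hax)⟩
    | succ t ih =>
      refine ⟨fun ht ↦ Or.inl ?_, fun ht ↦ Or.inl ?_⟩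
      · have h1 := (ih.1 (by omega)).resolve_right (by simp [hax])
        exact mem_biUnion.2 ⟨_, h1, (hS _ _ (hw (a + t) (by omega))).1⟩
      · have h1 := (ih.2 (by omega)).resolve_right (by simp [hax])
        have h2 := hw (a - (t + 1)) (by omega)
        rw [show a - (t + 1) + 1 = a - t by omega] at h2
        exact mem_biUnion.2 ⟨_, h1, (hS _ _ h2).2⟩
  calc #{e ∈ walkEdges S 𝒮 r | x ∈ e} ≤ #(ball k).powerset := by
        refine card_le_card fun e he ↦ mem_powerset.2 fun y hy ↦ ?_
        obtain ⟨he, hx⟩ := mem_filter.1 he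
        obtain ⟨-, I, hI, w, hw, rfl⟩ := mem_walkEdges.1 he
        obtain ⟨a, ha, hax⟩ := mem_image.1 hx
        obtain ⟨b, hb, rfl⟩ := mem_image.1 hy
        have ha' : a ≤ I.sup id := le_sup (f := id) ha
        have hb' : b ≤ I.sup id := le_sup (f := id) hb
        have hk := h𝒮 I hI
        rcases le_total a b with hab | hab
        · have := ((hwalk w _ hw a ha' (b - a)).1 (by omega)).resolve_right (by simp [hax])
          rw [show a + (b - a) = b by omega] at this
          exact hmono (by omega) this
        · have := ((hwalk w _ hw a ha' (a - b)).2 (by omega)).resolve_right (by simp [hax])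
          rw [show a - (a - b) = b by omega] at this
          exact hmono (by omega) this
    _ ≤ 2 ^ Δ ^ k := by
        rw [card_powerset]
        exact Nat.pow_le_pow_right (by norm_num) (hcard k)

/-- If the arcs of a digraph carry two kinds of labels, such that the arcs that avoid any given
labels form a zigzag, then the walk edges of the digraph form a sparse family. -/
lemma isSparse_walkEdges [Nonempty X] {S : X → X → Prop} {𝒮 : Finset (Finset ℕ)} {r k Δ : ℕ}
    (hr : 2 ≤ r) (hrd : 3 ≤ r ∨ 2 ≤ #𝒮) (h𝒮 : ∀ I ∈ 𝒮, IsSymmetricShape I)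
    (h𝒮k : ∀ I ∈ 𝒮, I.sup id ≤ k) (N : X → Finset X) (hN : ∀ x, #(N x) ≤ Δ)
    (hself : ∀ x, x ∈ N x) (hS : ∀ x y, S x y → y ∈ N x ∧ x ∈ N y)
    (lab₁ lab₂ : X → X → ℕ) (I₁ I₂ : Finset ℕ) (hI₁ : I₁.Nonempty) (hI₂ : I₂.Nonempty)
    (hzig : ∀ ρ ∈ I₁, ∀ c ∈ I₂, ∃ out inner τ rank,
      IsZigzag (fun x y ↦ S x y ∧ lab₁ x y ≠ ρ ∧ lab₂ x y ≠ c) out inner τ rank) :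
    IsSparse (walkEdges S 𝒮 r) r #𝒮 (2 ^ Δ ^ k)
      ((3 * #𝒮 + 2) * (k / #I₁ + k / #I₂)) := by
  classical
  refine isSparse_of_hasHeads hr hrd (fun e he ↦ (mem_walkEdges.1 he).1)
    (card_walkEdges_mem_le h𝒮k N hN hself hS) fun T hT ↦ ?_
  have hex : ∀ e : Finset X, ∃ I w, e ∈ T → I ∈ 𝒮 ∧ IsWalk S w (I.sup id) ∧ e = I.image w := by
    intro e
    by_cases he : e ∈ T
    · obtain ⟨-, I, hI, w, hw, h⟩ := mem_walkEdges.1 (hT he)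
      exact ⟨I, w, fun _ ↦ ⟨hI, hw, h⟩⟩
    · exact ⟨∅, fun _ ↦ Classical.arbitrary X, fun h ↦ absurd h he⟩
  choose I w hIw using hex
  -- The chosen walk of an edge has at most k arcs, so the edge carries at most k labels of each
  -- kind and some label is rare.
  have hlab : ∀ (lab : X → X → ℕ) (J : Finset ℕ), J.Nonempty → ∃ ρ ∈ J, 
      (#{e ∈ T | ρ ∈ (range ((I e).sup id)).image fun i ↦ lab (w e i) (w e (i + 1))} : ℝ) ≤
        k / #J * #T := by
    intro lab J hJ
    obtain ⟨ρ, hρ, hle⟩ := exists_rare_label T J hJ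
      (fun e ↦ (range ((I e).sup id)).image fun i ↦ lab (w e i) (w e (i + 1))) k fun e he ↦
      card_image_le.trans (by rw [card_range]; exact h𝒮k _ (hIw e he).1)
    refine ⟨ρ, hρ, ?_⟩
    have hJ0 : (0 : ℝ) < #J := by exact_mod_cast hJ.card_pos
    rw [div_mul_eq_mul_div, le_div_iff₀ hJ0]
    exact_mod_cast hle
  obtain ⟨ρ, hρ, h1⟩ := hlab lab₁ I₁ hI₁
  obtain ⟨c, hc, h2⟩ := hlab lab₂ I₂ hI₂
  obtain ⟨out, inner, τ, rank, hz⟩ := hzig ρ hρ c hc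
  refine ⟨T ∩ walkEdges (fun x y ↦ S x y ∧ lab₁ x y ≠ ρ ∧ lab₂ x y ≠ c) 𝒮 r, inter_subset_left,
    (hz.hasHeads h𝒮).mono inter_subset_right, ?_⟩
  rw [add_mul]
  refine le_trans ?_ (add_le_add h1 h2)
  norm_cast
  refine le_trans (card_le_card ?_) (card_union_le _ _)
  intro e he
  obtain ⟨heT, hen⟩ := mem_sdiff.1 he
  obtain ⟨hI, hw, heq⟩ := hIw e heT
  by_contra hcon
  simp only [mem_union, mem_filter, heT, true_and, mem_image, mem_range, not_or, not_exists,
    not_and] at hcon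
  refine hen (mem_inter.2 ⟨heT, mem_walkEdges.2 ⟨(mem_walkEdges.1 (hT heT)).1, I e, hI, w e, ?_,
    heq⟩⟩)
  exact fun i hi ↦ ⟨hw i hi, hcon.1 i hi, hcon.2 i hi⟩

end WalkEdges

end EdgeFamily

/-! ### The template, and how a column and a junction cut it into zigzags. -/

namespace AbsorberTemplate

open Finset RandomSubset EdgeFamily

/-- The vertices of the template: position `j` in the row `l` of the gadget `g`, or the vertex that
the gadget `g` can absorb. -/
inductive Vertex
  | row (g l j : ℕ)
  | core (g : ℕ)
  deriving DecidableEq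

open Vertex

/-- The last vertex of row `(g, l)` is followed by the first vertex of row `(g', l')`: in one order
the rows `1, …, 2 * h + 1` of a gadget are traversed in increasing order, in the other order the rows
`1, …, 2 * h` are traversed in decreasing order before row `2 * h + 1`, which is also the row that
precedes the next gadget. -/
def Junction (h g l g' l' : ℕ) : Prop :=
  (g' = g ∧ l' = l + 1 ∧ 1 ≤ l ∧ l ≤ 2 * h) ∨ (g' = g ∧ l = l' + 1 ∧ 1 ≤ l' ∧ l' < 2 * h) ∨
    (g' = g + 1 ∧ l = 2 * h + 1 ∧ l' = 2 * h) ∨ (g' = g ∧ l = 1 ∧ l' = 2 * h + 1)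

/-- The arcs of the template: `y` follows `x` in one of the two orders. -/
def Arc (h M : ℕ) : Vertex → Vertex → Prop
  | row g l j, row g' l' j' =>
    (g' = g ∧ l' = l ∧ j' = j + 1 ∧ j' < M) ∨ (j + 1 = M ∧ j' = 0 ∧ Junction h g l g' l')
  | row g l j, core g' => j + 1 = M ∧ l = 2 * h + 1 ∧ g' = g + 1
  | core g, row g' l' j' => g' = g ∧ l' = 1 ∧ j' = 0
  | core _, core _ => False

/-- The position of the beginning of row `l` in the cycle of junctions of its gadget. -/
def startPos (h l : ℕ) : ℕ := if l % 2 = 1 then l else 2 * h + 1 + l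

/-- The position of the end of row `l` in the cycle of junctions of its gadget; the last row
belongs to the next gadget. -/
def endPos (h l : ℕ) : ℕ :=
  if l = 2 * h + 1 then 4 * h + 2 else if l % 2 = 0 then l else 2 * h + 1 + l

/-- The position in the cycle of junctions, cut after position `c`. -/
def cutPos (h c q : ℕ) : ℕ := if c < q then q else q + (4 * h + 3)

/-- The position inside the row of the second vertex of an arc. -/
def columnLabel : Vertex → Vertex → ℕ
  | _, row _ _ j => j
  | _, core _ => 0

/-- The position of an arc between different rows in the cycle of junctions. -/
def junctionLabel (h : ℕ) : Vertex → Vertex → ℕ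
  | row _ l _, row _ l' j' => if j' = 0 then min (endPos h l) (startPos h l') else 4 * h + 3
  | row _ _ _, core _ => 4 * h + 2
  | core _, _ => 0

/-- The vertex lies in the final part of a row, which starts at column `ρ`. -/
def IsOut (ρ : ℕ) : Vertex → Prop
  | row _ _ j => ρ ≤ j
  | core _ => False

/-- The vertex lies in the initial part of a row, which ends before column `ρ`. -/
def IsInner (ρ : ℕ) : Vertex → Prop
  | row _ _ j => j < ρ
  | core _ => False

/-- The position of the part of a row that contains the given vertex. -/
def armPos (h ρ c : ℕ) : Vertex → ℕ
  | row _ l j => if j < ρ then cutPos h c (startPos h l) else cutPos h c (endPos h l)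
  | core _ => 4 * h + 3

/-- The distance from the end of the row that lies in the same part as the given vertex. -/
def armDepth (M ρ : ℕ) : Vertex → ℕ
  | row _ _ j => if j < ρ then min j (M - 1) else M - 1 - j
  | core _ => 0

lemma armDepth_lt {M ρ : ℕ} (hM : 1 ≤ M) (x : Vertex) : armDepth M ρ x < M := by
  cases x <;> simp only [armDepth] <;> (try split_ifs) <;> omega

/-- The arcs that avoid a column and a junction. -/
def CutArc (h M ρ c : ℕ) (x y : Vertex) : Prop :=
  Arc h M x y ∧ columnLabel x y ≠ ρ ∧ junctionLabel h x y ≠ c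

/-- A junction joins cyclically consecutive positions, and cutting the cycle reverses their order
only at the cut itself. The end of a row directly precedes the start it is joined to exactly for the
increasing traversal. -/
lemma Junction.of_le {h g l g' l' c : ℕ} (hj : Junction h g l g' l')
    (hc : min (endPos h l) (startPos h l') ≠ c)
    (hle : cutPos h c (endPos h l) ≤ cutPos h c (startPos h l')) :
    g' = g ∧ l' = l + 1 ∧ 1 ≤ l ∧ l ≤ 2 * h := by
  rcases hj with hj | hj
  · exact hj
  · exfalso
    revert hc hle
    simp only [cutPos, startPos, endPos]
    split_ifs <;> omega

/-- The counterpart for the other traversal, where the start directly precedes the end. -/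
lemma Junction.of_ge {h g l g' l' c : ℕ} (hh : 1 ≤ h) (hj : Junction h g l g' l')
    (hc : min (endPos h l) (startPos h l') ≠ c)
    (hle : cutPos h c (startPos h l') ≤ cutPos h c (endPos h l)) :
    (g' = g ∧ l = l' + 1 ∧ 1 ≤ l' ∧ l' < 2 * h) ∨
      (g' = g + 1 ∧ l = 2 * h + 1 ∧ l' = 2 * h) ∨ (g' = g ∧ l = 1 ∧ l' = 2 * h + 1) := by
  rcases hj with hj | hj
  · exfalso
    revert hc hle
    simp only [cutPos, startPos, endPos]
    split_ifs <;> omega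
  · exact hj

lemma CutArc.row_row {h M ρ c g l j g' l' j' : ℕ} (hρ : 1 ≤ ρ) (hρM : ρ < M)
    (ha : CutArc h M ρ c (row g l j) (row g' l' j')) :
    (g' = g ∧ l' = l ∧ j' = j + 1) ∨
      (j + 1 = M ∧ j' = 0 ∧ Junction h g l g' l' ∧ min (endPos h l) (startPos h l') ≠ c ∧
        armPos h ρ c (row g l j) = cutPos h c (endPos h l) ∧
        armPos h ρ c (row g' l' j') = cutPos h c (startPos h l')) := by
  obtain ⟨h1, h2, h3⟩ := ha
  rcases h1 with ⟨h4, h5, h6, -⟩ | ⟨h4, rfl, h5⟩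
  · exact Or.inl ⟨h4, h5, h6⟩
  · refine Or.inr ⟨h4, rfl, h5, by simpa [junctionLabel] using h3, ?_, ?_⟩
    · simp only [armPos, if_neg (show ¬ j < ρ by omega)]
    · simp only [armPos, if_pos (show 0 < ρ from hρ)]

/-- Cutting column `ρ` splits each row into an initial arm at its start and a final arm at its end.
Around a gadget these arms and the core form one cycle of length 4h + 3: core, start of 1, end of 2,
start of 3, …, end of 2h, start of 2h+1, end of 1, start of 2, …, start of 2h, end of the last row
of the preceding gadget. Cutting it at `c` leaves a linear order of arms. The rank is lexicographic:
position of the arm, then distance from the junction. -/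
lemma isZigzag {h M ρ c : ℕ} (hh : 1 ≤ h) (hρ : 1 ≤ ρ) (hρM : ρ < M) (hc : c < 4 * h + 3) :
    IsZigzag (CutArc h M ρ c) (IsOut ρ) (IsInner ρ) (armPos h ρ c)
      (fun x ↦ armPos h ρ c x * M + armDepth M ρ x) where
  rank_lt a b hab := by
    have h1 := armDepth_lt (M := M) (ρ := ρ) (by omega) a
    have h2 : (armPos h ρ c a + 1) * M ≤ armPos h ρ c b * M := Nat.mul_le_mul_right M hab
    rw [add_mul] at h2
    omega
  out_out a b hab ha hb := by
    obtain ⟨h1, h2, h3⟩ := hab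
    rcases a with ⟨g, l, j⟩ | g <;> rcases b with ⟨g', l', j'⟩ | g' <;>
      simp only [Arc, IsOut, columnLabel] at h1 h2 ha hb
    rcases h1 with ⟨rfl, rfl, rfl, hM⟩ | ⟨h4, h5, -⟩
    · simp only [armPos, armDepth, if_neg (not_lt.2 ha), if_neg (not_lt.2 hb), true_and]
      omega
    · omega
  out_in a b hab ha hb := by
    obtain ⟨h1, h2, h3⟩ := hab
    rcases a with ⟨g, l, j⟩ | g <;> rcases b with ⟨g', l', j'⟩ | g' <;>
      simp only [Arc, IsOut, IsInner, columnLabel, junctionLabel, Junction] at h1 h2 h3 ha hb ⊢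
    · rcases h1 with ⟨rfl, rfl, rfl, hM⟩ | ⟨h4, rfl, h5⟩
      · omega
      · simp only [armPos, if_neg (not_lt.2 ha), if_pos (show 0 < ρ from hρ), cutPos, startPos,
          endPos, if_true] at h3 ⊢
        split_ifs at h3 ⊢ <;> omega
    · simp only [armPos, if_neg (not_lt.2 ha), cutPos, endPos]
      split_ifs <;> omega
  not_out a b hab ha := by
    obtain ⟨h1, h2, h3⟩ := hab
    rcases a with ⟨g, l, j⟩ | g <;> rcases b with ⟨g', l', j'⟩ | g' <;>
      simp only [Arc, IsOut, columnLabel, junctionLabel, not_le] at h1 h2 h3 ha ⊢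
    · rcases h1 with ⟨rfl, rfl, rfl, hM⟩ | ⟨h4, rfl, -⟩
      · have hj : j + 1 < ρ := by omega
        simp only [armPos, armDepth, if_pos ha, if_pos hj, le_refl, true_and]
        omega
      · omega
    · omega
    · obtain ⟨rfl, rfl, rfl⟩ := h1
      have hlt : armPos h ρ c (core g') < armPos h ρ c (row g' 1 0) := by
        simp only [armPos, if_pos (show 0 < ρ from hρ), cutPos, startPos]
        split_ifs <;> omega
      refine ⟨by omega, hlt.le, ?_⟩
      have h2 : (armPos h ρ c (core g') + 1) * M ≤ armPos h ρ c (row g' 1 0) * M :=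
        Nat.mul_le_mul_right M hlt
      rw [add_mul] at h2
      have h5 := armDepth_lt (M := M) (ρ := ρ) (by omega) (core g')
      omega
  inner_eq a b hab ha := by
    obtain ⟨h1, h2, h3⟩ := hab
    rcases a with ⟨g, l, j⟩ | g <;> rcases b with ⟨g', l', j'⟩ | g' <;>
      simp only [Arc, IsInner, columnLabel] at h1 h2 ha ⊢
    · rcases h1 with ⟨rfl, rfl, rfl, hM⟩ | ⟨h4, rfl, -⟩
      · have hj : j + 1 < ρ := by omega
        simp only [armPos, if_pos ha, if_pos hj, true_and]
        exact hj
      · omega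
    · omega
  inner_not_out a ha := by
    rcases a with ⟨g, l, j⟩ | g <;> simp only [IsInner, IsOut] at ha ⊢
    omega
  pred_unique a a' b hab hab' hτ hτ' := by
    rcases b with ⟨g, l, j⟩ | g
    · rcases a with ⟨ga, la, ja⟩ | ga <;> rcases a' with ⟨gb, lb, jb⟩ | gb
      · rcases hab.row_row hρ hρM with h1 | ⟨h1, h2, h3, h4, h5, h6⟩ <;>
          rcases hab'.row_row hρ hρM with h1' | ⟨h1', h2', h3', h4', h5', h6'⟩
        · simp only [row.injEq]; omega
        · omega
        · omega
        · rw [h5, h6] at hτ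
          rw [h5', h6'] at hτ'
          have := h3.of_le h4 hτ
          have := h3'.of_le h4' hτ'
          simp only [row.injEq]; omega
      · rcases hab.row_row hρ hρM with h1 | ⟨h1, h2, h3, h4, h5, h6⟩
        · have := hab'.1.2.2; omega
        · rw [h5, h6] at hτ
          have := h3.of_le h4 hτ
          have := hab'.1.2.1; omega
      · rcases hab'.row_row hρ hρM with h1 | ⟨h1, h2, h3, h4, h5, h6⟩
        · have := hab.1.2.2; omega
        · rw [h5, h6] at hτ'
          have := h3.of_le h4 hτ'
          have := hab.1.2.1; omega
      · rw [← hab.1.1, ← hab'.1.1]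
    · rcases a with ⟨ga, la, ja⟩ | ga
      · rcases a' with ⟨gb, lb, jb⟩ | gb
        · have h1 := hab.1
          have h2 := hab'.1
          simp only [Arc, row.injEq] at h1 h2 ⊢
          omega
        · exact hab'.1.elim
      · exact hab.1.elim
  succ_unique a b b' hab hab' hτ hτ' := by
    -- The core is always entered from a smaller arm, so it never competes as a lower successor.
    have henter : ∀ ga la ja g, CutArc h M ρ c (row ga la ja) (core g) →
        armPos h ρ c (core g) ≤ armPos h ρ c (row ga la ja) → False := by
      intro ga la ja g h1 h2
      obtain ⟨⟨h3, rfl, -⟩, -, h4⟩ := h1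
      simp only [armPos, if_neg (show ¬ ja < ρ by omega), cutPos, endPos, if_true,
        junctionLabel] at h2 h4
      split_ifs at h2 <;> omega
    rcases a with ⟨ga, la, ja⟩ | ga
    · rcases b with ⟨g, l, j⟩ | g
      · rcases b' with ⟨g', l', j'⟩ | g'
        · rcases hab.row_row hρ hρM with h1 | ⟨h1, h2, h3, h4, h5, h6⟩ <;>
            rcases hab'.row_row hρ hρM with h1' | ⟨h1', h2', h3', h4', h5', h6'⟩
          · simp only [row.injEq]; omega
          · have := hab.1; simp only [Arc] at this; omega
          · have := hab'.1; simp only [Arc] at this; omega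
          · rw [h5, h6] at hτ
            rw [h5', h6'] at hτ'
            have := h3.of_ge hh h4 hτ
            have := h3'.of_ge hh h4' hτ'
            simp only [row.injEq]; omega
        · exact (henter _ _ _ _ hab' hτ').elim
      · exact (henter _ _ _ _ hab hτ).elim
    · rcases b with ⟨g, l, j⟩ | g
      · rcases b' with ⟨g', l', j'⟩ | g'
        · have h1 := hab.1
          have h2 := hab'.1
          simp only [Arc, row.injEq] at h1 h2 ⊢
          omega
        · exact hab'.1.elim
      · exact hab.1.elim

/-- A list of vertices that contains all vertices joined to `x` by an arc, and `x` itself. -/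
def neighborList (h M : ℕ) : Vertex → List Vertex
  | row g l j => [row g l j, row g l (j + 1), row g (l + 1) 0, row g (l - 1) 0,
      row (g + 1) (2 * h) 0, row g (2 * h + 1) 0, core (g + 1), row g l (j - 1),
      row g (l - 1) (M - 1), row g (l + 1) (M - 1), row (g - 1) (2 * h + 1) (M - 1),
      row g 1 (M - 1), core g]
  | core g => [core g, row g 1 0, row (g - 1) (2 * h + 1) (M - 1)]

lemma length_neighborList_le (h M : ℕ) (x : Vertex) : (neighborList h M x).length ≤ 13 := by
  cases x <;> simp [neighborList]

lemma self_mem_neighborList (h M : ℕ) (x : Vertex) : x ∈ neighborList h M x := by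
  cases x <;> simp [neighborList]

lemma Arc.mem_neighborList {h M : ℕ} {x y : Vertex} (hxy : Arc h M x y) :
    y ∈ neighborList h M x ∧ x ∈ neighborList h M y := by
  rcases x with ⟨g, l, j⟩ | g <;> rcases y with ⟨g', l', j'⟩ | g'
  · rcases hxy with ⟨rfl, rfl, rfl, -⟩ | ⟨hM, rfl, hJ⟩
    · simp [neighborList]
    · obtain rfl : j = M - 1 := by omega
      rcases hJ with ⟨rfl, rfl, -⟩ | ⟨rfl, rfl, -⟩ | ⟨rfl, rfl, rfl⟩ | ⟨rfl, rfl, rfl⟩ <;>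
        simp [neighborList]
  · obtain ⟨hM, rfl, rfl⟩ := hxy
    obtain rfl : j = M - 1 := by omega
    simp [neighborList]
  · obtain ⟨rfl, rfl, rfl⟩ := hxy
    simp [neighborList]
  · exact hxy.elim

/-- The vertices of the template with `G` gadgets. -/
def vertexFinset (h M G : ℕ) : Finset Vertex :=
  (range M).image (fun j ↦ row 0 (2 * h + 1) j) ∪ (Icc 1 G).image core ∪
    (Icc 1 G ×ˢ Icc 1 (2 * h + 1) ×ˢ range M).image fun x ↦ row x.1 x.2.1 x.2.2

lemma row_mem_vertexFinset {h M G g l j : ℕ} : row g l j ∈ vertexFinset h M G ↔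
    j < M ∧ ((g = 0 ∧ l = 2 * h + 1) ∨ (1 ≤ g ∧ g ≤ G ∧ 1 ≤ l ∧ l ≤ 2 * h + 1)) := by
  simp only [vertexFinset, mem_union, mem_image, mem_range, mem_product, mem_Icc, Prod.exists,
    row.injEq, reduceCtorEq, and_false, exists_const, or_false]
  constructor
  · rintro (⟨_, h1, rfl, rfl, rfl⟩ | ⟨_, _, _, h1, rfl, rfl, rfl⟩) <;> omega
  · rintro ⟨h1, ⟨rfl, rfl⟩ | h2⟩
    · exact Or.inl ⟨j, h1, rfl, rfl, rfl⟩
    · exact Or.inr ⟨g, l, j, by omega, rfl, rfl, rfl⟩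

lemma core_mem_vertexFinset {h M G g : ℕ} : core g ∈ vertexFinset h M G ↔ 1 ≤ g ∧ g ≤ G := by
  simp [vertexFinset]

lemma card_vertexFinset_le (h M G : ℕ) :
    #(vertexFinset h M G) ≤ M + G + G * ((2 * h + 1) * M) := by
  refine (card_union_le _ _).trans (add_le_add ((card_union_le _ _).trans (add_le_add ?_ ?_)) ?_)
  · exact card_image_le.trans (card_range M).le
  · exact card_image_le.trans (by simp)
  · exact card_image_le.trans (by simp [card_product])

/-- The type of vertices of the template with `G` gadgets. -/
abbrev TVertex (h M G : ℕ) : Type := {x : Vertex // x ∈ vertexFinset h M G}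

/-- The arcs of the template with `G` gadgets. -/
def TArc (h M G : ℕ) (x y : TVertex h M G) : Prop := Arc h M x y

/-- The walk edges of the template form a sparse family. -/
lemma isSparse_template {h M G r k : ℕ} {𝒮 : Finset (Finset ℕ)} (hh : 1 ≤ h) (hM : 2 ≤ M)
    (hr : 2 ≤ r) (hrd : 3 ≤ r ∨ 2 ≤ #𝒮) (h𝒮 : ∀ I ∈ 𝒮, IsSymmetricShape I)
    (h𝒮k : ∀ I ∈ 𝒮, I.sup id ≤ k) :
    IsSparse (walkEdges (TArc h M G) 𝒮 r) r #𝒮 (2 ^ 13 ^ k)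
      ((3 * #𝒮 + 2) * (k / (M - 1 : ℕ) + k / (4 * h + 3 : ℕ))) := by
  have : Nonempty (TVertex h M G) :=
    ⟨⟨row 0 (2 * h + 1) 0, row_mem_vertexFinset.2 ⟨by omega, Or.inl ⟨rfl, rfl⟩⟩⟩⟩
  have := isSparse_walkEdges (S := TArc h M G) (r := r) (k := k) (Δ := 13) hr hrd h𝒮 h𝒮k
    (fun x ↦ ((neighborList h M x).toFinset).subtype _) (fun x ↦ ?_) (fun x ↦ ?_) (fun x y hxy ↦ ?_)
    -- Column label 0 and junction label 4h + 3 are left out of the ranges: they mark arcs into the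
    -- first vertex of a row or into a core, and arcs inside a row, respectively, and these must
    -- survive the other kind of cut.
    (fun x y ↦ columnLabel x y) (fun x y ↦ junctionLabel h x y) (Ico 1 M) (range (4 * h + 3))
    ⟨1, by simp; omega⟩ ⟨0, by simp⟩ (fun ρ hρ c hc ↦ ?_)
  · rwa [Nat.card_Ico, card_range] at this
  · rw [card_subtype]
    exact (card_filter_le _ _).trans ((List.toFinset_card_le _).trans (length_neighborList_le h M x))
  · simpa using self_mem_neighborList h M x
  · simpa using Arc.mem_neighborList hxy
  · rw [mem_Ico] at hρ
    rw [mem_range] at hc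
    have hz := isZigzag (c := c) hh hρ.1 hρ.2 hc
    exact ⟨fun x ↦ IsOut ρ x, fun x ↦ IsInner ρ x, fun x ↦ armPos h ρ c x, _,
      ⟨fun a b ↦ hz.rank_lt a b, fun a b ↦ hz.out_out a b, fun a b ↦ hz.out_in a b,
        fun a b ↦ hz.not_out a b, fun a b ↦ hz.inner_eq a b, fun a ↦ hz.inner_not_out a,
        fun a a' b h1 h2 h3 h4 ↦ Subtype.ext (hz.pred_unique a a' b h1 h2 h3 h4),
        fun a b b' h1 h2 h3 h4 ↦ Subtype.ext (hz.succ_unique a b b' h1 h2 h3 h4)⟩⟩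

end AbsorberTemplate

/-! ### The absorbing paths of the template. -/

namespace AbsorberTemplate

open Finset RandomSubset EdgeFamily

open Vertex

/-- The list `l` is a walk along arcs of the template from `a` to `b`. -/
structure Trail (h M : ℕ) (l : List Vertex) (a b : Vertex) : Prop where
  chain : l.IsChain (Arc h M)
  head : l.head? = some a
  last : l.getLast? = some b

lemma Trail.append {h M : ℕ} {l l' : List Vertex} {a b c d : Vertex} (hl : Trail h M l a b)
    (hl' : Trail h M l' c d) (hbc : Arc h M b c) : Trail h M (l ++ l') a d where
  chain := by
    refine List.isChain_append.2 ⟨hl.chain, hl'.chain, fun x hx y hy ↦ ?_⟩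
    rw [hl.last, Option.mem_some_iff] at hx
    rw [hl'.head, Option.mem_some_iff] at hy
    rwa [← hx, ← hy]
  head := by rw [List.head?_append, hl.head, Option.some_or]
  last := by rw [List.getLast?_append, hl'.last, Option.some_or]

/-- The vertices of a row, in order. -/
def rowList (M g l : ℕ) : List Vertex := (List.range M).map (row g l)

lemma mem_rowList {M g l : ℕ} {v : Vertex} : v ∈ rowList M g l ↔ ∃ j < M, row g l j = v := by
  simp [rowList]

lemma nodup_rowList (M g l : ℕ) : (rowList M g l).Nodup :=
  List.nodup_range.map fun i j hij ↦ by simpa using hij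

lemma trail_rowList {h M : ℕ} (hM : 1 ≤ M) (g l : ℕ) :
    Trail h M (rowList M g l) (row g l 0) (row g l (M - 1)) where
  chain := by
    rw [List.isChain_iff_getElem]
    intro i hi
    have hi' : i + 1 < M := by simpa [rowList] using hi
    simp only [rowList, List.getElem_map, List.getElem_range]
    exact Or.inl ⟨rfl, rfl, rfl, hi'⟩
  head := by
    rw [rowList, List.head?_map, List.head?_range, if_neg (by omega)]
    rfl
  last := by
    rw [rowList, List.getLast?_map, List.getLast?_range, if_neg (by omega)]
    rfl

/-- The rows `1, …, n` of a gadget in increasing order. -/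
def upRows (M g : ℕ) : ℕ → List Vertex
  | 0 => []
  | n + 1 => upRows M g n ++ rowList M g (n + 1)

/-- The rows `1, …, n` of a gadget in decreasing order. -/
def downRows (M g : ℕ) : ℕ → List Vertex
  | 0 => []
  | n + 1 => rowList M g (n + 1) ++ downRows M g n

lemma mem_upRows {M g n : ℕ} {v : Vertex} :
    v ∈ upRows M g n ↔ ∃ l j, 1 ≤ l ∧ l ≤ n ∧ j < M ∧ row g l j = v := by
  induction n with
  | zero => simp only [upRows, List.not_mem_nil, false_iff]; rintro ⟨l, j, h1, h2, -⟩; omega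
  | succ n ih =>
    rw [upRows, List.mem_append, ih, mem_rowList]
    constructor
    · rintro (⟨l, j, h1, h2, h3⟩ | ⟨j, h1, h2⟩)
      · exact ⟨l, j, h1, by omega, h3⟩
      · exact ⟨n + 1, j, by omega, le_rfl, h1, h2⟩
    · rintro ⟨l, j, h1, h2, h3, rfl⟩
      rcases Nat.lt_or_ge n l with h4 | h4
      · obtain rfl : l = n + 1 := by omega
        exact Or.inr ⟨j, h3, rfl⟩
      · exact Or.inl ⟨l, j, h1, h4, h3, rfl⟩

lemma downRows_perm_upRows (M g n : ℕ) : (downRows M g n).Perm (upRows M g n) := by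
  induction n with
  | zero => exact List.Perm.refl _
  | succ n ih => exact List.perm_append_comm.trans (ih.append_right _)

lemma nodup_upRows (M g n : ℕ) : (upRows M g n).Nodup := by
  induction n with
  | zero => exact List.nodup_nil
  | succ n ih =>
    refine List.nodup_append'.2 ⟨ih, nodup_rowList _ _ _, fun v hv hv' ↦ ?_⟩
    obtain ⟨l, j, h1, h2, h3, rfl⟩ := mem_upRows.1 hv
    obtain ⟨j', -, h4⟩ := mem_rowList.1 hv'
    simp only [row.injEq] at h4
    omega

lemma trail_upRows {h M : ℕ} (hM : 1 ≤ M) (g : ℕ) {n : ℕ} (hn : 1 ≤ n) (hnh : n ≤ 2 * h + 1) :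
    Trail h M (upRows M g n) (row g 1 0) (row g n (M - 1)) := by
  induction n, hn using Nat.le_induction with
  | base => simpa [upRows] using trail_rowList hM g 1
  | succ n hn ih =>
    exact (ih (by omega)).append (trail_rowList hM g (n + 1))
      (Or.inr ⟨by omega, rfl, Or.inl ⟨rfl, rfl, by omega, by omega⟩⟩)

lemma trail_downRows {h M : ℕ} (hM : 1 ≤ M) (g : ℕ) {n : ℕ} (hn : 1 ≤ n) (hnh : n ≤ 2 * h) :
    Trail h M (downRows M g n) (row g n 0) (row g 1 (M - 1)) := by
  induction n, hn using Nat.le_induction with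
  | base => simpa [downRows] using trail_rowList hM g 1
  | succ n hn ih =>
    exact (trail_rowList hM g (n + 1)).append (ih (by omega))
      (Or.inr ⟨by omega, rfl, Or.inr (Or.inl ⟨rfl, rfl, by omega, by omega⟩)⟩)

open Classical in
/-- The part of an absorbing path inside one gadget, where `Y` is the set of gadgets whose core is
to be avoided. -/
noncomputable def block (h M : ℕ) (Y : Set ℕ) (g : ℕ) : List Vertex :=
  if g ∈ Y then downRows M g (2 * h) ++ rowList M g (2 * h + 1)
  else core g :: upRows M g (2 * h + 1)

lemma mem_block {h M g : ℕ} {Y : Set ℕ} {v : Vertex} : v ∈ block h M Y g ↔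
    (∃ l j, 1 ≤ l ∧ l ≤ 2 * h + 1 ∧ j < M ∧ row g l j = v) ∨ (g ∉ Y ∧ v = core g) := by
  have hperm : (downRows M g (2 * h) ++ rowList M g (2 * h + 1)).Perm (upRows M g (2 * h + 1)) :=
    (downRows_perm_upRows M g (2 * h)).append_right _
  unfold block
  split_ifs with hg
  · rw [hperm.mem_iff, mem_upRows]
    simp [hg]
  · rw [List.mem_cons, mem_upRows]
    simp [hg, or_comm]

lemma nodup_block (h M g : ℕ) (Y : Set ℕ) : (block h M Y g).Nodup := by
  have hperm : (downRows M g (2 * h) ++ rowList M g (2 * h + 1)).Perm (upRows M g (2 * h + 1)) :=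
    (downRows_perm_upRows M g (2 * h)).append_right _
  unfold block
  split_ifs with hg
  · exact hperm.nodup_iff.2 (nodup_upRows _ _ _)
  · refine List.nodup_cons.2 ⟨fun hmem ↦ ?_, nodup_upRows _ _ _⟩
    obtain ⟨_, _, -, -, -, h1⟩ := mem_upRows.1 hmem
    exact Vertex.noConfusion h1

/-- The absorbing path of the template that avoids the cores in `Y`. -/
noncomputable def absorbingPath (h M : ℕ) (Y : Set ℕ) : ℕ → List Vertex
  | 0 => rowList M 0 (2 * h + 1)
  | G + 1 => absorbingPath h M Y G ++ block h M Y (G + 1)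

lemma mem_absorbingPath {h M G : ℕ} {Y : Set ℕ} {v : Vertex} : v ∈ absorbingPath h M Y G ↔
    v ∈ vertexFinset h M G ∧ ∀ g, v = core g → g ∉ Y := by
  induction G with
  | zero =>
    rw [absorbingPath, mem_rowList]
    rcases v with ⟨g, l, j⟩ | g
    · simp only [row_mem_vertexFinset, row.injEq, reduceCtorEq, false_imp_iff, implies_true,
        and_true]
      constructor
      · rintro ⟨j', h1, rfl, rfl, rfl⟩
        exact ⟨h1, Or.inl ⟨rfl, rfl⟩⟩
      · rintro ⟨h1, h2⟩
        exact ⟨j, h1, by omega, by omega, rfl⟩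
    · simp only [core_mem_vertexFinset, reduceCtorEq, and_false, exists_false, false_iff]
      omega
  | succ G ih =>
    rw [absorbingPath, List.mem_append, ih, mem_block]
    rcases v with ⟨g, l, j⟩ | g
    · simp only [row_mem_vertexFinset, row.injEq, reduceCtorEq, false_imp_iff, implies_true,
        and_true, and_false, or_false]
      constructor
      · rintro (h1 | ⟨l', j', h1, h2, h3, rfl, rfl, rfl⟩) <;> omega
      · intro h1
        by_cases hg : g ≤ G
        · left; omega
        · right; exact ⟨l, j, by omega, by omega, by omega, by omega, rfl, rfl⟩
    · simp only [core_mem_vertexFinset, core.injEq, forall_eq', reduceCtorEq, and_false,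
        exists_false, false_or]
      constructor
      · rintro (⟨h1, h2⟩ | ⟨h1, rfl⟩)
        · exact ⟨by omega, h2⟩
        · exact ⟨by omega, h1⟩
      · rintro ⟨h1, h2⟩
        by_cases hg : g ≤ G
        · exact Or.inl ⟨by omega, h2⟩
        · obtain rfl : g = G + 1 := by omega
          exact Or.inr ⟨h2, rfl⟩

lemma nodup_absorbingPath (h M G : ℕ) (Y : Set ℕ) : (absorbingPath h M Y G).Nodup := by
  induction G with
  | zero => exact nodup_rowList _ _ _
  | succ G ih =>
    refine List.nodup_append'.2 ⟨ih, nodup_block _ _ _ _, fun v hv hv' ↦ ?_⟩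
    have h1 := (mem_absorbingPath.1 hv).1
    rcases mem_block.1 hv' with ⟨l, j, h2, h3, h4, rfl⟩ | ⟨-, rfl⟩
    · rw [row_mem_vertexFinset] at h1
      omega
    · rw [core_mem_vertexFinset] at h1
      omega

/-- Both traversals attach to the last row of the preceding gadget and stop at the end of the same
row, so the choices in consecutive gadgets do not interact. -/
lemma trail_block {h M : ℕ} (hh : 1 ≤ h) (hM : 1 ≤ M) (Y : Set ℕ) (g : ℕ) :
    ∃ c, Arc h M (row g (2 * h + 1) (M - 1)) c ∧
      Trail h M (block h M Y (g + 1)) c (row (g + 1) (2 * h + 1) (M - 1)) := by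
  unfold block
  split_ifs with hg
  · refine ⟨row (g + 1) (2 * h) 0, Or.inr ⟨by omega, rfl, Or.inr (Or.inr (Or.inl ⟨rfl, rfl, rfl⟩))⟩,
      (trail_downRows hM (g + 1) (by omega) le_rfl).append (trail_rowList hM _ _)
      (Or.inr ⟨by omega, rfl, Or.inr (Or.inr (Or.inr ⟨rfl, rfl, rfl⟩))⟩)⟩
  · have hcore : Trail h M [core (g + 1)] (core (g + 1)) (core (g + 1)) :=
      ⟨List.isChain_singleton _, rfl, rfl⟩
    exact ⟨core (g + 1), ⟨by omega, rfl, rfl⟩,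
      hcore.append (trail_upRows hM (g + 1) (by omega) le_rfl) ⟨rfl, rfl, rfl⟩⟩

lemma trail_absorbingPath {h M : ℕ} (hh : 1 ≤ h) (hM : 1 ≤ M) (Y : Set ℕ) (G : ℕ) :
    Trail h M (absorbingPath h M Y G) (row 0 (2 * h + 1) 0) (row G (2 * h + 1) (M - 1)) := by
  induction G with
  | zero => exact trail_rowList hM _ _
  | succ G ih =>
    obtain ⟨c, h1, h2⟩ := trail_block hh hM Y G
    exact ih.append h2 h1

lemma prefix_absorbingPath (h M G : ℕ) (Y : Set ℕ) :
    rowList M 0 (2 * h + 1) <+: absorbingPath h M Y G := by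
  induction G with
  | zero => exact List.prefix_rfl
  | succ G ih => exact ih.trans (List.prefix_append _ _)

lemma suffix_absorbingPath (h M G : ℕ) (Y : Set ℕ) :
    rowList M G (2 * h + 1) <:+ absorbingPath h M Y G := by
  cases G with
  | zero => exact List.suffix_rfl
  | succ G =>
    refine List.IsSuffix.trans ?_ (List.suffix_append _ _)
    unfold block
    split_ifs
    · exact List.suffix_append _ _
    · exact (List.suffix_append _ _).trans (List.suffix_cons _ _)

/-- The absorbing paths as injective sequences of template vertices. -/
lemma exists_absorbing_sequence {h M G k : ℕ} (hh : 1 ≤ h) (hM : 1 ≤ M) (hk : 2 * k ≤ M)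
    (Y : Set ℕ) : ∃ (ℓ : ℕ) (f : ℕ → TVertex h M G), 2 * k ≤ ℓ ∧ Set.InjOn f (Set.Iio ℓ) ∧
      (∀ i, i + 1 < ℓ → TArc h M G (f i) (f (i + 1))) ∧
      (∀ v : TVertex h M G, (∃ i < ℓ, f i = v) ↔ ∀ g, (v : Vertex) = core g → g ∉ Y) ∧
      (∀ i < k, (f i : Vertex) = row 0 (2 * h + 1) i) ∧
      (∀ i < k, (f (ℓ - k + i) : Vertex) = row G (2 * h + 1) (M - k + i)) := by
  set L := absorbingPath h M Y G with hL
  have hrowlen : ∀ g l, (rowList M g l).length = M := fun g l ↦ by simp [rowList]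
  have hlen : M ≤ L.length := by
    simpa [hrowlen] using (prefix_absorbingPath h M G Y).length_le
  have hLpos : 0 < L.length := by omega
  have hmem : ∀ i (hi : i < L.length), L[i] ∈ vertexFinset h M G := fun i hi ↦
    (mem_absorbingPath.1 (List.getElem_mem hi)).1
  refine ⟨L.length, fun i ↦ if hi : i < L.length then ⟨L[i], hmem i hi⟩ else ⟨L[0], hmem 0 hLpos⟩,
    by omega, ?_, ?_, ?_, ?_, ?_⟩
  · intro i hi j hj hij
    rw [Set.mem_Iio] at hi hj
    simp only [dif_pos hi, dif_pos hj, Subtype.mk.injEq] at hij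
    exact (nodup_absorbingPath h M G Y).getElem_inj_iff.1 hij
  · intro i hi
    simp only [dif_pos hi, dif_pos (Nat.lt_of_succ_lt hi), TArc]
    exact (List.isChain_iff_getElem.1 (trail_absorbingPath hh hM Y G).chain) i hi
  · intro v
    have hv : (v : Vertex) ∈ L ↔ ∀ g, (v : Vertex) = core g → g ∉ Y := by
      rw [hL, mem_absorbingPath]
      exact and_iff_right v.2
    rw [← hv, List.mem_iff_getElem]
    constructor
    · rintro ⟨i, hi, rfl⟩
      simp only [dif_pos hi]
      exact ⟨i, hi, rfl⟩
    · rintro ⟨i, hi, h1⟩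
      refine ⟨i, hi, Subtype.ext ?_⟩
      simpa only [dif_pos hi] using h1
  · intro i hi
    obtain ⟨t, ht⟩ := prefix_absorbingPath h M G Y
    have hiM : i < (rowList M 0 (2 * h + 1)).length := by rw [hrowlen]; omega
    have : L[i]'(by omega) = row 0 (2 * h + 1) i := by
      simp only [hL, ← ht, List.getElem_append_left hiM]
      simp [rowList]
    simp only [dif_pos (show i < L.length by omega), this]
  · intro i hi
    obtain ⟨t, ht⟩ := suffix_absorbingPath h M G Y
    have hlt : L.length = t.length + M := by rw [hL, ← ht, List.length_append, hrowlen]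
    have : L[L.length - k + i]'(by omega) = row G (2 * h + 1) (M - k + i) := by
      have hle : t.length ≤ L.length - k + i := by omega
      simp only [hL, ← ht]
      rw [List.getElem_append_right (by simpa [hL, ← ht] using hle)]
      simp only [rowList, List.getElem_map, List.getElem_range, row.injEq, true_and]
      simp
      omega
    simp only [dif_pos (show L.length - k + i < L.length by omega), this]

end AbsorberTemplate

/-! ### From a copy of the template to an absorber. -/

namespace AbsorberTemplate

open Finset RandomSubset EdgeFamily

open Vertex Absorbing

variable {h M G k n : ℕ}

lemma row_zero_mem (hM : 2 * k ≤ M) (i : Fin k) : row 0 (2 * h + 1) i ∈ vertexFinset h M G :=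
  row_mem_vertexFinset.2 ⟨by have := i.2; omega, Or.inl ⟨rfl, rfl⟩⟩

lemma row_last_mem (hM : 2 * k ≤ M) (i : Fin k) :
    row G (2 * h + 1) (M - k + i) ∈ vertexFinset h M G :=
  row_mem_vertexFinset.2 ⟨by have := i.2; omega, by omega⟩

/-- The first `k` vertices of the template. -/
def firstTuple (hM : 2 * k ≤ M) : Fin k ↪ TVertex h M G where
  toFun i := ⟨row 0 (2 * h + 1) i, row_zero_mem hM i⟩
  inj' i j hij := by simpa [Fin.ext_iff] using hij

/-- The last `k` vertices of the template. -/
def lastTuple (hM : 2 * k ≤ M) : Fin k ↪ TVertex h M G where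
  toFun i := ⟨row G (2 * h + 1) (M - k + i), row_last_mem hM i⟩
  inj' i j hij := by simpa [Fin.ext_iff] using hij

lemma firstTuple_ne_lastTuple (hM : 2 * k ≤ M) (i j : Fin k) :
    firstTuple (h := h) (G := G) hM i ≠ lastTuple hM j := by
  intro hij
  have hv : row 0 (2 * h + 1) i = row G (2 * h + 1) (M - k + j) := congrArg Subtype.val hij
  rw [row.injEq] at hv
  have := i.2
  omega

/-- The vertices of the template that can be absorbed. -/
def cores (h M G : ℕ) : Set (TVertex h M G) := {v | ∃ g, (v : Vertex) = core g}

lemma ncard_cores (h M G : ℕ) : (cores h M G).ncard = G := by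
  have himg : Subtype.val '' cores h M G = core '' Set.Icc 1 G := by
    ext v
    constructor
    · rintro ⟨⟨v, hv⟩, ⟨g, rfl⟩, rfl⟩
      exact ⟨g, core_mem_vertexFinset.1 hv, rfl⟩
    · rintro ⟨g, hg, rfl⟩
      exact ⟨⟨core g, core_mem_vertexFinset.2 hg⟩, ⟨g, rfl⟩, rfl⟩
  rw [← Set.ncard_image_of_injective _ Subtype.val_injective, himg,
    Set.ncard_image_of_injective _ fun a b hab ↦ by simpa using hab, ← Finset.coe_Icc,
    Set.ncard_coe_finset, Nat.card_Icc]
  omega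

lemma firstTuple_notMem_cores (hM : 2 * k ≤ M) (i : Fin k) :
    firstTuple (h := h) (G := G) hM i ∉ cores h M G := by
  rintro ⟨g, hg⟩
  exact Vertex.noConfusion hg

lemma lastTuple_notMem_cores (hM : 2 * k ≤ M) (i : Fin k) :
    lastTuple (h := h) (G := G) hM i ∉ cores h M G := by
  rintro ⟨g, hg⟩
  exact Vertex.noConfusion hg

/-- For every set of cores there is a walk in the template that visits precisely the other
vertices. -/
lemma exists_sequence_avoiding (hh : 1 ≤ h) (hM : 1 ≤ M) (hk : 2 * k ≤ M)
    {Z : Set (TVertex h M G)} (hZ : Z ⊆ cores h M G) :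
    ∃ (ℓ : ℕ) (f : ℕ → TVertex h M G), 2 * k ≤ ℓ ∧ Set.InjOn f (Set.Iio ℓ) ∧
      (∀ i, i + 1 < ℓ → TArc h M G (f i) (f (i + 1))) ∧
      (∀ v, (∃ i < ℓ, f i = v) ↔ v ∉ Z) ∧
      (∀ i : Fin k, f i = firstTuple hk i) ∧ (∀ i : Fin k, f (ℓ - k + i) = lastTuple hk i) := by
  obtain ⟨ℓ, f, h1, h2, h3, h4, h5, h6⟩ := exists_absorbing_sequence (G := G) hh hM hk
    {g | ∃ v ∈ Z, (v : Vertex) = core g}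
  refine ⟨ℓ, f, h1, h2, h3, fun v ↦ (h4 v).trans ?_, fun i ↦ Subtype.ext (h5 i i.2),
    fun i ↦ Subtype.ext (h6 i i.2)⟩
  constructor
  · intro hv hvZ
    obtain ⟨g, hg⟩ := hZ hvZ
    exact hv g hg ⟨v, hvZ, hg⟩
  · rintro hv g hg ⟨v', hv', hg'⟩
    exact hv (Subtype.ext (hg.trans hg'.symm) ▸ hv')

/-- Every edge of an absorbing path arises in this way from a stretch of the path, so it is an edge
of the template whichever traversals the path uses. -/
lemma segment_mem_walkEdges {S : TVertex h M G → TVertex h M G → Prop} {𝒮 : Finset (Finset ℕ)}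
    {I : Finset ℕ} (hI : I ∈ 𝒮) {ℓ i : ℕ} {f : ℕ → TVertex h M G}
    (hinj : Set.InjOn f (Set.Iio ℓ)) (harc : ∀ i, i + 1 < ℓ → S (f i) (f (i + 1)))
    (hi : i + I.sup id < ℓ) : I.image (fun t ↦ f (i + t)) ∈ walkEdges S 𝒮 #I := by
  refine mem_walkEdges.2 ⟨card_image_of_injOn ?_, I, hI, fun t ↦ f (i + t), ?_, rfl⟩
  · intro s hs t ht hst
    have hs' : s ≤ I.sup id := le_sup (f := id) hs
    have ht' : t ≤ I.sup id := le_sup (f := id) ht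
    have := hinj (Set.mem_Iio.2 (by omega)) (Set.mem_Iio.2 (by omega)) hst
    omega
  · intro t ht
    exact harc (i + t) (by omega)

/-- The index sets of the edges of the `k`-th power of a path. -/
def pairShapes (k : ℕ) : Finset (Finset ℕ) := (Icc 1 k).image fun j ↦ {0, j}

lemma sup_pair (j : ℕ) : ({0, j} : Finset ℕ).sup id = j := by simp

lemma card_pairShapes (k : ℕ) : #(pairShapes k) = k := by
  rw [pairShapes, card_image_of_injective, Nat.card_Icc, Nat.add_sub_cancel]
  intro i j hij
  rw [← sup_pair i, ← sup_pair j]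
  exact congrArg (fun s : Finset ℕ ↦ s.sup id) hij

lemma sup_pairShapes_le (k : ℕ) : ∀ I ∈ pairShapes k, I.sup id ≤ k := by
  intro I hI
  obtain ⟨j, hj, rfl⟩ := mem_image.1 hI
  rw [sup_pair]
  exact (mem_Icc.1 hj).2

lemma isSymmetricShape_pairShapes (k : ℕ) : ∀ I ∈ pairShapes k, IsSymmetricShape I := by
  intro I hI
  obtain ⟨j, hj, rfl⟩ := mem_image.1 hI
  refine ⟨by simp, fun i hi ↦ ?_⟩
  rw [sup_pair]
  rcases mem_insert.1 hi with rfl | hi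
  · simp
  · rw [mem_singleton.1 hi]
    simp

lemma sup_range_succ (k : ℕ) : (range (k + 1)).sup id = k :=
  le_antisymm (Finset.sup_le fun _ hi ↦ Nat.lt_succ_iff.1 (mem_range.1 hi))
    (le_sup (f := id) (self_mem_range_succ k))

lemma isSymmetricShape_range (k : ℕ) : IsSymmetricShape (range (k + 1)) := by
  refine ⟨by simp, fun i _ ↦ ?_⟩
  rw [sup_range_succ, mem_range]
  omega

/-- A graph that contains a copy of the template for pairs contains an absorber. -/
lemma containsAbsorber_of_copy (hh : 1 ≤ h) (hM : 1 ≤ M) (hk : 2 * k ≤ M) (H : SimpleGraph (Fin n))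
    (hG : G = absorbSize n) (φ : TVertex h M G ↪ Fin n)
    (hn : 2 * Fintype.card (TVertex h M G) ≤ n)
    (hφ : ∀ x y, {x, y} ∈ walkEdges (TArc h M G) (pairShapes k) 2 →
      H.Adj (φ x) (φ y)) : ContainsAbsorber k n H := by
  set A : H.Subgraph :=
    { verts := Set.range φ
      Adj u v := ∃ x y, φ x = u ∧ φ y = v ∧ {x, y} ∈ walkEdges (TArc h M G) (pairShapes k) 2
      adj_sub := by
        rintro _ _ ⟨x, y, rfl, rfl, hxy⟩
        exact hφ x y hxy
      edge_vert := by
        rintro _ _ ⟨x, y, rfl, rfl, hxy⟩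
        exact ⟨x, rfl⟩
      symm := ⟨by
        rintro _ _ ⟨x, y, rfl, rfl, hxy⟩
        exact ⟨y, x, rfl, rfl, by rwa [pair_comm]⟩⟩ } with hA
  refine ⟨φ '' cores h M G, (firstTuple hk).trans φ, (lastTuple hk).trans φ, A, ?_, ?_, ?_,
    ⟨fun i ↦ ⟨_, rfl⟩, fun i ↦ ⟨_, rfl⟩, ?_, ?_, ?_⟩, ?_⟩
  · rw [Set.ncard_image_of_injective _ φ.injective, ncard_cores, hG]
  · rintro i ⟨v, hv, hvi⟩
    exact firstTuple_notMem_cores hk i (φ.injective hvi ▸ hv)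
  · rintro i ⟨v, hv, hvi⟩
    exact lastTuple_notMem_cores hk i (φ.injective hvi ▸ hv)
  · rw [Set.disjoint_left]
    rintro _ ⟨i, rfl⟩ ⟨j, hij⟩
    exact firstTuple_ne_lastTuple hk i j (φ.injective hij).symm
  · rintro _ ⟨v, -, rfl⟩
    exact ⟨v, rfl⟩
  · intro X' hX'
    obtain ⟨ℓ, f, hℓ, hinj, harc, hcov, hfirst, hlast⟩ := exists_sequence_avoiding (G := G)
      hh hM hk (Z := φ ⁻¹' X') fun v hv ↦ by
        obtain ⟨w, hw, hwv⟩ := hX' hv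
        exact φ.injective hwv ▸ hw
    have hAdj : ∀ i j, i < j → j ≤ i + k → j < ℓ → A.Adj (φ (f i)) (φ (f j)) := by
      intro i j hij hjk hj
      refine ⟨f i, f j, rfl, rfl, ?_⟩
      have hmem : ({0, j - i} : Finset ℕ) ∈ pairShapes k :=
        mem_image.2 ⟨j - i, mem_Icc.2 ⟨by omega, by omega⟩, rfl⟩
      have := segment_mem_walkEdges (i := i) hmem hinj harc (by rw [sup_pair]; omega)
      rw [card_pair (by omega), image_insert, image_singleton, add_zero,
        show i + (j - i) = j by omega] at this
      exact this
    set P : H.Subgraph :=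
      { verts := A.verts \ X'
        Adj u v := ∃ i j, i < ℓ ∧ j < ℓ ∧ φ (f i) = u ∧ φ (f j) = v ∧
          ((i < j ∧ j ≤ i + k) ∨ (j < i ∧ i ≤ j + k))
        adj_sub := by
          rintro _ _ ⟨i, j, hi, hj, rfl, rfl, h1 | h1⟩
          · exact A.adj_sub (hAdj i j h1.1 h1.2 hj)
          · exact (A.adj_sub (hAdj j i h1.1 h1.2 hi)).symm
        edge_vert := by
          rintro _ _ ⟨i, j, hi, hj, rfl, rfl, -⟩
          exact ⟨⟨_, rfl⟩, (hcov (f i)).1 ⟨i, hi, rfl⟩⟩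
        symm := ⟨by
          rintro _ _ ⟨i, j, hi, hj, h1, h2, h3⟩
          exact ⟨j, i, hj, hi, h2, h1, h3.symm⟩⟩ } with hP
    refine ⟨P, ⟨Set.sdiff_subset, ?_⟩, ⟨ℓ, hℓ, ?_⟩, rfl⟩
    · rintro _ _ ⟨i, j, hi, hj, rfl, rfl, h1 | h1⟩
      · exact hAdj i j h1.1 h1.2 hj
      · exact (hAdj j i h1.1 h1.2 hi).symm
    · have hbij : Function.Bijective (fun i : Fin ℓ ↦
          (⟨φ (f i), ⟨_, rfl⟩, (hcov (f i)).1 ⟨i, i.2, rfl⟩⟩ : P.verts)) := by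
        constructor
        · intro i j hij
          exact Fin.ext (hinj i.2 j.2 (φ.injective (congrArg Subtype.val hij)))
        · rintro ⟨_, ⟨v, rfl⟩, hv⟩
          obtain ⟨i, hi, rfl⟩ := (hcov v).2 hv
          exact ⟨⟨i, hi⟩, rfl⟩
      refine ⟨⟨Equiv.ofBijective _ hbij, ?_⟩, fun i ↦ congrArg φ (hfirst i),
        fun i ↦ congrArg φ (hlast i)⟩
      intro i j
      constructor
      · rintro ⟨i', j', hi', hj', h1, h2, h3⟩
        obtain rfl : i' = i := hinj hi' i.2 (φ.injective h1)
        obtain rfl : j' = j := hinj hj' j.2 (φ.injective h2)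
        exact h3
      · intro h3
        exact ⟨i, j, i.2, j.2, rfl, rfl, h3⟩
  · have hc : A.verts.ncard = Fintype.card (TVertex h M G) := by
      change (Set.range φ).ncard = _
      rw [← Set.image_univ, Set.ncard_image_of_injective _ φ.injective, Set.ncard_univ,
        Nat.card_eq_fintype_card]
    rw [hc, le_div_iff₀ two_pos, mul_comm]
    exact_mod_cast hn

/-- A hypergraph that contains a copy of the template for windows of length `k + 1` contains an
absorber. -/
lemma containsHyperAbsorber_of_copy (hh : 1 ≤ h) (hM : 1 ≤ M) (hk : 2 * k ≤ M)
    (E : Set (Set (Fin n))) (hG : G = absorbSize n) (φ : TVertex h M G ↪ Fin n)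
    (hn : 2 * Fintype.card (TVertex h M G) ≤ n)
    (hφ : ∀ e ∈ walkEdges (TArc h M G) {range (k + 1)} (k + 1),
      φ '' (e : Set (TVertex h M G)) ∈ E) :
    ContainsHyperAbsorber k n (hypergraphOfEdges E) := by
  set A : Hypergraph (Fin n) :=
    { vertexSet := Set.range φ
      edgeSet := {e | ∃ e₀ ∈ walkEdges (TArc h M G) {range (k + 1)} (k + 1),
        e = φ '' (e₀ : Set (TVertex h M G))}
      subset_vertexSet_of_mem_edgeSet' := by
        rintro _ ⟨e₀, -, rfl⟩
        exact Set.image_subset_range _ _ } with hA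
  refine ⟨φ '' cores h M G, (firstTuple hk).trans φ, (lastTuple hk).trans φ, A, ?_, ?_, ?_,
    ⟨Set.subset_univ _, ?_⟩, ⟨fun i ↦ ⟨_, rfl⟩, fun i ↦ ⟨_, rfl⟩, ?_, ?_, ?_⟩, ?_⟩
  · rw [Set.ncard_image_of_injective _ φ.injective, ncard_cores, hG]
  · rintro i ⟨v, hv, hvi⟩
    exact firstTuple_notMem_cores hk i (φ.injective hvi ▸ hv)
  · rintro i ⟨v, hv, hvi⟩
    exact lastTuple_notMem_cores hk i (φ.injective hvi ▸ hv)
  · rintro _ ⟨e₀, he₀, rfl⟩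
    exact hφ e₀ he₀
  · rw [Set.disjoint_left]
    rintro _ ⟨i, rfl⟩ ⟨j, hij⟩
    exact firstTuple_ne_lastTuple hk i j (φ.injective hij).symm
  · rintro _ ⟨v, -, rfl⟩
    exact ⟨v, rfl⟩
  · intro X' hX'
    obtain ⟨ℓ, f, hℓ, hinj, harc, hcov, hfirst, hlast⟩ := exists_sequence_avoiding (G := G)
      hh hM hk (Z := φ ⁻¹' X') fun v hv ↦ by
        obtain ⟨w, hw, hwv⟩ := hX' hv
        exact φ.injective hwv ▸ hw
    set F : Fin ℓ ↪ Fin n :=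
      ⟨fun i ↦ φ (f i), fun i j hij ↦ Fin.ext (hinj i.2 j.2 (φ.injective hij))⟩ with hF
    have hverts : ((tightPath k ℓ).image F).vertexSet = A.vertexSet \ X' := by
      ext u
      constructor
      · rintro ⟨i, -, rfl⟩
        exact ⟨⟨_, rfl⟩, (hcov (f i)).1 ⟨i, i.2, rfl⟩⟩
      · rintro ⟨⟨v, rfl⟩, hv⟩
        obtain ⟨i, hi, rfl⟩ := (hcov v).2 hv
        exact ⟨⟨i, hi⟩, Set.mem_univ _, rfl⟩
    refine ⟨(tightPath k ℓ).image F, ⟨hverts ▸ Set.sdiff_subset, ?_⟩,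
      ⟨ℓ, hℓ, F, rfl, fun i ↦ congrArg φ (hfirst i), fun i ↦ congrArg φ (hlast i)⟩, hverts⟩
    rintro _ ⟨_, ⟨i, hi, rfl⟩, rfl⟩
    have := segment_mem_walkEdges (i := i) (mem_singleton_self (range (k + 1))) hinj harc
      (by rw [sup_range_succ]; exact hi)
    rw [card_range] at this
    refine ⟨_, this, ?_⟩
    ext u
    constructor
    · rintro ⟨j, ⟨h1, h2⟩, rfl⟩
      refine ⟨f j, ?_, rfl⟩
      rw [coe_image]
      exact ⟨j - i, by simp; omega, congrArg f (by omega)⟩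
    · rintro ⟨v, hv, rfl⟩
      rw [coe_image] at hv
      obtain ⟨t, ht, rfl⟩ := hv
      have ht : t < k + 1 := by simpa using ht
      exact ⟨⟨i + t, by omega⟩, ⟨by simp, by simp; omega⟩, rfl⟩
  · have hc : A.vertexSet.ncard = Fintype.card (TVertex h M G) := by
      change (Set.range φ).ncard = _
      rw [← Set.image_univ, Set.ncard_image_of_injective _ φ.injective, Set.ncard_univ,
        Nat.card_eq_fintype_card]
    rw [hc, le_div_iff₀ two_pos, mul_comm]
    exact_mod_cast hn

end AbsorberTemplate

/-! ### Transfer to product measures. -/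

namespace RandomSubset

open Finset MeasureTheory ProbabilityTheory

/-- A lower bound for the probability, under `setBernoulli`, of an event that holds whenever the
image of the random set under a bijection is good. -/
lemma le_setBernoulli_real {α β : Type*} [Finite α] [DecidableEq β] {u : Set α} {E : Finset β}
    {g : α → β} (hg : Set.BijOn g u E) (p : unitInterval) (good : Finset β → Prop)
    [DecidablePred good] {𝓟 : Set (Set α)}
    (h𝓟 : ∀ W ⊆ E, good W → {a ∈ u | g a ∈ W} ∈ 𝓟) :
    1 - binomialExp E p (fun W ↦ if good W then 0 else 1) ≤ (setBernoulli u p).real 𝓟 := by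
  classical
  set s : Finset β → Set α := fun W ↦ {a ∈ u | g a ∈ W} with hs
  have himg : ∀ W ⊆ E, g '' s W = W := by
    intro W hW
    ext b
    constructor
    · rintro ⟨a, ⟨-, ha⟩, rfl⟩
      exact ha
    · intro hb
      obtain ⟨a, ha, rfl⟩ := hg.surjOn (hW hb)
      exact ⟨a, ⟨ha, hb⟩, rfl⟩
  have hncard : ∀ W ⊆ E, (s W).ncard = #W := by
    intro W hW
    rw [← (hg.injOn.mono (Set.sep_subset _ _)).ncard_image, himg W hW,
      Set.ncard_coe_finset]
  have hncard' : ∀ W ⊆ E, (u \ s W).ncard = #(E \ W) := by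
    intro W hW
    rw [Set.ncard_sdiff (Set.sep_subset _ _) (Set.toFinite _), hncard W hW,
      card_sdiff_of_subset hW, ← hg.injOn.ncard_image, hg.image_eq,
      Set.ncard_coe_finset]
  have hinj : Set.InjOn s (E.powerset.filter good) := by
    intro W hW W' hW' h
    have hW := mem_powerset.1 (mem_filter.1 hW).1
    have hW' := mem_powerset.1 (mem_filter.1 hW').1
    exact coe_injective (by rw [← himg W hW, ← himg W' hW', h])
  have h1 : binomialExp E p (fun W ↦ if good W then 0 else 1) +
      binomialExp E p (fun W ↦ if good W then 1 else 0) = 1 := by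
    rw [← binomialExp_add]
    refine Eq.trans (congrArg (binomialExp E p) (funext fun W ↦ ?_)) (binomialExp_const E p 1)
    split_ifs <;> simp
  have h2 : binomialExp E p (fun W ↦ if good W then 1 else 0) =
      ∑ x ∈ (E.powerset.filter good).image s, (setBernoulli u p).real {x} := by
    rw [sum_image hinj, binomialExp, sum_filter]
    refine sum_congr rfl fun W hW ↦ ?_
    rw [mem_powerset] at hW
    split_ifs
    · rw [setBernoulli_real_singleton p (Set.sep_subset _ _) (Set.toFinite u), hncard W hW,
        hncard' W hW, mul_one]
    · rw [mul_zero]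
  -- Only singletons need to be measurable; the event itself enters through monotonicity.
  have h3 : ∑ x ∈ (E.powerset.filter good).image s, (setBernoulli u p).real {x} ≤
      (setBernoulli u p).real 𝓟 := by
    rw [← measureReal_biUnion_finset (fun x _ y _ hxy ↦ by simpa using hxy)
      fun x _ ↦ measurableSet_singleton x]
    refine measureReal_mono ?_
    intro x hx
    simp only [Set.mem_iUnion, Set.mem_singleton_iff, exists_prop] at hx
    obtain ⟨y, hy, rfl⟩ := hx
    obtain ⟨W, hW, rfl⟩ := mem_image.1 hy
    exact h𝓟 W (mem_powerset.1 (mem_filter.1 hW).1) (mem_filter.1 hW).2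
  linarith

end RandomSubset

/-! ### Choice of parameters and asymptotics. -/

namespace AbsorberTemplate

open Finset Filter RandomSubset EdgeFamily Absorbing

lemma absorbSize_mul_le {n : ℕ} (hn : 4 ≤ n) :
    16 * (absorbSize n * Nat.log 2 n ^ 2) ≤ n := by
  have hℓ : 2 ≤ Nat.log 2 n := by
    have := Nat.log_mono_right (b := 2) hn
    simpa using (Nat.log_pow (b := 2) (by norm_num) 2).symm.le.trans this
  have hlog : (Nat.log 2 n : ℝ) ≤ Real.logb 2 n := by exact_mod_cast Real.natLog_le_logb n 2
  have hℓ' : (2 : ℝ) ≤ Nat.log 2 n := by exact_mod_cast hℓ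
  have h1 : (absorbSize n : ℝ) ≤ n / (16 * Real.logb 2 n ^ 2) := Nat.floor_le (by positivity)
  have h2 : (n : ℝ) / (16 * Real.logb 2 n ^ 2) ≤ n / (16 * (Nat.log 2 n : ℝ) ^ 2) := by gcongr
  have h3 := h1.trans h2
  rw [le_div_iff₀ (by positivity)] at h3
  have h4 : ((16 * (absorbSize n * Nat.log 2 n ^ 2) : ℕ) : ℝ) ≤ n := by
    push_cast
    linarith
  exact_mod_cast h4

/-- The template that absorbs `absorbSize n` vertices has at most `n / 2` vertices. -/
lemma two_mul_card_le {n : ℕ} (hn : 16 ≤ n) :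
    2 * Fintype.card (TVertex (Nat.log 2 n) (Nat.log 2 n) (absorbSize n)) ≤ n := by
  have h1 := absorbSize_mul_le (show 4 ≤ n by omega)
  set ℓ := Nat.log 2 n with hℓ
  set G := absorbSize n
  have hℓ4 : 4 ≤ ℓ := by
    have := Nat.log_mono_right (b := 2) hn
    simpa using (Nat.log_pow (b := 2) (by norm_num) 4).symm.le.trans this
  have hpow : ∀ m, 4 ≤ m → 4 * m ≤ 2 ^ m := by
    intro m hm
    induction m, hm using Nat.le_induction with
    | base => norm_num
    | succ m hm ih => rw [pow_succ]; omega
  have h2 : 4 * ℓ ≤ n := (hpow ℓ hℓ4).trans (Nat.pow_log_le_self 2 (by omega))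
  have h3 := card_vertexFinset_le ℓ ℓ G
  rw [Fintype.card_coe]
  have h4 : G + G * ((2 * ℓ + 1) * ℓ) ≤ 4 * (G * ℓ ^ 2) := by
    calc G + G * ((2 * ℓ + 1) * ℓ) = G * (1 + (2 * ℓ + 1) * ℓ) := by ring
      _ ≤ G * (4 * ℓ ^ 2) := Nat.mul_le_mul_left G (by nlinarith)
      _ = 4 * (G * ℓ ^ 2) := by ring
  omega

/-- With rows and gadgets of length about log n, the sparsity error is κ = O(1 / log n), so n ^ (κ /
(2d)) is bounded and θ is at most a constant times p⁻¹ n ^ (-1/d) ≤ (log⁸ n) ^ (-1/d). This tends to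
0 for each fixed d. -/
lemma exists_error_bound {k r : ℕ} {𝒮 : Finset (Finset ℕ)} (hr : 2 ≤ r)
    (hrd : 3 ≤ r ∨ 2 ≤ #𝒮) (h𝒮 : ∀ I ∈ 𝒮, IsSymmetricShape I) (h𝒮k : ∀ I ∈ 𝒮, I.sup id ≤ k)
    (h𝒮0 : 1 ≤ #𝒮) (p : ℕ → unitInterval)
    (hp : ∀ᶠ n : ℕ in atTop, 1 * Real.logb 2 n ^ 8 / n ≤ (p n : ℝ) ^ #𝒮) :
    ∃ err : ℕ → ℝ, Tendsto err atTop (nhds 0) ∧ ∀ᶠ n : ℕ in atTop,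
      binomialExp (univ.powersetCard r : Finset (Finset (Fin n))) (p n)
        (fun U ↦ if ∃ φ ∈ (univ : Finset
          (TVertex (Nat.log 2 n) (Nat.log 2 n) (absorbSize n) ↪ Fin n)),
          copy (walkEdges (TArc (Nat.log 2 n) (Nat.log 2 n) (absorbSize n)) 𝒮 r) φ ⊆ U
          then 0 else 1) ≤ err n := by
  set d := #𝒮 with hd
  set D : ℕ := 2 ^ 13 ^ k with hD
  have hD1 : 1 ≤ D := Nat.one_le_two_pow
  have hd0 : (0 : ℝ) < d := by exact_mod_cast h𝒮0
  -- The single factor 2 comes from q = p / 2, the power 2 ^ (3k(3d + 2)) bounds n ^ (κ / (2d)), and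
  -- the rest is the constant in the definition of θ for sparse families.
  set B : ℝ := 2 ^ (D * r) * (2 * ((2 : ℝ) ^ (3 * k * (3 * d + 2))) * (2 * (D * r)) ^ r) with hB
  set θ : ℕ → ℝ := fun n ↦ B * (Real.logb 2 n ^ 8) ^ (-(1 / d : ℝ)) with hθ
  have hlog : Tendsto (fun n : ℕ ↦ Real.logb 2 n) atTop atTop :=
    (Real.tendsto_logb_atTop (by norm_num)).comp tendsto_natCast_atTop_atTop
  have hθ0 : Tendsto θ atTop (nhds 0) := by
    have h1 : Tendsto (fun n : ℕ ↦ Real.logb 2 n ^ 8) atTop atTop :=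
      (tendsto_pow_atTop (by norm_num)).comp hlog
    have h2 := ((tendsto_rpow_neg_atTop (y := 1 / (d : ℝ)) (by positivity)).comp h1).const_mul B
    simpa [hθ] using h2
  refine ⟨fun n ↦ 2 * (Real.exp D * θ n) + 2 * (Real.exp 1 * θ n), ?_, ?_⟩
  · simpa using ((hθ0.const_mul (Real.exp D)).const_mul 2).add
      ((hθ0.const_mul (Real.exp 1)).const_mul 2)
  have hev1 : ∀ᶠ n in atTop, θ n ≤ 1 / 2 := hθ0.eventually_le_const (by norm_num)
  have hev2 : ∀ᶠ n in atTop, Real.exp D * θ n ≤ 1 := by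
    have := hθ0.const_mul (Real.exp D)
    rw [mul_zero] at this
    exact this.eventually_le_const one_pos
  filter_upwards [hp, hev1, hev2, eventually_ge_atTop 16] with n hpn h1 h2 hn
  set ℓ := Nat.log 2 n with hℓ
  have hℓ4 : 4 ≤ ℓ := by
    have := Nat.log_mono_right (b := 2) hn
    simpa using (Nat.log_pow (b := 2) (by norm_num) 4).symm.le.trans this
  have hn0 : (0 : ℝ) < n := by exact_mod_cast (by omega : 0 < n)
  have hlogpos : 0 < Real.logb 2 n := Real.logb_pos (by norm_num) (by exact_mod_cast (by omega))
  have hp0 : 0 < (p n : ℝ) := by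
    refine lt_of_le_of_ne (p n).2.1 fun h0 ↦ ?_
    rw [← h0, zero_pow (by omega)] at hpn
    have : 0 < 1 * Real.logb 2 n ^ 8 / n := by positivity
    linarith
  have hp1 : (p n : ℝ) ≤ 1 := (p n).2.2
  set κ : ℝ := (3 * d + 2) * (k / (ℓ - 1 : ℕ) + k / (4 * ℓ + 3 : ℕ)) with hκ
  have hsparse := isSparse_template (h := ℓ) (M := ℓ) (G := absorbSize n) (r := r) (k := k)
    (by omega) (by omega) hr hrd h𝒮 h𝒮k
  set θ' : ℝ := 2 ^ (D * r) *
      (((p n : ℝ) / 2)⁻¹ * (n : ℝ) ^ (-(1 / d : ℝ) + κ / (2 * d)) * (2 * (D * r)) ^ r) with hθ'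
  -- Columns contribute 2k because ℓ ≤ 2 (ℓ - 1), junctions contribute k because ℓ ≤ 4ℓ + 3.
  have hκle : κ * ℓ ≤ (3 * d + 2) * (3 * k) := by
    have e1 : (k : ℝ) / (ℓ - 1 : ℕ) * ℓ ≤ 2 * k := by
      rw [div_mul_eq_mul_div, div_le_iff₀ (by exact_mod_cast (by omega : 0 < ℓ - 1))]
      have : (ℓ : ℝ) ≤ 2 * (ℓ - 1 : ℕ) := by exact_mod_cast (by omega : ℓ ≤ 2 * (ℓ - 1))
      nlinarith [Nat.cast_nonneg (α := ℝ) k]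
    have e2 : (k : ℝ) / (4 * ℓ + 3 : ℕ) * ℓ ≤ k := by
      rw [div_mul_eq_mul_div, div_le_iff₀ (by positivity)]
      have : (ℓ : ℝ) ≤ (4 * ℓ + 3 : ℕ) := by exact_mod_cast (by omega : ℓ ≤ 4 * ℓ + 3)
      nlinarith [Nat.cast_nonneg (α := ℝ) k]
    rw [hκ, mul_assoc]
    refine mul_le_mul_of_nonneg_left ?_ (by positivity)
    rw [add_mul]
    linarith
  have hκ0 : 0 ≤ κ := by positivity
  have hnκ : (n : ℝ) ^ (κ / (2 * d)) ≤ 2 ^ (3 * k * (3 * d + 2)) := by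
    have e1 : (n : ℝ) ≤ 2 ^ ((2 : ℝ) * ℓ) := by
      have : n ≤ 2 ^ (2 * ℓ) :=
        (Nat.lt_pow_succ_log_self (by norm_num) n).le.trans
          (Nat.pow_le_pow_right (by norm_num) (by omega))
      rw [show (2 : ℝ) * ℓ = ((2 * ℓ : ℕ) : ℝ) by push_cast; ring, Real.rpow_natCast]
      exact_mod_cast this
    calc (n : ℝ) ^ (κ / (2 * d)) ≤ (2 ^ ((2 : ℝ) * ℓ)) ^ (κ / (2 * d)) :=
          Real.rpow_le_rpow hn0.le e1 (by positivity)
      _ = 2 ^ (κ * ℓ / d) := by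
          rw [← Real.rpow_mul (by norm_num)]
          congr 1
          field_simp
      _ ≤ 2 ^ ((3 * k * (3 * d + 2) : ℕ) : ℝ) := by
          refine Real.rpow_le_rpow_of_exponent_le (by norm_num) ?_
          rw [div_le_iff₀ hd0]
          push_cast
          have hd1 : (1 : ℝ) ≤ d := by exact_mod_cast h𝒮0
          have : 0 ≤ 3 * (k : ℝ) * (3 * d + 2) := by positivity
          nlinarith
      _ = 2 ^ (3 * k * (3 * d + 2)) := Real.rpow_natCast _ _
  have hpinv : (p n : ℝ)⁻¹ * (n : ℝ) ^ (-(1 / d : ℝ)) ≤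
      (Real.logb 2 n ^ 8) ^ (-(1 / d : ℝ)) := by
    rw [one_mul, div_le_iff₀ hn0] at hpn
    have e1 : (p n : ℝ)⁻¹ = ((p n : ℝ) ^ d) ^ (-(1 / d : ℝ)) := by
      rw [← Real.rpow_natCast, ← Real.rpow_mul hp0.le, ← Real.rpow_neg_one]
      congr 1
      field_simp
    rw [e1, ← Real.mul_rpow (by positivity) hn0.le]
    exact Real.rpow_le_rpow_of_nonpos (by positivity) hpn (by simp)
  have hle : θ' ≤ θ n := by
    rw [hθ', hθ, hB, Real.rpow_add hn0, inv_div]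
    calc (2 : ℝ) ^ (D * r) * (2 / (p n : ℝ) * ((n : ℝ) ^ (-(1 / d : ℝ)) *
          (n : ℝ) ^ (κ / (2 * d))) * (2 * (D * r)) ^ r)
        = 2 ^ (D * r) * (2 * (n : ℝ) ^ (κ / (2 * d)) * (2 * (D * r)) ^ r) *
          ((p n : ℝ)⁻¹ * (n : ℝ) ^ (-(1 / d : ℝ))) := by ring
      _ ≤ 2 ^ (D * r) * (2 * 2 ^ (3 * k * (3 * d + 2)) * (2 * (D * r)) ^ r) *
          (Real.logb 2 n ^ 8) ^ (-(1 / d : ℝ)) := by gcongr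
  have hmain := hsparse.binomialExp_not_contains_copy_le (W := Fin n) (q := p n / 2) (θ := θ')
    (by omega) h𝒮0 hD1 (by simpa using two_mul_card_le hn) (by simp; omega)
    (by positivity) (by linarith) (by rw [hθ', hκ, Fintype.card_fin]) (hle.trans h1)
    ((mul_le_mul_of_nonneg_left hle (Real.exp_pos _).le).trans h2)
  rw [mul_div_cancel₀ _ (two_ne_zero)] at hmain
  refine le_trans (by convert hmain) ?_
  gcongr

lemma tendsto_one_of_real {Ω : ℕ → Type*} [∀ n, MeasurableSpace (Ω n)]
    {μ : ∀ n, MeasureTheory.Measure (Ω n)} [∀ n, MeasureTheory.IsProbabilityMeasure (μ n)]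
    {s : ∀ n, Set (Ω n)} {err : ℕ → ℝ} (herr : Tendsto err atTop (nhds 0))
    (h : ∀ᶠ n in atTop, 1 - err n ≤ (μ n).real (s n)) :
    Tendsto (fun n ↦ μ n (s n)) atTop (nhds 1) := by
  have h1 : Tendsto (fun n ↦ (μ n).real (s n)) atTop (nhds 1) := by
    refine tendsto_of_tendsto_of_tendsto_of_le_of_le' (g := fun n ↦ 1 - err n) (h := fun _ ↦ 1) ?_
      tendsto_const_nhds h (Eventually.of_forall fun n ↦ MeasureTheory.measureReal_le_one)
    simpa using herr.const_sub 1
  have h2 := ENNReal.tendsto_ofReal h1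
  simpa using h2

end AbsorberTemplate

/-! ### The two random models. -/

namespace AbsorberTemplate

open Finset Filter RandomSubset EdgeFamily Absorbing MeasureTheory ProbabilityTheory

lemma bijOn_sym2_toFinset (V : Type*) [Fintype V] [DecidableEq V] :
    Set.BijOn (Sym2.toFinset (α := V)) Sym2.diagSetᶜ (univ.powersetCard 2 : Finset (Finset V)) := by
  refine ⟨fun z hz ↦ ?_, fun z _ w _ hzw ↦ ?_, fun e he ↦ ?_⟩
  · rw [mem_coe, mem_powersetCard_univ]
    exact Sym2.card_toFinset_of_not_isDiag z (by simpa using hz)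
  · ext x
    rw [← Sym2.mem_toFinset, hzw, Sym2.mem_toFinset]
  · obtain ⟨x, y, hxy, rfl⟩ := card_eq_two.1 (mem_powersetCard_univ.1 (mem_coe.1 he))
    exact ⟨s(x, y), by simpa using hxy, Sym2.toFinset_mk_eq⟩

lemma bijOn_set_toFinset (V : Type*) [Fintype V] (r : ℕ) :
    Set.BijOn (fun e : Set V ↦ (Set.toFinite e).toFinset) {e : Set V | e.ncard = r}
      (univ.powersetCard r : Finset (Finset V)) := by
  refine ⟨fun e he ↦ ?_, fun e _ f _ hef ↦ ?_, fun e he ↦ ?_⟩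
  · rw [mem_coe, mem_powersetCard_univ, ← Set.ncard_eq_toFinset_card e]
    exact he
  · simpa using hef
  · refine ⟨e, ?_, by ext; simp⟩
    rw [Set.mem_ofPred_eq, Set.ncard_coe_finset]
    exact mem_powersetCard_univ.1 (mem_coe.1 he)

lemma eventually_le_log (m : ℕ) : ∀ᶠ n : ℕ in atTop, m ≤ Nat.log 2 n := by
  filter_upwards [eventually_ge_atTop (2 ^ m)] with n hn
  simpa [Nat.log_pow] using Nat.log_mono_right (b := 2) hn

lemma tendsto_containsAbsorber {k : ℕ} (hk : 2 ≤ k) (p : ℕ → unitInterval)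
    (hp : ∀ᶠ n : ℕ in atTop, 1 * Real.logb 2 n ^ 8 / n ≤ (p n : ℝ) ^ k) :
    Tendsto (fun n : ℕ ↦ SimpleGraph.binomialRandom (Fin n) (p n) {G | ContainsAbsorber k n G})
      atTop (nhds 1) := by
  obtain ⟨err, herr, hle⟩ := exists_error_bound (𝒮 := pairShapes k) le_rfl
    (Or.inr (by rwa [card_pairShapes])) (isSymmetricShape_pairShapes k) (sup_pairShapes_le k)
    (by rw [card_pairShapes]; omega) p (by rwa [card_pairShapes])
  refine tendsto_one_of_real herr ?_
  filter_upwards [hle, eventually_le_log (2 * k), eventually_ge_atTop 16] with n hn hlog hn16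
  rw [measureReal_def, SimpleGraph.binomialRandom_apply', ← measureReal_def]
  refine (sub_le_sub_left hn 1).trans
    (le_setBernoulli_real (bijOn_sym2_toFinset (Fin n)) (p n) _ fun W hW ↦ ?_)
  rintro ⟨φ, -, hφ⟩
  refine ⟨SimpleGraph.fromEdgeSet {a ∈ Sym2.diagSetᶜ | a.toFinset ∈ W}, ?_, ?_⟩
  · refine containsAbsorber_of_copy (by omega) (by omega) hlog _ rfl φ (two_mul_card_le hn16)
      fun x y hxy ↦ ?_
    have hW' : {φ x, φ y} ∈ W := hφ (mem_copy.2 ⟨_, hxy, by simp⟩)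
    have hne : φ x ≠ φ y := by
      intro h
      have := mem_powersetCard_univ.1 (hW hW')
      simp [h] at this
    rw [SimpleGraph.fromEdgeSet_adj]
    exact ⟨⟨by simpa using hne, by rwa [Sym2.toFinset_mk_eq]⟩, hne⟩
  · rw [SimpleGraph.edgeSet_fromEdgeSet]
    refine sdiff_eq_left.2 ?_
    rw [Set.disjoint_left]
    intro a ha ha'
    exact ha.1 ha'

lemma tendsto_containsHyperAbsorber {k : ℕ} (hk : 2 ≤ k) (p : ℕ → unitInterval)
    (hp : ∀ᶠ n : ℕ in atTop, 1 * Real.logb 2 n ^ 8 / n ≤ (p n : ℝ)) :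
    Tendsto (fun n : ℕ ↦ binomialRandomEdges (Fin n) (k + 1) (p n)
      {E | ContainsHyperAbsorber k n (hypergraphOfEdges E)}) atTop (nhds 1) := by
  obtain ⟨err, herr, hle⟩ := exists_error_bound (k := k) (r := k + 1) (𝒮 := {range (k + 1)})
    (by omega) (Or.inl (by omega))
    (fun I hI ↦ by rw [mem_singleton.1 hI]; exact isSymmetricShape_range k)
    (fun I hI ↦ by rw [mem_singleton.1 hI]; exact (sup_range_succ k).le)
    (by simp) p (by simpa using hp)
  unfold binomialRandomEdges
  refine tendsto_one_of_real herr ?_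
  filter_upwards [hle, eventually_le_log (2 * k), eventually_ge_atTop 16] with n hn hlog hn16
  refine (sub_le_sub_left hn 1).trans
    (le_setBernoulli_real (bijOn_set_toFinset (Fin n) (k + 1)) (p n) _ fun W hW ↦ ?_)
  rintro ⟨φ, -, hφ⟩
  refine containsHyperAbsorber_of_copy (by omega) (by omega) hlog _ rfl φ (two_mul_card_le hn16)
    fun e he ↦ ?_
  have hW' : e.map φ ∈ W := hφ (mem_copy.2 ⟨e, he, rfl⟩)
  rw [← coe_map]
  refine ⟨?_, ?_⟩
  · rw [Set.mem_ofPred_eq, Set.ncard_coe_finset]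
    exact mem_powersetCard_univ.1 (hW hW')
  · simpa [map_eq_image] using hW'

end AbsorberTemplate

theorem lemma4p1 (k : ℕ) (hk : 2 ≤ k) :
    ∃ C : ℝ, 0 < C ∧
      (∀ p : ℕ → unitInterval,
        (∀ᶠ n : ℕ in Filter.atTop, C * Real.logb 2 n ^ 8 / n ≤ (p n : ℝ) ^ k) →
        Filter.Tendsto
          (fun n : ℕ => SimpleGraph.binomialRandom (Fin n) (p n)
            {G | Absorbing.ContainsAbsorber k n G})
          Filter.atTop (nhds 1)) ∧
      (∀ p : ℕ → unitInterval,
        (∀ᶠ n : ℕ in Filter.atTop, C * Real.logb 2 n ^ 8 / n ≤ (p n : ℝ)) →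
        Filter.Tendsto
          (fun n : ℕ => Absorbing.binomialRandomEdges (Fin n) (k + 1) (p n)
            {E | Absorbing.ContainsHyperAbsorber k n (Absorbing.hypergraphOfEdges E)})
          Filter.atTop (nhds 1)) :=
  -- No large constant is needed, since the logarithmic factor alone makes the error tend to 0.
  ⟨1, one_pos, AbsorberTemplate.tendsto_containsAbsorber hk,
    AbsorberTemplate.tendsto_containsHyperAbsorber hk⟩
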